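/- Let $C$ be an algebraically closed field of characteristic zero. A curve over a field $k$ means an integral, smooth, projective scheme of dimension one over $k$, with function field $k(X)$; a rational 1-form on $X$ is an element of $\Omega_{k(X)/k}$. A rational 1-form $\omega$ on a curve $X$ over $k$ (with $k$ of characteristic zero) is called - exact if $\omega = \mathrm{d}f$ for some $f \in k(X)$; - of exponential type if $\omega = \frac{\mathrm{d}f}{cf}$ for some $f \in k(X)^*$ and $c \in k^*$; - of Weierstrass type if $\omega = \frac{\mathrm{d}f}{g}$ for some $f, g \in k(X)$ with $g \neq 0$ and $g^2 = f^3 + af + b$, where $a, b \in k$ satisfy $4a^3 + 27b^2 \neq 0$; - of general type if it is neither exact, nor of exponential type, nor of Weierstrass type; - old if $\omega = m^*\eta$ for some non-constant morphism $m\colon X \to Y$ of curves over $k$ of degree $[k(X):k(Y)] \geq 2$ and some rational 1-form $\eta$ on $Y$. Let $X$ be a curve over $C$ and let $\omega \in \Omega_{C(X)/C}$ be a non-zero rational 1-form on $X$. Let $K \supset C$ be an arbitrary field extension, put $X_K := K \times_C X$ (a curve over $K$), and let $\omega_K$ denote $\omega$ regarded as a rational 1-form on $X_K$, i.e. its image in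 $\Omega_{K(X_K)/K}$. Then: 1. $\omega$ is exact if and only if $\omega_K$ is exact. 2. $\omega$ is of exponential type if and only if $\omega_K$ is of exponential type. 3. $\omega$ is of Weierstrass type if and only if $\omega_K$ is of Weierstrass type. 4. $\omega$ is of general type if and only if $\omega_K$ is of general type. 5. $\omega$ is old if and only if $\omega_K$ is old. -/

import Mathlib

open CategoryTheory CategoryTheory.Limits AlgebraicGeometry
open scoped TensorProduct

universe u

noncomputable section

namespace OneForms

/-! ### Base change of integral schemes over an algebraically closed field -/

theorem isDomain_tensor (C A K : Type u) [Field C] [IsAlgClosed C] [CommRing A] [IsDomain A]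
    [Algebra C A] [Algebra.FiniteType C A] [Field K] [Algebra C K] : IsDomain (A ⊗[C] K) := by
  classical
  let b := Module.Basis.ofVectorSpace C K
  let B := Algebra.TensorProduct.basis A b
  have hjac : IsJacobsonRing A := isJacobsonRing_of_finiteType (A := C)
  have key : ∀ x : A, (∀ χ : A →ₐ[C] C, χ x = 0) → x = 0 := by
    intro x hx
    have h0 : (⊥ : Ideal A).jacobson = ⊥ := by
      rw [← Ideal.radical_eq_jacobson]
      exact Ideal.radical_bot_of_isReduced
    rw [← Ideal.mem_bot, ← h0, Ideal.jacobson, Ideal.mem_sInf]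
    rintro m ⟨-, hm⟩
    let _ := Ideal.Quotient.field m
    have : Module.Finite C (A ⧸ m) := finite_of_finite_type_of_isJacobsonRing C (A ⧸ m)
    have hbij := IsAlgClosed.algebraMap_bijective_of_isIntegral (k := C) (K := A ⧸ m)
    let e := AlgEquiv.ofBijective (Algebra.ofId C (A ⧸ m)) hbij
    have := hx ((e.symm : (A ⧸ m) →ₐ[C] C).comp (Ideal.Quotient.mkₐ C m))
    simp only [AlgHom.comp_apply] at this
    rw [← Ideal.Quotient.eq_zero_iff_mem]
    exact (map_eq_zero_iff _ e.symm.injective).1 this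
  let ψ (χ : A →ₐ[C] C) : A ⊗[C] K →ₐ[C] K :=
    Algebra.TensorProduct.lift ((Algebra.ofId C K).comp χ) (AlgHom.id C K)
      (fun _ _ => Commute.all _ _)
  have hψ : ∀ (χ : A →ₐ[C] C) (z : A ⊗[C] K), ψ χ z = 0 → ∀ i, χ (B.repr z i) = 0 := by
    intro χ z hz
    have h1 : ψ χ z = Finsupp.sum (B.repr z) (fun i a => χ a • b i) := by
      conv_lhs => rw [← B.linearCombination_repr z, Finsupp.linearCombination_apply]
      rw [map_finsuppSum]
      refine Finsupp.sum_congr fun i _ => ?_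
      simp [ψ, B, Algebra.smul_def, Algebra.ofId_apply]
    rw [h1, Finsupp.sum] at hz
    have := (linearIndependent_iff'.1 b.linearIndependent) _ _ hz
    intro i
    by_cases hi : i ∈ (B.repr z).support
    · exact this i hi
    · simp [Finsupp.notMem_support_iff.1 hi]
  have : NoZeroDivisors (A ⊗[C] K) := by
    refine ⟨fun {y z} hyz => ?_⟩
    have hij : ∀ i j, B.repr y i * B.repr z j = 0 := by
      intro i j
      refine key _ fun χ => ?_
      have : ψ χ y * ψ χ z = 0 := by rw [← map_mul, hyz, map_zero]
      rcases mul_eq_zero.1 this with h | h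
      · rw [map_mul, hψ χ y h i, zero_mul]
      · rw [map_mul, hψ χ z h j, mul_zero]
    by_contra! hne
    have h1 : B.repr y ≠ 0 := fun h => hne.1 (B.repr.map_eq_zero_iff.1 h)
    have h2 : B.repr z ≠ 0 := fun h => hne.2 (B.repr.map_eq_zero_iff.1 h)
    obtain ⟨i, hi⟩ := Finsupp.ne_iff.1 h1
    obtain ⟨j, hj⟩ := Finsupp.ne_iff.1 h2
    exact (mul_ne_zero hi hj) (hij i j)
  exact NoZeroDivisors.to_isDomain _


theorem isIntegral_pullback_affine {C K : Type u} [Field C] [IsAlgClosed C] [Field K] [Algebra C K]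
    {R : CommRingCat.{u}} [IsDomain R] (s : Spec R ⟶ Spec (.of C)) [LocallyOfFiniteType s] :
    IsIntegral (pullback s (Spec.map (CommRingCat.ofHom (algebraMap C K)))) := by
  obtain ⟨φ, rfl⟩ := Spec.map_surjective s
  algebraize [φ.hom]
  have : Algebra.FiniteType C R :=
    (HasRingHomProperty.Spec_iff (P := @LocallyOfFiniteType) (φ := φ)).1 ‹_›
  have := isDomain_tensor C R K
  have : IsIntegral (Spec (.of (R ⊗[C] K))) := inferInstance
  exact IsIntegral.of_isIso (pullbackSpecIso C R K).inv

theorem isIntegral_pullback {C K : Type u} [Field C] [IsAlgClosed C] [Field K] [Algebra C K]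
    {X : Scheme.{u}} [IsIntegral X] (s : X ⟶ Spec (.of C)) [LocallyOfFiniteType s] :
    IsIntegral (pullback s (Spec.map (CommRingCat.ofHom (algebraMap C K)))) := by
  let g := Spec.map (CommRingCat.ofHom (algebraMap C K))
  let p := pullback.fst s g
  have : Surjective g := inferInstance
  have : Surjective p := inferInstance
  obtain ⟨𝒰, hdom⟩ : ∃ 𝒰 : X.OpenCover, ∀ i, ∃ (R : CommRingCat.{u}) (_ : IsDomain R),
      Nonempty (Spec R ≅ 𝒰.X i) := by
    refine ⟨Scheme.Cover.mkOfCovers X (fun x => Spec (X.affineOpenCover.X (X.affineOpenCover.idx x)))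
      (fun x => X.affineOpenCover.f (X.affineOpenCover.idx x)) (fun x => ⟨x, ?_⟩)
      (fun x => X.affineOpenCover.map_prop _),
      fun x => ⟨X.affineOpenCover.X (X.affineOpenCover.idx x), ?_, ⟨Iso.refl _⟩⟩⟩
    · exact X.affineOpenCover.covers x
    · obtain ⟨y, -⟩ := X.affineOpenCover.covers x
      have : Nonempty (Spec (X.affineOpenCover.X (X.affineOpenCover.idx x))) := ⟨y⟩
      have : IsOpenImmersion (X.affineOpenCover.f (X.affineOpenCover.idx x)) :=
        X.affineOpenCover.map_prop _
      exact (affine_isIntegral_iff _).1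
        (isIntegral_of_isOpenImmersion (X.affineOpenCover.f (X.affineOpenCover.idx x)))
  have hne : ∀ i, Nonempty (𝒰.X i) := fun i => by
    obtain ⟨R, _, ⟨e⟩⟩ := hdom i
    obtain ⟨y⟩ : Nonempty (Spec R) := inferInstance
    exact ⟨e.hom y⟩
  have hint₀ : ∀ i, IsIntegral (𝒰.X i) := fun i => isIntegral_of_isOpenImmersion (𝒰.f i)
  let 𝒱 : (pullback s g).OpenCover := 𝒰.pullback₁ p
  have hint : ∀ i, IsIntegral (𝒱.X i) := by
    intro i
    obtain ⟨R, _, ⟨e⟩⟩ := hdom i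
    have ho : IsOpenImmersion (𝒰.f i) := 𝒰.map_prop i
    have hi : IsIntegral (pullback (e.hom ≫ 𝒰.f i ≫ s) g) :=
      isIntegral_pullback_affine _
    let e₁ : pullback (e.hom ≫ 𝒰.f i ≫ s) g ≅ pullback (𝒰.f i ≫ s) g :=
      asIso (pullback.map _ _ _ _ e.hom (𝟙 _) (𝟙 _) (by simp) (by simp))
    let e₂ : pullback (𝒰.f i ≫ s) g ≅ 𝒱.X i :=
      (pullbackRightPullbackFstIso s g (𝒰.f i)).symm ≪≫ pullbackSymmetry (𝒰.f i) p
    exact IsIntegral.of_isIso (e₁ ≪≫ e₂).hom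
  have hred : IsReduced (pullback s g) := IsReduced.of_openCover _ 𝒱
  have hnon : Nonempty (pullback s g : Scheme.{u}) := by
    obtain ⟨x⟩ : Nonempty X := inferInstance
    obtain ⟨y, -⟩ := p.surjective x
    exact ⟨y⟩
  have hpre : PreirreducibleSpace (pullback s g : Scheme.{u}) := by
    refine PreirreducibleSpace.of_isOpenCover (U := fun i => p ⁻¹ᵁ (𝒰.f i).opensRange) ?_ ?_ ?_
    · intro i j _ hd
      obtain ⟨x, hx⟩ := nonempty_preirreducible_inter (𝒰.f i).opensRange.2 (𝒰.f j).opensRange.2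
        (by obtain ⟨x⟩ := hne i; exact ⟨_, x, rfl⟩) (by obtain ⟨x⟩ := hne j; exact ⟨_, x, rfl⟩)
      obtain ⟨y, rfl⟩ := p.surjective x
      have := disjoint_iff.1 hd
      have hy : y ∈ p ⁻¹ᵁ (𝒰.f i).opensRange ⊓ p ⁻¹ᵁ (𝒰.f j).opensRange := hx
      rw [this] at hy
      exact hy
    · rw [TopologicalSpace.IsOpenCover, eq_top_iff]
      intro y _
      obtain ⟨i, z, hz⟩ := 𝒰.exists_eq (p y)
      exact TopologicalSpace.Opens.mem_iSup.2 ⟨i, z, hz⟩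
    · intro i
      have h1 : ((p ⁻¹ᵁ (𝒰.f i).opensRange : (pullback s g).Opens) : Set (pullback s g : Scheme.{u}))
          = Set.range (𝒱.f i) := by
        exact (Scheme.Pullback.range_fst p (𝒰.f i)).symm
      have h2 : IsPreirreducible (Set.range (𝒱.f i)) := by
        rw [← Set.image_univ]
        have := hint i; have : IrreducibleSpace (𝒱.X i) := inferInstance
        exact (IrreducibleSpace.isIrreducible_univ _).2.image _ (𝒱.f i).continuous.continuousOn
      rw [← h1] at h2
      exact Subtype.preirreducibleSpace h2
  have : IrreducibleSpace (pullback s g : Scheme.{u}) := { toNonempty := hnon }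
  exact isIntegral_of_irreducibleSpace_of_isReduced _

/-! ### Kähler differentials along a commutative square -/

/-- The additive map `Ω[A⁄R] → Ω[B⁄S]`, `a d b ↦ φ a d (φ b)`, attached to a commutative square
formed by `φ : A → B` and the structure maps of the algebras `S/R`, `A/R`, `B/S`. -/
def formMap (R S : Type u) {A B : Type u} [CommRing R] [CommRing S] [CommRing A] [CommRing B]
    [Algebra R S] [Algebra R A] [Algebra S B] (φ : A →+* B)
    (h : ∀ c : R, φ (algebraMap R A c) = algebraMap S B (algebraMap R S c)) :
    Ω[A⁄R] →+ Ω[B⁄S] :=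
  letI : Algebra A B := φ.toAlgebra
  letI : Algebra R B := ((algebraMap S B).comp (algebraMap R S)).toAlgebra
  haveI : IsScalarTower R S B := IsScalarTower.of_algebraMap_eq fun _ => rfl
  haveI : IsScalarTower R A B := IsScalarTower.of_algebraMap_eq fun c => (h c).symm
  (KaehlerDifferential.map R S A B).toAddMonoidHom

theorem formMap_smul_D (R S : Type u) {A B : Type u} [CommRing R] [CommRing S] [CommRing A]
    [CommRing B] [Algebra R S] [Algebra R A] [Algebra S B] (φ : A →+* B)
    (h : ∀ c : R, φ (algebraMap R A c) = algebraMap S B (algebraMap R S c)) (a b : A) :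
    formMap R S φ h (a • KaehlerDifferential.D R A b) =
      φ a • KaehlerDifferential.D S B (φ b) := by
  let _ : Algebra A B := φ.toAlgebra
  let _ : Algebra R B := ((algebraMap S B).comp (algebraMap R S)).toAlgebra
  have : IsScalarTower R S B := IsScalarTower.of_algebraMap_eq fun _ => rfl
  have : IsScalarTower R A B := IsScalarTower.of_algebraMap_eq fun c => (h c).symm
  have key : KaehlerDifferential.map R S A B (a • KaehlerDifferential.D R A b) =
      algebraMap A B a • KaehlerDifferential.D S B (algebraMap A B b) := by
    rw [map_smul, KaehlerDifferential.map_D, algebraMap_smul]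
  exact key

/-! ### Rational functions and dominant morphisms -/

theorem map_genericPoint {X Y : Scheme.{u}} [IsIntegral X] [IsIntegral Y] (f : X ⟶ Y)
    [IsDominant f] : f (genericPoint X) = genericPoint Y := by
  have h := (genericPoint_spec X).image f.continuous
  rw [Set.image_univ, f.denseRange.closure_range] at h
  exact h.eq (genericPoint_spec Y)

/-- The pull-back `g ↦ g ∘ f` of rational functions along a dominant morphism `f : X ⟶ Y` of
integral schemes: the map on stalks at the generic point. -/
def pullbackFun {X Y : Scheme.{u}} [IsIntegral X] [IsIntegral Y] (f : X ⟶ Y) [IsDominant f] :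
    Y.functionField →+* X.functionField :=
  (Y.presheaf.stalkSpecializes (specializes_of_eq (map_genericPoint f)) ≫
    f.stalkMap (genericPoint X)).hom

theorem pullbackFun_germ {X Y : Scheme.{u}} [IsIntegral X] [IsIntegral Y] (f : X ⟶ Y)
    [IsDominant f] (s : Γ(Y, ⊤)) :
    pullbackFun f (Y.presheaf.germ ⊤ (genericPoint Y) (TopologicalSpace.Opens.mem_top _) s) =
      X.presheaf.germ ⊤ (genericPoint X) (TopologicalSpace.Opens.mem_top _) (f.appTop s) := by
  have h : Y.presheaf.germ ⊤ (genericPoint Y) (TopologicalSpace.Opens.mem_top _) ≫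
      Y.presheaf.stalkSpecializes (specializes_of_eq (map_genericPoint f)) ≫
        f.stalkMap (genericPoint X) =
      f.appTop ≫ X.presheaf.germ ⊤ (genericPoint X) (TopologicalSpace.Opens.mem_top _) := by
    rw [TopCat.Presheaf.germ_stalkSpecializes_assoc, Scheme.Hom.germ_stalkMap]
    rfl
  exact congr($(h).hom s)

/-! ### Curves -/

/-- A curve over a field `k`: an integral scheme, smooth of relative dimension one and proper over
`k` (for schemes of dimension one over a field, proper is the same as projective). -/
structure Curve (k : Type u) [Field k] where
  scheme : Scheme.{u}
  toSpec : scheme ⟶ Spec (.of k)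
  [integral : IsIntegral scheme]
  [smooth : SmoothOfRelativeDimension 1 toSpec]
  [proper : IsProper toSpec]

namespace Curve

attribute [instance] Curve.integral Curve.smooth Curve.proper

variable {k : Type u} [Field k]

/-- The field `k(X)` of rational functions on the curve `X` over `k`. -/
def functionField (X : Curve k) : Type u := X.scheme.functionField

instance (X : Curve k) : Field X.functionField :=
  inferInstanceAs (Field X.scheme.functionField)

/-- Elements of `k` as constant rational functions. -/
instance (X : Curve k) : Algebra k X.functionField :=
  RingHom.toAlgebra ((Scheme.ΓSpecIso (.of k)).inv ≫ X.toSpec.appTop ≫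
    X.scheme.presheaf.germ ⊤ (genericPoint X.scheme) (TopologicalSpace.Opens.mem_top _)).hom

/-- The rational 1-forms on the curve `X` over `k`, i.e. `Ω_{k(X)/k}`. -/
abbrev Form (X : Curve k) : Type u := Ω[X.functionField⁄k]

/-- The differential `df` of a rational function `f`. -/
abbrev d (X : Curve k) (f : X.functionField) : X.Form :=
  KaehlerDifferential.D k X.functionField f

/-- Compatibility of the pull-back of rational functions with constants. -/
theorem pullbackFun_algebraMap {k l : Type u} [Field k] [Field l] [Algebra k l] (X : Curve k)
    (Y : Curve l) (f : Y.scheme ⟶ X.scheme) [IsDominant f]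
    (w : f ≫ X.toSpec = Y.toSpec ≫ Spec.map (CommRingCat.ofHom (algebraMap k l))) (c : k) :
    pullbackFun f (algebraMap k X.functionField c) =
      algebraMap l Y.functionField (algebraMap k l c) := by
  have h : (Scheme.ΓSpecIso (.of k)).inv ≫ X.toSpec.appTop ≫ f.appTop =
      CommRingCat.ofHom (algebraMap k l) ≫ (Scheme.ΓSpecIso (.of l)).inv ≫ Y.toSpec.appTop := by
    rw [← Scheme.Hom.comp_appTop, w, Scheme.Hom.comp_appTop, Scheme.ΓSpecIso_inv_naturality_assoc]
  refine (pullbackFun_germ f _).trans ?_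
  exact congrArg
    (Y.scheme.presheaf.germ ⊤ (genericPoint Y.scheme) (TopologicalSpace.Opens.mem_top _)).hom
    (congrArg (fun φ => φ.hom c) h)

/-- A non-constant (equivalently, dominant) morphism of curves over `k`. -/
structure NonconstHom (X Y : Curve k) where
  hom : X.scheme ⟶ Y.scheme
  w : hom ≫ Y.toSpec = X.toSpec
  [dominant : IsDominant hom]

attribute [instance] NonconstHom.dominant

namespace NonconstHom

variable {X Y : Curve k}

/-- The inclusion of function fields `k(Y) → k(X)` induced by `m : X → Y`. -/
def onFun (m : NonconstHom X Y) : Y.functionField →+* X.functionField := pullbackFun m.hom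

theorem onFun_algebraMap (m : NonconstHom X Y) (c : k) :
    m.onFun (algebraMap k Y.functionField c) =
      algebraMap k X.functionField (algebraMap k k c) :=
  pullbackFun_algebraMap Y X m.hom (by
    have : CommRingCat.ofHom (algebraMap k k) = 𝟙 (CommRingCat.of k) := rfl
    rw [this, Spec.map_id, Category.comp_id, m.w]) c

/-- The degree `[k(X) : k(Y)]` of a non-constant morphism `X → Y`. -/
def degree (m : NonconstHom X Y) : ℕ :=
  letI : Algebra Y.functionField X.functionField := m.onFun.toAlgebra
  Module.finrank Y.functionField X.functionField

/-- The pull-back `m^*ω` of a rational 1-form. -/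
def pullbackForm (m : NonconstHom X Y) : Y.Form →+ X.Form :=
  formMap k k m.onFun m.onFun_algebraMap

end NonconstHom

/-! ### Types of 1-forms -/

/-- `ω = df` for some rational function `f`. -/
def IsExact (X : Curve k) (ω : X.Form) : Prop := ∃ f : X.functionField, ω = X.d f

/-- `ω = df / (c f)` for some rational function `f` and constant `c ≠ 0`. -/
def IsExponential (X : Curve k) (ω : X.Form) : Prop :=
  ∃ (f : X.functionField) (c : k), f ≠ 0 ∧ c ≠ 0 ∧
    ω = (algebraMap k X.functionField c * f)⁻¹ • X.d f

/-- `ω = df / g` with `g² = f³ + a f + b` for constants `a`, `b` with `4a³ + 27b² ≠ 0`. -/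
def IsWeierstrass (X : Curve k) (ω : X.Form) : Prop :=
  ∃ (f g : X.functionField) (a b : k), g ≠ 0 ∧ 4 * a ^ 3 + 27 * b ^ 2 ≠ 0 ∧
    g ^ 2 = f ^ 3 + algebraMap k X.functionField a * f + algebraMap k X.functionField b ∧
    ω = g⁻¹ • X.d f

/-- `ω` is neither exact, nor of exponential type, nor of Weierstrass type. -/
def IsGeneral (X : Curve k) (ω : X.Form) : Prop :=
  ¬ X.IsExact ω ∧ ¬ X.IsExponential ω ∧ ¬ X.IsWeierstrass ω

/-- `ω` is a proper pull-back: `ω = m^*η` for a morphism `m : X → Y` of degree at least two to a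
curve `Y` over `k` and a rational 1-form `η` on `Y`. -/
def IsOld (X : Curve k) (ω : X.Form) : Prop :=
  ∃ (Y : Curve k) (m : NonconstHom X Y) (η : Y.Form), 2 ≤ m.degree ∧ m.pullbackForm η = ω

/-! ### Base change -/

variable (K : Type u) [Field K] [Algebra k K]

/-- The curve `X_K = K ×_k X` over `K`. -/
def baseChange [IsAlgClosed k] (X : Curve k) : Curve K :=
  haveI : Smooth X.toSpec := SmoothOfRelativeDimension.smooth 1 X.toSpec
  { scheme := pullback X.toSpec (Spec.map (CommRingCat.ofHom (algebraMap k K)))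
    toSpec := pullback.snd _ _
    integral := isIntegral_pullback X.toSpec
    smooth := (smoothOfRelativeDimension_isStableUnderBaseChange 1).of_isPullback
      (IsPullback.of_hasPullback _ _) X.smooth
    proper := inferInstance }

variable [IsAlgClosed k]

/-- The projection `X_K → X`. -/
def proj (X : Curve k) : (X.baseChange K).scheme ⟶ X.scheme := pullback.fst _ _

instance (X : Curve k) : IsDominant (X.proj K) :=
  haveI : Surjective (Spec.map (CommRingCat.ofHom (algebraMap k K))) := inferInstance
  inferInstanceAs
    (IsDominant (pullback.fst X.toSpec (Spec.map (CommRingCat.ofHom (algebraMap k K)))))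

/-- The inclusion `k(X) → K(X_K)` of function fields. -/
def baseChangeFun (X : Curve k) : X.functionField →+* (X.baseChange K).functionField :=
  pullbackFun (X.proj K)

theorem baseChangeFun_algebraMap (X : Curve k) (c : k) :
    X.baseChangeFun K (algebraMap k X.functionField c) =
      algebraMap K (X.baseChange K).functionField (algebraMap k K c) :=
  pullbackFun_algebraMap X (X.baseChange K) (X.proj K) pullback.condition c

/-- A rational 1-form `ω` on `X`, regarded as a rational 1-form `ω_K` on `X_K`. -/
def baseChangeForm (X : Curve k) : X.Form →+ (X.baseChange K).Form :=
  formMap k K (X.baseChangeFun K) (X.baseChangeFun_algebraMap K)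

end Curve

end OneForms

end

/-! Passing from `C` to `K` is formal, because pull-back of functions commutes with `d`. For old
forms one must also see that a base-changed morphism still has degree at least two
(`IsFracTensor.surjective_of_surjective`).

Descent from `K` to `C` is a specialization argument. By the Nullstellensatz every finitely
generated `C`-subalgebra of `K` has a `C`-point. Along an ultrafilter on the finite subsets of `K`
these points assemble into a homomorphism `σ` from `K` to an ultrapower of `C`, diagonal on `C`
(`exists_hom_ultrapower`). The field `K(X_K)` is the fraction field of `C(X) ⊗ K`
(`Curve.isFracTensor`), and linear disjointness makes the induced map from this tensor product to
the ultrapower of `C(X)` injective. It therefore extends to a homomorphism `Φ` on `K(X_K)` which is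
diagonal on `C(X)` and sends constants to constants. An identity between functions or differentials
over `K` then holds at almost every index (`Specialization.eventually_form_eq`), and finitely many
such conditions hold at one common index. This settles the exact, exponential and Weierstrass types,
and with them the general type.

For old forms, write `ω_K = u dv` with `u`, `v` in a proper subfield `E` of `K(X_K)`, and `E = K(v,
w)`. At a good index `i` the form `ω` is `u_i dv_i` with `u_i` in `E_i = C(v_i, w_i)`. The point is
that `E_i` is still proper (`Specialization.exists_old`). Let `d = [E : K(v)]` and let `θ` in `C(X)`
generate `K(X_K)` over `K(v)`. The monomials in `v` and `θ` of degree at most `d` in `θ` and at most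
`n = [C(X) : C(θ)]` in `v` are independent over `K`, and stay independent over `C` after
specialization. If `E_i` were everything, `θ` would have degree at most `d` over `C(v_i)`, and
Gauss's lemma would give an algebraic relation of degrees at most `d` and `n`
(`not_linearIndependent_monomials`), a contradiction.

It remains to turn the subfield `E_i` into a morphism of curves. A complete smooth curve with
function field `E_i` is the normalization of the projective line in `E_i`, glued from two affine
charts (`exists_curve`). Field inclusions come from morphisms by the valuative criterion, as the
local rings of a smooth curve are valuation rings (`Curve.exists_nonconstHom`). -/

noncomputable section

namespace OneForms

/-! ### Ultrapowers -/

section Ultrapower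

variable {I : Type*} (U : Ultrafilter I)

/-- The map of ultrapowers induced by a ring homomorphism. -/
def germMap {R S : Type*} [CommRing R] [CommRing S] (f : R →+* S) :
    (U : Filter I).Germ R →+* (U : Filter I).Germ S where
  toFun := Filter.Germ.map f
  map_one' := congrArg Filter.Germ.ofFun (funext fun _ => f.map_one)
  map_zero' := congrArg Filter.Germ.ofFun (funext fun _ => f.map_zero)
  map_mul' a b := Filter.Germ.inductionOn₂ a b fun _ _ =>
    congrArg Filter.Germ.ofFun (funext fun _ => f.map_mul _ _)
  map_add' a b := Filter.Germ.inductionOn₂ a b fun _ _ =>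
    congrArg Filter.Germ.ofFun (funext fun _ => f.map_add _ _)

theorem germMap_coe {R S : Type*} [CommRing R] [CommRing S] (f : R →+* S) (x : I → R) :
    germMap U f (x : (U : Filter I).Germ R) = ((fun i => f (x i) : I → S) : (U : Filter I).Germ S) :=
  rfl

/-- The diagonal embedding into an ultrapower. -/
def germConst (R : Type*) [CommRing R] : R →+* (U : Filter I).Germ R where
  toFun r := (fun _ => r : I → R)
  map_one' := rfl
  map_zero' := rfl
  map_mul' _ _ := rfl
  map_add' _ _ := rfl

theorem germConst_apply {R : Type*} [CommRing R] (r : R) :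
    germConst U R r = ((fun _ => r : I → R) : (U : Filter I).Germ R) := rfl

theorem germ_sum_coe {R ι : Type*} [CommRing R] (s : Finset ι) (f : ι → I → R) :
    ∑ j ∈ s, (f j : (U : Filter I).Germ R) =
      ((fun i => ∑ j ∈ s, f j i : I → R) : (U : Filter I).Germ R) := by
  classical
  induction s using Finset.induction_on with
  | empty => simp; rfl
  | insert a s ha ih => rw [Finset.sum_insert ha, ih]; simp_rw [Finset.sum_insert ha]; rfl

/-- Elements linearly independent over `C` remain so over the ultrapower of `C`. -/
theorem germ_linearIndependent {C L ι : Type*} [Field C] [Field L] [Algebra C L] {b : ι → L}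
    (hb : LinearIndependent C b) (s : Finset ι) (c : ι → (U : Filter I).Germ C)
    (h : ∑ j ∈ s, germMap U (algebraMap C L) (c j) * germConst U L (b j) = 0) :
    ∀ j ∈ s, c j = 0 := by
  choose f hf using fun j => Quotient.exists_rep (c j)
  have hf' : ∀ j, c j = (f j : (U : Filter I).Germ C) := fun j => (hf j).symm
  simp_rw [hf', germMap_coe, germConst_apply] at h
  have h1 : ∑ j ∈ s, (((fun i => algebraMap C L (f j i) * b j) : I → L) : (U : Filter I).Germ L)
      = 0 := h
  rw [germ_sum_coe] at h1
  have h2 := Filter.Germ.coe_eq.1 (h1.trans (rfl : (0 : (U : Filter I).Germ L) =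
    ((fun _ => 0 : I → L) : (U : Filter I).Germ L)))
  intro j hj
  rw [hf']
  refine Filter.Germ.coe_eq.2 ?_
  filter_upwards [h2] with i hi
  refine linearIndependent_iff'.1 hb s (fun j => f j i) ?_ j hj
  simpa [Algebra.smul_def] using hi

end Ultrapower

/-- A field extension of an algebraically closed field `C` embeds into an ultrapower of `C`. -/
theorem exists_hom_ultrapower (C K : Type u) [Field C] [IsAlgClosed C] [Field K] [Algebra C K] :
    ∃ (I : Type u) (U : Ultrafilter I) (σ : K →+* (U : Filter I).Germ C),
      ∀ c, σ (algebraMap C K c) = germConst U C c := by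
  classical
  -- Nullstellensatz: the residue field at a maximal ideal is finite over `C`, hence equal to `C`.
  have hχ : ∀ S : Finset K, Nonempty (Algebra.adjoin C (S : Set K) →ₐ[C] C) := by
    intro S
    have : Algebra.FiniteType C (Algebra.adjoin C (S : Set K)) :=
      (Subalgebra.fg_iff_finiteType _).1 ⟨S, rfl⟩
    obtain ⟨m, hm⟩ := Ideal.exists_maximal (Algebra.adjoin C (S : Set K))
    let _ := Ideal.Quotient.field m
    have : Module.Finite C (Algebra.adjoin C (S : Set K) ⧸ m) :=
      finite_of_finite_type_of_isJacobsonRing C _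
    have hbij := IsAlgClosed.algebraMap_bijective_of_isIntegral (k := C)
      (K := Algebra.adjoin C (S : Set K) ⧸ m)
    let e := AlgEquiv.ofBijective (Algebra.ofId C (Algebra.adjoin C (S : Set K) ⧸ m)) hbij
    exact ⟨(e.symm : _ →ₐ[C] C).comp (Ideal.Quotient.mkₐ C m)⟩
  have χ : ∀ S : Finset K, Algebra.adjoin C (S : Set K) →ₐ[C] C := fun S => (hχ S).some
  -- The value 0 off the subalgebra is harmless: each `k` lies in the subalgebra generated by `S` as
  -- soon as `S` contains `k`, which is almost always.
  let f (k : K) (S : Finset K) : C :=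
    if h : k ∈ Algebra.adjoin C (S : Set K) then χ S ⟨k, h⟩ else 0
  let U : Ultrafilter (Finset K) := Ultrafilter.of Filter.atTop
  have hU : ∀ k : K, ∀ᶠ S : Finset K in (U : Filter (Finset K)), k ∈ Algebra.adjoin C (S : Set K) := by
    intro k
    refine Ultrafilter.of_le _ ?_
    filter_upwards [Filter.eventually_ge_atTop {k}] with S hS
    exact Algebra.subset_adjoin (by simpa using hS)
  refine ⟨Finset K, U, ?_, ?_⟩
  · exact
      { toFun := fun k => (f k : (U : Filter (Finset K)).Germ C)
        map_one' := Filter.Germ.coe_eq.2 (Filter.Eventually.of_forall fun S => by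
          have h : (1 : K) ∈ Algebra.adjoin C (S : Set K) := one_mem _
          simp only [f, dif_pos h]
          exact map_one (χ S))
        map_zero' := Filter.Germ.coe_eq.2 (Filter.Eventually.of_forall fun S => by
          have h : (0 : K) ∈ Algebra.adjoin C (S : Set K) := zero_mem _
          simp only [f, dif_pos h]
          exact map_zero (χ S))
        map_mul' := fun x y => Filter.Germ.coe_eq.2 (by
          filter_upwards [hU x, hU y] with S hx hy
          simp only [f, dif_pos hx, dif_pos hy, dif_pos (mul_mem hx hy)]
          exact map_mul (χ S) ⟨x, hx⟩ ⟨y, hy⟩)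
        map_add' := fun x y => Filter.Germ.coe_eq.2 (by
          filter_upwards [hU x, hU y] with S hx hy
          simp only [f, dif_pos hx, dif_pos hy, dif_pos (add_mem hx hy)]
          exact map_add (χ S) ⟨x, hx⟩ ⟨y, hy⟩) }
  · intro c
    refine Filter.Germ.coe_eq.2 (Filter.Eventually.of_forall fun S => ?_)
    have h : algebraMap C K c ∈ Algebra.adjoin C (S : Set K) := Subalgebra.algebraMap_mem _ c
    simp only [f, dif_pos h]
    exact (χ S).commutes c

/-! ### Specialization of the function field of a base change -/

/-- `M` is the field of fractions of its subring `L ⊗[C] K`. -/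
structure IsFracTensor (C K L M : Type u) [Field C] [Field K] [Field L] [Field M] [Algebra C K]
    [Algebra C L] [Algebra C M] [Algebra K M] [Algebra L M] [IsScalarTower C K M]
    [IsScalarTower C L M] : Prop where
  inj : Function.Injective (Algebra.TensorProduct.productMap
    (IsScalarTower.toAlgHom C L M) (IsScalarTower.toAlgHom C K M))
  frac : ∀ x : M, ∃ p q : L ⊗[C] K, q ≠ 0 ∧
    x * Algebra.TensorProduct.productMap
      (IsScalarTower.toAlgHom C L M) (IsScalarTower.toAlgHom C K M) q =
    Algebra.TensorProduct.productMap
      (IsScalarTower.toAlgHom C L M) (IsScalarTower.toAlgHom C K M) p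

/-- A family of partially defined specializations `M ⇢ L` over `L`, sending constants in `K` to
constants in `C`, and packed into a single homomorphism to an ultrapower of `L`. -/
structure Specialization (C K L M : Type u) [Field C] [Field K] [Field L] [Field M]
    [Algebra C K] [Algebra C L] [Algebra K M] [Algebra L M] where
  I : Type u
  U : Ultrafilter I
  σ : K →+* (U : Filter I).Germ C
  Φ : M →+* (U : Filter I).Germ L
  map_left : ∀ l, Φ (algebraMap L M l) = germConst U L l
  map_right : ∀ k, Φ (algebraMap K M k) = germMap U (algebraMap C L) (σ k)
  -- Linear disjointness: families independent over `K` map to families independent over the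
  -- ultrapower of `C`. The bound on degrees in the descent of old forms rests on it.
  eq_zero_of_sum : ∀ {ι : Type} [Fintype ι] (x : ι → M), LinearIndependent K x →
    ∀ c : ι → (U : Filter I).Germ C, ∑ i, germMap U (algebraMap C L) (c i) * Φ (x i) = 0 →
    ∀ i, c i = 0

section

variable {C K L M : Type u} [Field C] [Field K] [Field L] [Field M] [Algebra C K]
    [Algebra C L] [Algebra C M] [Algebra K M] [Algebra L M] [IsScalarTower C K M]
    [IsScalarTower C L M]

/-- Linear independence survives extension of scalars: expanding the `c i` in a basis of `E` over
`F` turns each coordinate of the relation into a relation over `F`. -/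
theorem eq_zero_of_linearIndependent_map {F E ι J : Type*} [Field F] [Field E] (σ : F →+* E)
    [Fintype ι] (x : ι → J →₀ F) (hx : LinearIndependent F x) (c : ι → E)
    (h : ∀ j, ∑ i, c i * σ (x i j) = 0) (i : ι) : c i = 0 := by
  let _ : Algebra F E := σ.toAlgebra
  let γ := Module.Basis.ofVectorSpace F E
  have h1 : ∀ s i, γ.repr (c i) s = 0 := by
    intro s
    refine Fintype.linearIndependent_iff.1 hx (fun i => γ.repr (c i) s) ?_
    ext j
    have h2 := congrArg (fun e => γ.repr e s) (h j)
    have h3 : ∀ i, c i * σ (x i j) = x i j • c i := fun i => by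
      rw [Algebra.smul_def, mul_comm]; rfl
    simp_rw [h3] at h2
    simpa [Finsupp.finsetSum_apply, mul_comm] using h2
  exact γ.repr.map_eq_zero_iff.1 (Finsupp.ext fun s => h1 s i)

section Tensor

open TensorProduct in
theorem equivFinsupp_mul_tmul {J : Type*} [DecidableEq J] (b : Module.Basis J C L)
    (z : L ⊗[C] K) (k : K) :
    equivFinsuppOfBasisLeft b (z * (1 ⊗ₜ k)) = k • equivFinsuppOfBasisLeft (N := K) b z := by
  induction z with
  | zero => simp
  | tmul l k' =>
    ext j
    simp [mul_comm k]
  | add p q hp hq => rw [add_mul, map_add, hp, hq, map_add, smul_add]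

variable {I : Type u} {U : Ultrafilter I} (σ : K →+* (U : Filter I).Germ C)
  (hσ : ∀ c, σ (algebraMap C K c) = germConst U C c)

/-- The homomorphism from `L ⊗[C] K` to the ultrapower of `L` induced by one from `K` to the
ultrapower of `C`. -/
def tensorToGerm : L ⊗[C] K →+* (U : Filter I).Germ L :=
  letI : Algebra C ((U : Filter I).Germ L) := ((germConst U L).comp (algebraMap C L)).toAlgebra
  (Algebra.TensorProduct.productMap (S := (U : Filter I).Germ L)
    ({ germConst U L with commutes' := fun c => rfl } : L →ₐ[C] (U : Filter I).Germ L)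
    ({ (germMap U (algebraMap C L)).comp σ with
      commutes' := fun c => by
        change germMap U (algebraMap C L) (σ (algebraMap C K c)) = _
        rw [hσ]; rfl } : K →ₐ[C] (U : Filter I).Germ L)).toRingHom

theorem tensorToGerm_tmul (l : L) (k : K) : tensorToGerm σ hσ (l ⊗ₜ[C] k) =
    germConst U L l * germMap U (algebraMap C L) (σ k) := by
  let _ : Algebra C ((U : Filter I).Germ L) := ((germConst U L).comp (algebraMap C L)).toAlgebra
  exact Algebra.TensorProduct.productMap_apply_tmul _ _ _ _

-- The set `s` may exceed the support, so that several tensors can be expanded over one index set.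
open TensorProduct in
theorem tensorToGerm_eq_sum {J : Type*} [DecidableEq J] (b : Module.Basis J C L)
    (s : Finset J) (z : L ⊗[C] K) (hs : (equivFinsuppOfBasisLeft b z).support ⊆ s) :
    tensorToGerm σ hσ z = ∑ j ∈ s, germMap U (algebraMap C L)
      (σ (equivFinsuppOfBasisLeft b z j)) * germConst U L (b j) := by
  conv_lhs => rw [← (equivFinsuppOfBasisLeft (N := K) b).symm_apply_apply z,
    equivFinsuppOfBasisLeft_symm_apply, map_finsuppSum,
    Finsupp.sum_of_support_subset _ hs _ (by simp)]
  refine Finset.sum_congr rfl fun j _ => ?_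
  rw [tensorToGerm_tmul, mul_comm]

-- A basis of `L` over `C` stays independent over the ultrapower of `C`, so `σ` kills every
-- coordinate of an element of the kernel, and `σ` is injective on the field `K`.
open TensorProduct in
theorem tensorToGerm_injective : Function.Injective (tensorToGerm (L := L) σ hσ) := by
  classical
  rw [injective_iff_map_eq_zero]
  intro z hz
  let b := Module.Basis.ofVectorSpace C L
  rw [tensorToGerm_eq_sum σ hσ b _ z subset_rfl] at hz
  have h1 := germ_linearIndependent U b.linearIndependent _ _ hz
  rw [← (equivFinsuppOfBasisLeft (N := K) b).map_eq_zero_iff]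
  ext j
  by_cases hj : j ∈ (equivFinsuppOfBasisLeft (N := K) b z).support
  · exact (map_eq_zero σ).1 (h1 j hj)
  · simpa using hj

-- Comparing coefficients of the basis vectors `b j` gives one relation over the ultrapower of `C`
-- for each `j`, between the images under `σ` of the coordinates of the `z i`. The coordinate
-- vectors are independent over `K`, hence also along `σ`.
open TensorProduct in
theorem tensorToGerm_linearIndependent {ι : Type*} [Fintype ι] (z : ι → L ⊗[C] K)
    (hz : ∀ a : ι → K, ∑ i, z i * (1 ⊗ₜ a i) = 0 → ∀ i, a i = 0)
    (c : ι → (U : Filter I).Germ C)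
    (hc : ∑ i, germMap U (algebraMap C L) (c i) * tensorToGerm σ hσ (z i) = 0) (i : ι) :
    c i = 0 := by
  classical
  let b := Module.Basis.ofVectorSpace C L
  have hzl : LinearIndependent K fun i => equivFinsuppOfBasisLeft (N := K) b (z i) := by
    rw [Fintype.linearIndependent_iff]
    intro a ha
    refine hz a ?_
    rw [← (equivFinsuppOfBasisLeft (N := K) b).map_eq_zero_iff, map_sum, ← ha]
    exact Finset.sum_congr rfl fun i _ => equivFinsupp_mul_tmul b _ _
  refine eq_zero_of_linearIndependent_map σ _ hzl c (fun j => ?_) i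
  -- The index `j` is added so that its coefficient can be read off even when it lies in none of the
  -- supports.
  let s : Finset _ := insert j
    (Finset.univ.biUnion fun i => (equivFinsuppOfBasisLeft (N := K) b (z i)).support)
  have hs : ∀ i, (equivFinsuppOfBasisLeft (N := K) b (z i)).support ⊆ s := fun i =>
    (Finset.subset_biUnion_of_mem (fun i => (equivFinsuppOfBasisLeft (N := K) b (z i)).support)
      (Finset.mem_univ i)).trans (Finset.subset_insert _ _)
  refine germ_linearIndependent U b.linearIndependent s
    (fun j => ∑ i, c i * σ (equivFinsuppOfBasisLeft (N := K) b (z i) j)) ?_ j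
    (Finset.mem_insert_self _ _)
  simp_rw [fun i => tensorToGerm_eq_sum σ hσ b s (z i) (hs i), Finset.mul_sum] at hc
  rw [Finset.sum_comm] at hc
  rw [← hc]
  refine Finset.sum_congr rfl fun j _ => ?_
  rw [map_sum, Finset.sum_mul]
  exact Finset.sum_congr rfl fun i _ => by rw [map_mul, mul_assoc]

end Tensor

/-- The map from the tensor product to the ultrapower of `L` is injective and its target is a field,
so it extends to the fraction field `M`. -/
theorem IsFracTensor.nonempty_specialization [IsAlgClosed C] (H : IsFracTensor C K L M) :
    Nonempty (Specialization C K L M) := by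
  obtain ⟨I, U, σ, hσ⟩ := exists_hom_ultrapower C K
  let μ := Algebra.TensorProduct.productMap
    (IsScalarTower.toAlgHom C L M) (IsScalarTower.toAlgHom C K M)
  have hμ : ∀ l k, μ (l ⊗ₜ k) = algebraMap L M l * algebraMap K M k := fun l k => by simp [μ]
  have hμe : ∀ (k : K) z, μ z * algebraMap K M k = μ (z * (1 ⊗ₜ k)) := by
    intro k z; rw [map_mul, hμ]; simp
  have hdom : IsDomain (L ⊗[C] K) := H.inj.isDomain μ.toRingHom
  let _ : Algebra (L ⊗[C] K) M := μ.toRingHom.toAlgebra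
  have hfr : IsFractionRing (L ⊗[C] K) M := by
    have : FaithfulSMul (L ⊗[C] K) M := (faithfulSMul_iff_algebraMap_injective _ _).2 H.inj
    refine IsFractionRing.of_field _ _ fun x => ?_
    obtain ⟨p, q, hq, hpq⟩ := H.frac x
    refine ⟨p, q, ?_⟩
    have : μ q ≠ 0 := fun h => hq (H.inj (h.trans (map_zero μ).symm))
    exact (eq_div_iff this).2 hpq
  let Φ : M →+* (U : Filter I).Germ L :=
    IsFractionRing.lift (A := L ⊗[C] K) (tensorToGerm_injective σ hσ)
  have hΦ : ∀ z, Φ (μ z) = tensorToGerm σ hσ z := fun z =>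
    IsFractionRing.lift_algebraMap (A := L ⊗[C] K) (tensorToGerm_injective σ hσ) z
  refine ⟨⟨I, U, σ, Φ, ?_, ?_, ?_⟩⟩
  · intro l
    have : algebraMap L M l = μ (l ⊗ₜ 1) := by simp [hμ]
    rw [this, hΦ, tensorToGerm_tmul]; simp
  · intro k
    have : algebraMap K M k = μ (1 ⊗ₜ k) := by simp [hμ]
    rw [this, hΦ, tensorToGerm_tmul]; simp
  · intro ι _ x hx c hc
    -- A common denominator `q` reduces independence in `M` to independence in the tensor product.
    obtain ⟨⟨q, hq⟩, hq'⟩ := IsLocalization.exist_integer_multiples_of_finite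
      (nonZeroDivisors (L ⊗[C] K)) x
    choose z hz using hq'
    have hz' : ∀ i, μ (z i) = μ q * x i := fun i => (hz i).trans (Algebra.smul_def q (x i))
    have hq0 : μ q ≠ 0 := fun h => nonZeroDivisors.ne_zero hq (H.inj (h.trans (map_zero μ).symm))
    refine tensorToGerm_linearIndependent σ hσ z (fun a ha => ?_) c ?_
    · refine Fintype.linearIndependent_iff.1 hx a ?_
      have h2 := congrArg μ ha
      rw [map_sum, map_zero] at h2
      simp_rw [← hμe, hz'] at h2
      have h3 : μ q * ∑ i, a i • x i = 0 := by
        rw [Finset.mul_sum, ← h2]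
        refine Finset.sum_congr rfl fun i _ => ?_
        rw [Algebra.smul_def]; ring
      exact (mul_eq_zero.1 h3).resolve_left hq0
    · simp_rw [← hΦ, hz', map_mul]
      rw [← mul_zero (Φ (μ q)), ← hc, Finset.mul_sum]
      exact Finset.sum_congr rfl fun i _ => by ring

end

/-! ### Algebraic relations of bounded degree -/

section Relation

open Polynomial IntermediateField

variable {k F : Type*} [Field k] [Field F] [Algebra k F]

theorem aevalAeval_eq_eval₂ (x y : F) (P : k[X][X]) :
    aevalAeval x y P = eval₂ (aeval x : k[X] →ₐ[k] F).toRingHom y P := by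
  induction P using Polynomial.induction_on' with
  | add p q hp hq => rw [map_add, eval₂_add, hp, hq]
  | monomial n a => simp [← C_mul_X_pow_eq_monomial, eval₂_mul]

/-- As `x` is transcendental, `k(x)` is the fraction field of `k[X]`; clearing denominators
multiplies `f` by a non-zero constant and leaves its degree alone. -/
theorem exists_bivariate_of_adjoin {x y : F} (hx : Transcendental k x) {f : k⟮x⟯[X]} (hf : f ≠ 0)
    (hfy : aeval y f = 0) :
    ∃ P : k[X][X], P ≠ 0 ∧ aevalAeval x y P = 0 ∧ P.natDegree ≤ f.natDegree := by
  let φ : k[X] →ₐ[k] k⟮x⟯ := aeval (AdjoinSimple.gen k x)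
  have hφx : ∀ p, algebraMap k⟮x⟯ F (φ p) = aeval x p := fun p => by
    rw [← aeval_algebraMap_apply]; rfl
  have hφ : Function.Injective φ := by
    rw [injective_iff_map_eq_zero]
    intro p hp
    refine (transcendental_iff.1 hx) p ?_
    rw [← hφx, hp, map_zero]
  let _ : Algebra k[X] k⟮x⟯ := φ.toRingHom.toAlgebra
  have hfr : IsFractionRing k[X] k⟮x⟯ := by
    have : FaithfulSMul k[X] k⟮x⟯ := (faithfulSMul_iff_algebraMap_injective _ _).2 hφ
    refine IsFractionRing.of_field _ _ fun z => ?_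
    obtain ⟨p, q, hpq⟩ := (mem_adjoin_simple_iff k z.1).1 z.2
    refine ⟨p, q, ?_⟩
    apply (algebraMap k⟮x⟯ F).injective
    rw [map_div₀]
    refine hpq.trans ?_
    rw [← hφx, ← hφx]; rfl
  obtain ⟨b, hb, hP⟩ := IsLocalization.integerNormalization_spec (nonZeroDivisors k[X]) f
  set P := IsLocalization.integerNormalization (nonZeroDivisors k[X]) f
  have hP' : P.map (algebraMap k[X] k⟮x⟯) = Polynomial.C (φ b) * f := by
    rw [hP, ← algebraMap_smul k⟮x⟯ b f, smul_eq_C_mul]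
    rfl
  have hb0 : φ b ≠ 0 := fun h => nonZeroDivisors.ne_zero hb (hφ (h.trans (map_zero φ).symm))
  refine ⟨P, ?_, ?_, ?_⟩
  · intro h
    rw [h, Polynomial.map_zero] at hP'
    exact mul_ne_zero (C_ne_zero.2 hb0) hf hP'.symm
  · have h1 := congrArg (aeval y) hP'
    rw [map_mul, hfy, mul_zero] at h1
    rw [← h1, aevalAeval_eq_eval₂, eval₂_eq_eval_map, aeval_def, eval₂_eq_eval_map,
      Polynomial.map_map]
    congr 2
    exact RingHom.ext fun p => (hφx p).symm
  · have : (P.map (algebraMap k[X] k⟮x⟯)).natDegree = P.natDegree :=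
      natDegree_map_eq_of_injective hφ P
    rw [← this, hP', natDegree_C_mul hb0]

theorem exists_irreducible_bivariate {x y : F} {P : k[X][X]} (hP : P ≠ 0)
    (h : aevalAeval x y P = 0) :
    ∃ Q : k[X][X], Irreducible Q ∧ aevalAeval x y Q = 0 ∧ Q.natDegree ≤ P.natDegree := by
  induction P using WfDvdMonoid.induction_on_irreducible with
  | zero => exact absurd rfl hP
  | unit u hu =>
    exact absurd h (hu.map (aevalAeval x y)).ne_zero
  | mul a i ha hi ih =>
    rw [map_mul, mul_eq_zero] at h
    rw [natDegree_mul hi.ne_zero ha]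
    rcases h with h | h
    · exact ⟨i, hi, h, by omega⟩
    · obtain ⟨Q, h1, h2, h3⟩ := ih ha h
      exact ⟨Q, h1, h2, by omega⟩

theorem natDegree_ne_zero_of_transcendental {x y : F} (hx : Transcendental k x) {P : k[X][X]}
    (hP : P ≠ 0) (h : aevalAeval x y P = 0) : P.natDegree ≠ 0 := by
  intro h0
  obtain ⟨a, rfl⟩ := natDegree_eq_zero.1 h0
  have : aeval x a = 0 := by simpa using h
  exact hP (by rw [transcendental_iff.1 hx a this, map_zero])

/-- Gauss's lemma: both polynomials have positive degree in `y`, so they are primitive. Over the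
fraction field `P` stays irreducible, hence is the minimal polynomial of `y` up to a unit and
divides `Q`; primitivity brings the divisibility back to `k[X]`. -/
theorem associated_of_irreducible_bivariate {x y : F} (hx : Transcendental k x) {P Q : k[X][X]}
    (hP : Irreducible P) (hQ : Irreducible Q) (hPx : aevalAeval x y P = 0)
    (hQx : aevalAeval x y Q = 0) : Associated P Q := by
  have hinj : Function.Injective (aeval x : k[X] →ₐ[k] F) := by
    rw [injective_iff_map_eq_zero]
    exact transcendental_iff.1 hx
  let _ : Algebra k[X] F := (aeval x : k[X] →ₐ[k] F).toRingHom.toAlgebra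
  let κ := FractionRing k[X]
  let j : κ →+* F := IsFractionRing.lift (A := k[X]) (g := (aeval x : k[X] →ₐ[k] F).toRingHom) hinj
  let _ : Algebra κ F := j.toAlgebra
  have hj : ∀ p : k[X], algebraMap κ F (algebraMap k[X] κ p) = aeval x p := fun p =>
    IsFractionRing.lift_algebraMap (A := k[X]) hinj p
  have hroot : ∀ R : k[X][X], aevalAeval x y R = 0 →
      aeval y (R.map (algebraMap k[X] κ)) = 0 := by
    intro R hR
    rw [← hR, aevalAeval_eq_eval₂, eval₂_eq_eval_map, aeval_def, eval₂_eq_eval_map,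
      Polynomial.map_map]
    congr 2
    exact RingHom.ext fun p => hj p
  have hpP := hP.isPrimitive (natDegree_ne_zero_of_transcendental hx hP.ne_zero hPx)
  have hpQ := hQ.isPrimitive (natDegree_ne_zero_of_transcendental hx hQ.ne_zero hQx)
  have hP' := (hpP.irreducible_iff_irreducible_map_fraction_map (K := κ)).1 hP
  have hdvd : ∀ {A B : κ[X]}, Irreducible A → aeval y A = 0 → aeval y B = 0 → A ∣ B := by
    intro A B hA hAy hBy
    have hm : minpoly κ y ∣ A := minpoly.dvd κ y hAy
    have hyint : IsIntegral κ y := (isAlgebraic_iff_isIntegral).1 ⟨A, hA.ne_zero, hAy⟩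
    exact ((minpoly.irreducible hyint).associated_of_dvd hA hm).symm.dvd.trans
      (minpoly.dvd κ y hBy)
  exact hP.associated_of_dvd hQ (hpP.dvd_of_fraction_map_dvd_fraction_map (K := κ)
    (hdvd hP' (hroot P hPx) (hroot Q hQx)))

theorem coeff_coeff_swap (P : k[X][X]) (i j : ℕ) :
    ((Bivariate.swap P).coeff i).coeff j = (P.coeff j).coeff i := by
  induction P using Polynomial.induction_on' with
  | add p q hp hq => simp [hp, hq]
  | monomial n a =>
    induction a using Polynomial.induction_on' with
    | add p q hp hq => rw [map_add, map_add]; simp [hp, hq]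
    | monomial m r =>
      rw [Bivariate.swap_monomial_monomial, coeff_monomial, coeff_monomial]
      split_ifs with h1 h2 h2 <;> simp [coeff_monomial, h1, h2]

/-- A relation between two transcendental elements which is of bounded degree in each of them. -/
theorem not_linearIndependent_monomials {x y : F} (hx : Transcendental k x)
    (hy : Transcendental k y) {f : k⟮x⟯[X]} (hf : f ≠ 0) (hfy : aeval y f = 0)
    {g : k⟮y⟯[X]} (hg : g ≠ 0) (hgx : aeval x g = 0) {m n : ℕ} (hm : f.natDegree ≤ m)
    (hn : g.natDegree ≤ n) :
    ¬ LinearIndependent k fun p : Fin (m + 1) × Fin (n + 1) => x ^ (p.2 : ℕ) * y ^ (p.1 : ℕ) := by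
  obtain ⟨P₀, hP₀, hP₀x, hP₀d⟩ := exists_bivariate_of_adjoin hx hf hfy
  obtain ⟨P, hP, hPx, hPd⟩ := exists_irreducible_bivariate hP₀ hP₀x
  obtain ⟨Q₀, hQ₀, hQ₀x, hQ₀d⟩ := exists_bivariate_of_adjoin hy hg hgx
  obtain ⟨Q, hQ, hQx, hQd⟩ := exists_irreducible_bivariate hQ₀ hQ₀x
  have hQ' : Irreducible (Bivariate.swap Q) := (MulEquiv.irreducible_iff Bivariate.swap).2 hQ
  have hQ'x : aevalAeval x y (Bivariate.swap Q) = 0 := by rw [Bivariate.aevalAeval_swap, hQx]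
  -- The irreducible relation found over `k(x)` and the one found over `k(y)` agree up to a unit, so
  -- the bound `m` in `y` and the bound `n` in `x` hold for the same `P`.
  obtain ⟨u, hu⟩ := associated_of_irreducible_bivariate hx hP hQ' hPx hQ'x
  have hsw : (Bivariate.swap P).natDegree ≤ n := by
    have h1 : Bivariate.swap P * Bivariate.swap (u : k[X][X]) = Q := by
      rw [← map_mul, hu, Bivariate.swap_swap_apply]
    refine le_trans ?_ (hQd.trans (hQ₀d.trans hn))
    rw [← h1]
    refine natDegree_le_of_dvd ⟨_, rfl⟩ ?_
    rw [h1]; exact hQ.ne_zero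
  have hdeg : ∀ i, (P.coeff i).natDegree ≤ n := by
    intro i
    rw [natDegree_le_iff_coeff_eq_zero]
    intro j hj
    rw [← coeff_coeff_swap, coeff_eq_zero_of_natDegree_lt (hsw.trans_lt hj), coeff_zero]
  have hPm : P.natDegree ≤ m := hPd.trans (hP₀d.trans hm)
  intro hli
  have h2 := Fintype.linearIndependent_iff.1 hli
    (fun p => (P.coeff (p.1 : ℕ)).coeff (p.2 : ℕ)) (by
      rw [Fintype.sum_prod_type, ← hPx, aevalAeval_eq_eval₂,
        eval₂_eq_sum_range' _ (Nat.lt_succ_of_le hPm), ← Fin.sum_univ_eq_sum_range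
        (fun i => (aeval x : k[X] →ₐ[k] F).toRingHom (P.coeff i) * y ^ i)]
      refine Finset.sum_congr rfl fun i _ => ?_
      change _ = aeval x (P.coeff i) * y ^ (i : ℕ)
      rw [aeval_eq_sum_range' (Nat.lt_succ_of_le (hdeg i)), ← Fin.sum_univ_eq_sum_range
        (fun j => (P.coeff i).coeff j • x ^ j), Finset.sum_mul]
      exact Finset.sum_congr rfl fun j _ => (smul_mul_assoc _ _ _).symm)
  refine hP.ne_zero (Polynomial.ext fun i => Polynomial.ext fun j => ?_)
  rw [coeff_zero, coeff_zero]
  by_cases hi : i ≤ m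
  · by_cases hj : j ≤ n
    · exact h2 (⟨i, by omega⟩, ⟨j, by omega⟩)
    · exact coeff_eq_zero_of_natDegree_lt ((hdeg i).trans_lt (not_le.1 hj))
  · rw [coeff_eq_zero_of_natDegree_lt (hPm.trans_lt (not_le.1 hi)), coeff_zero]

end Relation

/-! ### Differentials of function fields of curves -/

section FunctionField

open KaehlerDifferential

/-- `L` is a finitely generated field extension of `k` with a one-dimensional space of
differentials. -/
structure IsFunctionField (k L : Type*) [Field k] [Field L] [Algebra k L] : Prop where
  essFiniteType : Algebra.EssFiniteType k L
  finrank_eq_one : Module.finrank L Ω[L⁄k] = 1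

variable {k L : Type*} [Field k] [Field L] [Algebra k L]

/-- For `v` algebraic with minimal polynomial `p`, differentiating gives `p'(v) dv = 0`, and `p'(v)`
is non-zero by separability. -/
theorem transcendental_of_D_ne_zero [CharZero k] {v : L} (hv : D k L v ≠ 0) :
    Transcendental k v := by
  intro halg
  have hint : IsIntegral k v := halg.isIntegral
  have h1 : D k L (Polynomial.aeval v (minpoly k v)) = 0 := by rw [minpoly.aeval, map_zero]
  rw [Derivation.map_aeval] at h1
  have h2 : Polynomial.aeval v (Polynomial.derivative (minpoly k v)) ≠ 0 :=
    (minpoly.irreducible hint).separable.aeval_derivative_ne_zero (minpoly.aeval k v)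
  exact hv ((smul_eq_zero.1 h1).resolve_left h2)

theorem IsFunctionField.exists_eq_smul (h : IsFunctionField k L) {v : L} (hv : D k L v ≠ 0)
    (η : Ω[L⁄k]) : ∃ u : L, η = u • D k L v := by
  obtain ⟨u, hu⟩ := (finrank_eq_one_iff_of_nonzero' _ hv).1 h.finrank_eq_one η
  exact ⟨u, hu.symm⟩

theorem IsFunctionField.exists_D_ne_zero (h : IsFunctionField k L) : ∃ v : L, D k L v ≠ 0 := by
  by_contra! h0
  have h1 : (⊤ : Submodule L Ω[L⁄k]) = ⊥ := by
    rw [← span_range_derivation, Submodule.span_eq_bot]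
    rintro _ ⟨x, rfl⟩
    exact h0 x
  have h2 := h.finrank_eq_one
  rw [← finrank_top, h1, finrank_bot] at h2
  exact zero_ne_one h2

-- Since `dv` spans the differentials over `k`, those over `k(v)` vanish. The extension is thus
-- unramified and essentially of finite type, hence finite.
open IntermediateField in
theorem IsFunctionField.finiteDimensional_adjoin [CharZero k] (h : IsFunctionField k L) {v : L}
    (hv : D k L v ≠ 0) : FiniteDimensional k⟮v⟯ L := by
  have := h.essFiniteType
  have : Algebra.EssFiniteType k⟮v⟯ L := Algebra.EssFiniteType.of_comp k k⟮v⟯ L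
  have : Algebra.FormallyUnramified k⟮v⟯ L := by
    rw [Algebra.formallyUnramified_iff]
    have h0 : ∀ x, D k⟮v⟯ L x = 0 := by
      intro x
      obtain ⟨u, hu⟩ := h.exists_eq_smul hv (D k L x)
      have h1 := congrArg (KaehlerDifferential.map k k⟮v⟯ L L) hu
      rw [map_smul, map_D, map_D] at h1
      have h2 : D k⟮v⟯ L v = 0 :=
        (D k⟮v⟯ L).map_algebraMap (AdjoinSimple.gen k v)
      simpa [h2] using h1
    rw [← Submodule.subsingleton_iff L, ← subsingleton_iff_bot_eq_top, eq_comm,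
      ← span_range_derivation, Submodule.span_eq_bot]
    rintro _ ⟨x, rfl⟩
    exact h0 x
  exact Algebra.FormallyUnramified.finite_of_free _ _

end FunctionField

/-! ### Transfer of forms to the ultrapower -/

namespace Specialization

variable {C K L M : Type u} [Field C] [Field K] [Field L] [Field M] [Algebra C K]
    [Algebra C L] [Algebra K M] [Algebra L M] (S : Specialization C K L M)

theorem exists_rep : ∃ s : M → S.I → L, ∀ x, S.Φ x = (s x : (S.U : Filter S.I).Germ L) := by
  choose s hs using fun x => Quotient.exists_rep (S.Φ x)
  exact ⟨s, fun x => (hs x).symm⟩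

theorem exists_rep_const : ∃ c : K → S.I → C, ∀ x, S.σ x = (c x : (S.U : Filter S.I).Germ C) := by
  choose s hs using fun x => Quotient.exists_rep (S.σ x)
  exact ⟨s, fun x => (hs x).symm⟩

/-- A derivation of `L` over `C` gives a homomorphism from the differentials of `M` over `K` to
the ultrapower of `L`. -/
theorem exists_formHom (d : Derivation C L L) :
    ∃ F : Ω[M⁄K] →+ (S.U : Filter S.I).Germ L, ∀ x y : M,
      F (x • KaehlerDifferential.D K M y) = S.Φ x * Filter.Germ.map d (S.Φ y) := by
  let _ : Algebra M ((S.U : Filter S.I).Germ L) := S.Φ.toAlgebra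
  let _ : Algebra K ((S.U : Filter S.I).Germ L) := (S.Φ.comp (algebraMap K M)).toAlgebra
  have : IsScalarTower K M ((S.U : Filter S.I).Germ L) := IsScalarTower.of_algebraMap_eq fun _ => rfl
  have hadd : ∀ a b : (S.U : Filter S.I).Germ L,
      Filter.Germ.map d (a + b) = Filter.Germ.map d a + Filter.Germ.map d b := fun a b =>
    Filter.Germ.inductionOn₂ a b fun _ _ =>
      congrArg Filter.Germ.ofFun (funext fun _ => map_add d _ _)
  have hmul : ∀ a b : (S.U : Filter S.I).Germ L,
      Filter.Germ.map d (a * b) = a * Filter.Germ.map d b + b * Filter.Germ.map d a := fun a b =>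
    Filter.Germ.inductionOn₂ a b fun _ _ =>
      congrArg Filter.Germ.ofFun (funext fun _ => d.leibniz _ _)
  -- Elements of `K` go to germs of constants from `C`, which `d` kills index by index; this makes
  -- the composite a derivation over `K`.
  have hconst : ∀ k, Filter.Germ.map d (S.Φ (algebraMap K M k)) = 0 := by
    intro k
    rw [S.map_right]
    exact Filter.Germ.inductionOn (S.σ k) fun f =>
      congrArg Filter.Germ.ofFun (funext fun _ => d.map_algebraMap _)
  let δ : Derivation K M ((S.U : Filter S.I).Germ L) :=
    Derivation.mk'
      { toFun := fun x => Filter.Germ.map d (S.Φ x)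
        map_add' := fun x y => by rw [map_add, hadd]
        map_smul' := fun k x => by
          rw [Algebra.smul_def, map_mul, hmul, hconst, mul_zero, add_zero, RingHom.id_apply,
            Algebra.smul_def]
          rfl }
      (fun x y => by
        change Filter.Germ.map d (S.Φ (x * y)) = _
        rw [map_mul, hmul, Algebra.smul_def, Algebra.smul_def]
        rfl)
  refine ⟨δ.liftKaehlerDifferential.toAddMonoidHom, fun x y => ?_⟩
  change δ.liftKaehlerDifferential (x • KaehlerDifferential.D K M y) = _
  rw [map_smul, Derivation.liftKaehlerDifferential_comp_D, Algebra.smul_def]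
  rfl

/-- Each element is built from `T` and constants by finitely many field operations, and each of
these is respected at almost every index. -/
theorem eventually_mem_adjoin (T : Set M) (s : M → S.I → L)
    (hs : ∀ x, S.Φ x = (s x : (S.U : Filter S.I).Germ L)) {x : M}
    (hx : x ∈ IntermediateField.adjoin K T) :
    ∀ᶠ i in (S.U : Filter S.I), s x i ∈ IntermediateField.adjoin C ((fun y => s y i) '' T) := by
  induction hx using IntermediateField.adjoin_induction with
  | mem x hx =>
    exact Filter.Eventually.of_forall fun i =>
      IntermediateField.subset_adjoin _ _ (Set.mem_image_of_mem _ hx)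
  | algebraMap k =>
    obtain ⟨c, hc⟩ := S.exists_rep_const
    have h1 := S.map_right k
    rw [hs, hc] at h1
    filter_upwards [Filter.Germ.coe_eq.1 (h1.trans (germMap_coe S.U _ _))] with i hi
    rw [hi]
    exact IntermediateField.algebraMap_mem _ _
  | add x y _ _ hx hy =>
    have h1 := map_add S.Φ x y
    rw [hs, hs, hs] at h1
    filter_upwards [Filter.Germ.coe_eq.1 h1, hx, hy] with i hi hx hy
    rw [hi]; exact add_mem hx hy
  | mul x y _ _ hx hy =>
    have h1 := map_mul S.Φ x y
    rw [hs, hs, hs] at h1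
    filter_upwards [Filter.Germ.coe_eq.1 h1, hx, hy] with i hi hx hy
    rw [hi]; exact mul_mem hx hy
  | inv x _ hx =>
    have h1 := map_inv₀ S.Φ x
    rw [hs, hs] at h1
    filter_upwards [Filter.Germ.coe_eq.1 h1, hx] with i hi hx
    rw [hi]; exact inv_mem hx

/-- Otherwise the non-trivial relations at almost all indices form a single relation with
coefficients in the ultrapower of `C`. All its coefficients vanish by `eq_zero_of_sum`, and as `ι`
is finite they vanish together at one index, which is absurd. -/
theorem eventually_linearIndependent {ι : Type} [Fintype ι] (x : ι → M)
    (hx : LinearIndependent K x) (y : ι → S.I → L)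
    (hy : ∀ p, S.Φ (x p) = (y p : (S.U : Filter S.I).Germ L)) :
    ∀ᶠ i in (S.U : Filter S.I), LinearIndependent C fun p => y p i := by
  by_contra hcon
  rw [← Ultrafilter.eventually_not] at hcon
  have hex : ∀ i, ∃ g : ι → C, (¬ LinearIndependent C fun p => y p i) →
      ∑ p, g p • y p i = 0 ∧ ∃ p, g p ≠ 0 := by
    intro i
    by_cases h : LinearIndependent C fun p => y p i
    · exact ⟨0, fun h' => absurd h h'⟩
    · obtain ⟨g, hg⟩ := Fintype.not_linearIndependent_iff.1 h
      exact ⟨g, fun _ => hg⟩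
  choose g hg using hex
  have hz := S.eq_zero_of_sum x hx
    (fun p => ((fun i => g i p : S.I → C) : (S.U : Filter S.I).Germ C)) (by
      simp_rw [hy, germMap_coe]
      refine (germ_sum_coe S.U Finset.univ
        (fun p i => algebraMap C L (g i p) * y p i)).trans (Filter.Germ.coe_eq.2 ?_)
      filter_upwards [hcon] with i hi
      simpa [Algebra.smul_def] using (hg i hi).1)
  have hz' : ∀ᶠ i in (S.U : Filter S.I), ∀ p, g i p = 0 :=
    Filter.eventually_all.2 fun p => Filter.Germ.coe_eq.1 (hz p)
  obtain ⟨i, hi1, hi2⟩ := (hcon.and hz').exists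
  obtain ⟨p, hp⟩ := (hg i hi1).2
  exact hp (hi2 p)

end Specialization

/-! ### Descent of exact, exponential and Weierstrass forms -/

section Descent

open KaehlerDifferential

variable {C K L M : Type u} [Field C] [Field K] [Field L] [Field M] [Algebra C K]
    [Algebra C L] [Algebra K M] [Algebra L M]

/-- The derivation with `d t = 1`. -/
theorem IsFunctionField.exists_derivation (h : IsFunctionField C L) {t : L} (ht : D C L t ≠ 0) :
    ∃ d : Derivation C L L, ∀ x, D C L x = d x • D C L t := by
  choose u hu using fun x => h.exists_eq_smul ht (D C L x)
  have hinj : ∀ a b : L, a • D C L t = b • D C L t → a = b := fun a b hab =>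
    smul_left_injective L ht hab
  refine ⟨Derivation.mk' { toFun := u, map_add' := ?_, map_smul' := ?_ } ?_, hu⟩
  · intro x y
    apply hinj
    rw [← hu, map_add, hu x, hu y, add_smul]
  · intro c x
    apply hinj
    rw [← hu, Derivation.map_smul, hu x, RingHom.id_apply, smul_assoc]
  · intro x y
    apply hinj
    change u (x * y) • D C L t = _
    rw [← hu, Derivation.leibniz, hu x, hu y, smul_smul, smul_smul, ← add_smul]
    rfl

/-- An identity `h dt = x dy` in the differentials of `M` over `K` holds for almost all
specializations. -/
theorem Specialization.eventually_form_eq (S : Specialization C K L M) (hL : IsFunctionField C L)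
    {h t : L} (ht : D C L t ≠ 0) {x y : M}
    (hxy : algebraMap L M h • D K M (algebraMap L M t) = x • D K M y) {x' y' : S.I → L}
    (hx' : S.Φ x = (x' : (S.U : Filter S.I).Germ L))
    (hy' : S.Φ y = (y' : (S.U : Filter S.I).Germ L)) :
    ∀ᶠ i in (S.U : Filter S.I), h • D C L t = x' i • D C L (y' i) := by
  obtain ⟨d, hd⟩ := hL.exists_derivation ht
  obtain ⟨F, hF⟩ := S.exists_formHom d
  have h1 := congrArg F hxy
  rw [hF, hF, S.map_left, S.map_left, hx', hy'] at h1
  have h2 : ((fun _ => h * d t : S.I → L) : (S.U : Filter S.I).Germ L) =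
    ((fun i => x' i * d (y' i) : S.I → L) : (S.U : Filter S.I).Germ L) := h1
  filter_upwards [Filter.Germ.coe_eq.1 h2] with i hi
  have ht1 : d t • D C L t = D C L t := (hd t).symm
  rw [hd (y' i), smul_smul, ← hi, mul_smul, ht1]

/-- A set of the ultrafilter is non-empty, so an index where the specialized identity holds supplies
the function over `C`. The exponential and Weierstrass cases add finitely many further conditions
valid almost everywhere. -/
theorem Specialization.exists_exact (S : Specialization C K L M) (hL : IsFunctionField C L)
    {h t : L} (ht : D C L t ≠ 0) {f : M}
    (hf : algebraMap L M h • D K M (algebraMap L M t) = D K M f) :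
    ∃ f : L, h • D C L t = D C L f := by
  obtain ⟨s, hs⟩ := S.exists_rep
  have h1 := S.eventually_form_eq hL ht (x := 1) (hf.trans (one_smul _ _).symm) (x' := fun _ => 1)
    (by rw [map_one]; rfl) (hs f)
  obtain ⟨i, hi⟩ := h1.exists
  exact ⟨_, hi.trans (one_smul _ _)⟩

theorem Specialization.eventually_ne (S : Specialization C K L M) {x : M} (hx : x ≠ 0)
    {x' : S.I → L} (hx' : S.Φ x = (x' : (S.U : Filter S.I).Germ L)) :
    ∀ᶠ i in (S.U : Filter S.I), x' i ≠ 0 := by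
  rw [Ultrafilter.eventually_not]
  intro h
  refine hx ((map_eq_zero S.Φ).1 (hx'.trans (Filter.Germ.coe_eq.2 h)))

theorem Specialization.eventually_const_ne (S : Specialization C K L M) {c : K} (hc : c ≠ 0)
    {c' : S.I → C} (hc' : S.σ c = (c' : (S.U : Filter S.I).Germ C)) :
    ∀ᶠ i in (S.U : Filter S.I), c' i ≠ 0 := by
  rw [Ultrafilter.eventually_not]
  intro h
  refine hc ((map_eq_zero S.σ).1 (hc'.trans (Filter.Germ.coe_eq.2 h)))

theorem Specialization.exists_exponential (S : Specialization C K L M)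
    (hL : IsFunctionField C L) {h t : L} (ht : D C L t ≠ 0) {f : M} {c : K} (hf0 : f ≠ 0)
    (hc0 : c ≠ 0)
    (hf : algebraMap L M h • D K M (algebraMap L M t) = (algebraMap K M c * f)⁻¹ • D K M f) :
    ∃ (f : L) (c : C), f ≠ 0 ∧ c ≠ 0 ∧ h • D C L t = (algebraMap C L c * f)⁻¹ • D C L f := by
  obtain ⟨s, hs⟩ := S.exists_rep
  obtain ⟨r, hr⟩ := S.exists_rep_const
  have h1 := S.eventually_form_eq hL ht hf
    (x' := fun i => (algebraMap C L (r c i) * s f i)⁻¹) (by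
      rw [map_inv₀, map_mul, S.map_right, hs, hr, germMap_coe]; rfl) (hs f)
  obtain ⟨i, hi, hi1, hi2⟩ :=
    (h1.and ((S.eventually_ne hf0 (hs f)).and (S.eventually_const_ne hc0 (hr c)))).exists
  exact ⟨_, _, hi1, hi2, hi⟩

theorem Specialization.exists_weierstrass (S : Specialization C K L M)
    (hL : IsFunctionField C L) {h t : L} (ht : D C L t ≠ 0) {f g : M} {a b : K} (hg0 : g ≠ 0)
    (hab : 4 * a ^ 3 + 27 * b ^ 2 ≠ 0)
    (hfg : g ^ 2 = f ^ 3 + algebraMap K M a * f + algebraMap K M b)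
    (hf : algebraMap L M h • D K M (algebraMap L M t) = g⁻¹ • D K M f) :
    ∃ (f g : L) (a b : C), g ≠ 0 ∧ 4 * a ^ 3 + 27 * b ^ 2 ≠ 0 ∧
      g ^ 2 = f ^ 3 + algebraMap C L a * f + algebraMap C L b ∧ h • D C L t = g⁻¹ • D C L f := by
  obtain ⟨s, hs⟩ := S.exists_rep
  obtain ⟨r, hr⟩ := S.exists_rep_const
  have h1 := S.eventually_form_eq hL ht hf (x' := fun i => (s g i)⁻¹) (by
      rw [map_inv₀, hs]; rfl) (hs f)
  have h2 := congrArg S.Φ hfg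
  rw [map_add, map_add, map_mul, map_pow, map_pow, S.map_right, S.map_right, hs, hs, hr, hr,
    germMap_coe, germMap_coe] at h2
  have h3 : ∀ᶠ i in (S.U : Filter S.I), s g i ^ 2 =
    s f i ^ 3 + algebraMap C L (r a i) * s f i + algebraMap C L (r b i) := Filter.Germ.coe_eq.1 h2
  -- Non-vanishing of the discriminant passes to almost all indices because `σ` is injective.
  have h4 : ∀ᶠ i in (S.U : Filter S.I), 4 * r a i ^ 3 + 27 * r b i ^ 2 ≠ 0 := by
    refine S.eventually_const_ne hab ?_
    rw [map_add, map_mul, map_mul, map_pow, map_pow, map_ofNat, map_ofNat, hr, hr]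
    rfl
  obtain ⟨i, hi, hi1, hi2, hi3⟩ := (h1.and ((S.eventually_ne hg0 (hs g)).and (h4.and h3))).exists
  exact ⟨_, _, _, _, hi1, hi2, hi3, hi⟩

/-! ### Descent of old forms -/

open IntermediateField

/-- A primitive element of `M` which lies in `L` and has non-zero differential. -/
theorem IsFracTensor.exists_primitive [CharZero C] [Algebra C M] [IsScalarTower C K M]
    [IsScalarTower C L M] (H : IsFracTensor C K L M) (hL : IsFunctionField C L) (v : M)
    [FiniteDimensional K⟮v⟯ M] :
    ∃ θ : L, D C L θ ≠ 0 ∧ K⟮v⟯⟮algebraMap L M θ⟯ = ⊤ := by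
  have : CharZero M := charZero_of_injective_algebraMap (algebraMap C M).injective
  have : CharZero K := charZero_of_injective_algebraMap (algebraMap C K).injective
  have : CharZero K⟮v⟯ := charZero_of_injective_algebraMap (algebraMap K K⟮v⟯).injective
  -- A finite separable extension has only finitely many intermediate fields.
  have hfin : Finite (IntermediateField K⟮v⟯ M) :=
    (Field.exists_primitive_element_iff_finite_intermediateField _ _).1
      ⟨inferInstance, Field.exists_primitive_element _ _⟩
  let toSub : IntermediateField K⟮v⟯ M → Submodule C L := fun G =>
    { carrier := {l | algebraMap L M l ∈ G}
      add_mem' := fun {a b} ha hb => by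
        simp only [Set.mem_ofPred_eq, map_add] at *
        exact add_mem ha hb
      zero_mem' := by
        simp only [Set.mem_ofPred_eq, map_zero]
        exact zero_mem G
      smul_mem' := fun c a ha => by
        simp only [Set.mem_ofPred_eq, Algebra.smul_def, map_mul] at *
        refine mul_mem ?_ ha
        rw [← IsScalarTower.algebraMap_apply, IsScalarTower.algebraMap_apply C K M,
          IsScalarTower.algebraMap_apply K K⟮v⟯ M]
        exact G.algebraMap_mem _ }
  -- The subspaces of `L` that `θ` must avoid: the kernel of `d`, and the trace on `L` of each
  -- proper intermediate field. None is all of `L`: the differentials of `L` are non-zero, and `L`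
  -- together with `K` generates `M`.
  let p : Option {G : IntermediateField K⟮v⟯ M // G ≠ ⊤} → Submodule C L
    | none => LinearMap.ker (D C L).toLinearMap
    | some G => toSub G.1
  have hp : ∀ i, p i ≠ ⊤ := by
    rintro (_ | ⟨G, hG⟩) htop
    · obtain ⟨t, ht⟩ := hL.exists_D_ne_zero
      have : t ∈ p none := htop ▸ Submodule.mem_top
      exact ht this
    · have hmem : ∀ l : L, algebraMap L M l ∈ G := fun l => by
        have : l ∈ toSub G := by
          change l ∈ p (some ⟨G, hG⟩)
          rw [htop]; exact Submodule.mem_top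
        exact this
      apply hG
      rw [eq_top_iff]
      intro x _
      let μ := Algebra.TensorProduct.productMap
        (IsScalarTower.toAlgHom C L M) (IsScalarTower.toAlgHom C K M)
      have hμ : ∀ z, μ z ∈ G := by
        intro z
        induction z with
        | zero => rw [map_zero]; exact zero_mem G
        | tmul l k =>
          have : μ (l ⊗ₜ k) = algebraMap L M l * algebraMap K⟮v⟯ M (algebraMap K K⟮v⟯ k) := by
            simp only [μ, Algebra.TensorProduct.productMap_apply_tmul]; rfl
          rw [this]
          exact mul_mem (hmem l) (G.algebraMap_mem _)
        | add a b ha hb => rw [map_add]; exact add_mem ha hb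
      obtain ⟨a, b, hb, hab⟩ := H.frac x
      have hb' : μ b ≠ 0 := fun h => hb (H.inj (h.trans (map_zero μ).symm))
      rw [(eq_div_iff hb').2 hab]
      exact div_mem (hμ a) (hμ b)
  -- A vector space over the infinite field `C` is not a finite union of proper subspaces.
  have hU : ⋃ i, (p i : Set L) ≠ Set.univ := fun hU => by
    obtain ⟨i, hi⟩ := Subspace.exists_eq_top_of_iUnion_eq_univ hU
    exact hp i hi
  obtain ⟨θ, hθ⟩ := (Set.ne_univ_iff_exists_notMem _).1 hU
  simp only [Set.mem_iUnion, not_exists] at hθ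
  refine ⟨θ, hθ none, ?_⟩
  by_contra hne
  refine hθ (some ⟨_, hne⟩) ?_
  exact mem_adjoin_simple_self K⟮v⟯ (algebraMap L M θ)

/-- Powers of `v` are independent over `F`, and powers of `θ` below its degree are independent over
`F(v)`; products of two such families are independent over `F`. The `m + 1` exponents `0, ..., m`
fit because `m` is strictly less than the degree. -/
theorem linearIndependent_monomials {F G : Type*} [Field F] [Field G] [Algebra F G] {v θ : G}
    (hv : Transcendental F v) [FiniteDimensional F⟮v⟯ G] {m : ℕ} (n : ℕ)
    (hm : m < (minpoly F⟮v⟯ θ).natDegree) :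
    LinearIndependent F fun p : Fin (m + 1) × Fin (n + 1) => v ^ (p.2 : ℕ) * θ ^ (p.1 : ℕ) := by
  have h1 : LinearIndependent F fun j : Fin (n + 1) => (AdjoinSimple.gen F v) ^ (j : ℕ) := by
    have h0 := (Polynomial.basisMonomials F).linearIndependent.map'
      (Polynomial.aeval v : Polynomial F →ₐ[F] G).toLinearMap
      (LinearMap.ker_eq_bot'.2 (transcendental_iff.1 hv))
    have h2 := h0.comp (fun j : Fin (n + 1) => (j : ℕ)) Fin.val_injective
    refine LinearIndependent.of_comp (F⟮v⟯.val.toLinearMap) ?_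
    have hfun : (F⟮v⟯.val.toLinearMap ∘ fun j : Fin (n + 1) => AdjoinSimple.gen F v ^ (j : ℕ)) =
        ((Polynomial.aeval v : Polynomial F →ₐ[F] G).toLinearMap ∘ Polynomial.basisMonomials F) ∘
          fun j : Fin (n + 1) => (j : ℕ) := by
      ext j
      simp
    rw [hfun]
    exact h2
  have h2 : LinearIndependent F⟮v⟯ fun i : Fin (m + 1) => θ ^ (i : ℕ) := by
    have h0 := linearIndependent_pow (K := F⟮v⟯) θ
    exact h0.comp (Fin.castLE (by omega)) (Fin.castLE_injective _)
  have h3 := linearIndependent_smul h1 h2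
  have h4 := h3.comp Prod.swap Prod.swap_injective
  convert h4 using 1
  ext p
  simp [Algebra.smul_def]

/-- The descended field is generated by specializations of `v` and of a generator `w` of `E` over
`K(v)`. It is proper because the drop in degree from `M` to `E` is recorded by the independence of
finitely many monomials, a condition that specializes. -/
theorem Specialization.exists_old [CharZero C] [Algebra C M] [IsScalarTower C K M]
    [IsScalarTower C L M] (H : IsFracTensor C K L M) (S : Specialization C K L M)
    (hL : IsFunctionField C L) {h t : L} (hω : h • D C L t ≠ 0) {v u : M}
    [FiniteDimensional K⟮v⟯ M] (E : IntermediateField K⟮v⟯ M) (hE : E ≠ ⊤) (hu : u ∈ E)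
    (huv : algebraMap L M h • D K M (algebraMap L M t) = u • D K M v) :
    ∃ (E : IntermediateField C L) (u v : L), E ≠ ⊤ ∧ u ∈ E ∧ v ∈ E ∧ FiniteDimensional E L ∧
      h • D C L t = u • D C L v := by
  have : CharZero M := charZero_of_injective_algebraMap (algebraMap C M).injective
  have : CharZero K := charZero_of_injective_algebraMap (algebraMap C K).injective
  have : CharZero K⟮v⟯ := charZero_of_injective_algebraMap (algebraMap K K⟮v⟯).injective
  have ht : D C L t ≠ 0 := fun h0 => hω (by rw [h0, smul_zero])
  obtain ⟨s, hs⟩ := S.exists_rep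
  obtain ⟨θ, hθ0, hθ⟩ := H.exists_primitive hL v
  obtain ⟨⟨w, hw⟩, hwE⟩ := Field.exists_primitive_element K⟮v⟯ E
  have hwE' : K⟮v⟯⟮w⟯ = E := by
    have := congrArg (IntermediateField.map E.val) hwE
    rw [adjoin_map, ← AlgHom.fieldRange_eq_map, IntermediateField.fieldRange_val,
      Set.image_singleton] at this
    exact this
  set d := (minpoly K⟮v⟯ w).natDegree with hd
  -- The degree of `E` over `K(v)` is strictly smaller than that of `M`, which `θ` generates.
  have hdn : d < (minpoly K⟮v⟯ (algebraMap L M θ)).natDegree := by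
    have hwi : IsIntegral K⟮v⟯ w := Algebra.IsIntegral.isIntegral w
    have hθi : IsIntegral K⟮v⟯ (algebraMap L M θ) := Algebra.IsIntegral.isIntegral _
    rw [hd, ← adjoin.finrank hwi, ← adjoin.finrank hθi, hθ, hwE', finrank_top']
    refine lt_of_le_of_ne (Submodule.finrank_le E.toSubalgebra.toSubmodule) fun heq => hE ?_
    exact IntermediateField.eq_of_le_of_finrank_eq le_top
      (heq.trans finrank_top'.symm)
  have hform := S.eventually_form_eq hL ht huv (hs u) (hs v)
  -- Were `dv` zero, the form would be zero over `K`, and so would its specialization `h dt`.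
  have hv0 : D K M v ≠ 0 := by
    intro h0
    have h1 := S.eventually_form_eq hL ht (x := 0) (y := v) (by rw [huv, h0, smul_zero, zero_smul])
      (x' := fun _ => 0) (by rw [map_zero]; rfl) (hs v)
    obtain ⟨i, hi⟩ := h1.exists
    exact hω (by rw [hi, zero_smul])
  have := hL.finiteDimensional_adjoin hθ0
  -- This number bounds the degree over `C(θ)` of every element of `L`, hence of all specializations
  -- of `v` at once. Since `θ` lies in `L`, it is the same at every index.
  let n := Module.finrank C⟮θ⟯ L
  have hli := linearIndependent_monomials (transcendental_of_D_ne_zero hv0) n hdn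
  have hev := S.eventually_linearIndependent _ hli
    (fun p i => s v i ^ (p.2 : ℕ) * θ ^ (p.1 : ℕ)) (fun p => by
      rw [map_mul, map_pow, map_pow, S.map_left, hs]; rfl)
  have hcoeff : ∀ᶠ i in (S.U : Filter S.I), ∀ j : Fin d,
      s ((minpoly K⟮v⟯ w).coeff j) i ∈ C⟮s v i⟯ := by
    rw [Filter.eventually_all]
    intro j
    simpa using S.eventually_mem_adjoin {v} s hs ((minpoly K⟮v⟯ w).coeff j).2
  -- The minimal polynomial of `w` over `K(v)` specializes to a monic equation of the same degree
  -- `d`.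
  have hrel : ∀ᶠ i in (S.U : Filter S.I), s w i ^ d +
      ∑ j : Fin d, s ((minpoly K⟮v⟯ w).coeff j) i * s w i ^ (j : ℕ) = 0 := by
    have h1 := congrArg S.Φ (minpoly.aeval K⟮v⟯ w)
    have hm : (minpoly K⟮v⟯ w).coeff d = 1 :=
      (minpoly.monic (Algebra.IsIntegral.isIntegral w)).coeff_natDegree
    rw [Polynomial.aeval_eq_sum_range, Finset.sum_range_succ, hm, one_smul,
      ← Fin.sum_univ_eq_sum_range (fun j => (minpoly K⟮v⟯ w).coeff j • w ^ j), map_add, map_sum,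
      map_zero, map_pow] at h1
    have h2 : ∀ j : Fin d, S.Φ ((minpoly K⟮v⟯ w).coeff j • w ^ (j : ℕ)) =
        ((fun i => s ((minpoly K⟮v⟯ w).coeff j) i * s w i ^ (j : ℕ) : S.I → L) :
          (S.U : Filter S.I).Germ L) := by
      intro j
      rw [Algebra.smul_def, map_mul, map_pow, hs w]
      exact congrArg (· * _) (hs _)
    simp_rw [h2] at h1
    rw [germ_sum_coe, hs w] at h1
    filter_upwards [Filter.Germ.coe_eq.1 h1] with i hi
    rw [add_comm]
    exact hi
  have hu' : u ∈ IntermediateField.adjoin K {v, w} := by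
    rw [← hwE'] at hu
    rw [← adjoin_simple_adjoin_simple]
    exact hu
  have humem := S.eventually_mem_adjoin {v, w} s hs hu'
  obtain ⟨i, hi1, hi2, hi3, hi4, hi5⟩ :=
    (hform.and (hev.and (hcoeff.and (hrel.and humem)))).exists
  rw [Set.image_pair] at hi5
  have hvi : D C L (s v i) ≠ 0 := fun h0 => hω (by rw [hi1, h0, smul_zero])
  have := hL.finiteDimensional_adjoin hvi
  refine ⟨IntermediateField.adjoin C {s v i, s w i}, s u i, s v i, ?_, hi5,
    subset_adjoin _ _ (by simp), ?_, hi1⟩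
  · intro htop
    rw [← adjoin_simple_adjoin_simple] at htop
    have htop' : C⟮s v i⟯⟮s w i⟯ = ⊤ := by
      rw [eq_top_iff]
      intro x _
      have : x ∈ (⊤ : IntermediateField C L) := mem_top
      rw [← htop] at this
      exact this
    let q : Polynomial C⟮s v i⟯ := Polynomial.X ^ d +
      ∑ j : Fin d, Polynomial.C ⟨_, hi3 j⟩ * Polynomial.X ^ (j : ℕ)
    have hqdeg : (∑ j : Fin d, Polynomial.C (⟨_, hi3 j⟩ : C⟮s v i⟯) *
        Polynomial.X ^ (j : ℕ)).degree < (d : WithBot ℕ) := Polynomial.degree_sum_fin_lt _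
    have hqm : q.Monic := Polynomial.monic_X_pow_add hqdeg
    have hqd : q.natDegree = d := by
      rw [Polynomial.natDegree_add_eq_left_of_degree_lt (by rwa [Polynomial.degree_X_pow]),
        Polynomial.natDegree_X_pow]
    have hqr : Polynomial.aeval (s w i) q = 0 := by
      simpa [q, Algebra.smul_def] using hi4
    -- If `v_i` and `w_i` generate `L`, then `[L : C(v_i)]` is the degree of `w_i`, at most `d`.
    -- Hence `θ` has degree at most `d` over `C(v_i)`, while `v_i` has degree at most `n` over
    -- `C(θ)`, against the independence of the monomials.
    have hle : Module.finrank C⟮s v i⟯ L ≤ d := by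
      rw [← finrank_top', ← htop', adjoin.finrank (Algebra.IsIntegral.isIntegral _), ← hqd]
      exact Polynomial.natDegree_le_of_dvd (minpoly.dvd _ _ hqr) hqm.ne_zero
    refine not_linearIndependent_monomials (transcendental_of_D_ne_zero hvi)
      (transcendental_of_D_ne_zero hθ0) (f := minpoly C⟮s v i⟯ θ) (g := minpoly C⟮θ⟯ (s v i))
      (minpoly.ne_zero (Algebra.IsIntegral.isIntegral _)) (minpoly.aeval _ _)
      (minpoly.ne_zero (Algebra.IsIntegral.isIntegral _)) (minpoly.aeval _ _)
      ((minpoly.natDegree_le _).trans hle) (minpoly.natDegree_le _) hi2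
  · have hle : C⟮s v i⟯ ≤ IntermediateField.adjoin C {s v i, s w i} :=
      adjoin.mono _ _ _ (by simp)
    exact FiniteDimensional.right C⟮s v i⟯ (extendScalars hle) L

end Descent

/-! ### Rational functions in affine charts -/

section Chart

theorem isDominant_of_isOpenImmersion {X Y : Scheme.{u}} [IsIntegral X] [IsIntegral Y] (f : X ⟶ Y)
    [IsOpenImmersion f] : IsDominant f := by
  refine ⟨?_⟩
  exact f.isOpenEmbedding.isOpen_range.dense (Set.range_nonempty _)

theorem pullbackFun_congr {X Y : Scheme.{u}} [IsIntegral X] [IsIntegral Y] {f g : X ⟶ Y}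
    [IsDominant f] [IsDominant g] (h : f = g) : pullbackFun f = pullbackFun g := by
  subst h; rfl

theorem pullbackFun_comp {X Y Z : Scheme.{u}} [IsIntegral X] [IsIntegral Y] [IsIntegral Z]
    (f : X ⟶ Y) (g : Y ⟶ Z) [IsDominant f] [IsDominant g] (s : Z.functionField) :
    pullbackFun (f ≫ g) s = pullbackFun f (pullbackFun g s) := by
  have h : Z.presheaf.stalkSpecializes (specializes_of_eq (map_genericPoint (f ≫ g))) ≫
      (f ≫ g).stalkMap (genericPoint X) =
      (Z.presheaf.stalkSpecializes (specializes_of_eq (map_genericPoint g)) ≫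
        g.stalkMap (genericPoint Y)) ≫
      (Y.presheaf.stalkSpecializes (specializes_of_eq (map_genericPoint f)) ≫
        f.stalkMap (genericPoint X)) := by
    rw [Scheme.Hom.stalkMap_comp, Category.assoc, ← Scheme.Hom.stalkSpecializes_stalkMap_assoc,
      TopCat.Presheaf.stalkSpecializes_comp_assoc]
    rfl
  exact congr($(h).hom s)

theorem pullbackFun_bijective {X Y : Scheme.{u}} [IsIntegral X] [IsIntegral Y] (f : X ⟶ Y)
    [IsOpenImmersion f] [IsDominant f] : Function.Bijective (pullbackFun f) := by
  have h1 : IsIso (Y.presheaf.stalkSpecializes (specializes_of_eq (map_genericPoint f))) := by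
    have := TopCat.Presheaf.stalkCongr Y.presheaf (.of_eq (map_genericPoint f))
    refine ⟨Y.presheaf.stalkSpecializes (specializes_of_eq (map_genericPoint f).symm), ?_, ?_⟩
    · rw [TopCat.Presheaf.stalkSpecializes_comp, TopCat.Presheaf.stalkSpecializes_refl]
    · rw [TopCat.Presheaf.stalkSpecializes_comp, TopCat.Presheaf.stalkSpecializes_refl]
  exact ConcreteCategory.bijective_of_isIso (C := CommRingCat)
    (Y.presheaf.stalkSpecializes (specializes_of_eq (map_genericPoint f)) ≫
    f.stalkMap (genericPoint X))

theorem algebraMap_functionField_Spec (R : CommRingCat.{u}) [IsDomain R] (r : R) :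
    algebraMap R (Spec R).functionField r =
      (Spec R).presheaf.germ ⊤ (genericPoint (Spec R)) (TopologicalSpace.Opens.mem_top _)
        ((Scheme.ΓSpecIso R).inv r) := rfl

theorem pullbackFun_SpecMap {R S : CommRingCat.{u}} [IsDomain R] [IsDomain S] (φ : R ⟶ S)
    [IsDominant (Spec.map φ)] (r : R) :
    pullbackFun (Spec.map φ) (algebraMap R (Spec R).functionField r) =
      algebraMap S (Spec S).functionField (φ r) := by
  rw [algebraMap_functionField_Spec, pullbackFun_germ, algebraMap_functionField_Spec]
  congr 1
  exact congr($(Scheme.ΓSpecIso_inv_naturality φ).hom r).symm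

variable {Z : Scheme.{u}} [IsIntegral Z] {A : CommRingCat.{u}} [IsDomain A] (j : Spec A ⟶ Z)
  [IsOpenImmersion j]

/-- The function field of an affine chart is that of the scheme. -/
def chartEquiv : Z.functionField ≃+* (Spec A).functionField :=
  haveI := isDominant_of_isOpenImmersion j
  RingEquiv.ofBijective (pullbackFun j) (pullbackFun_bijective j)

/-- The functions on an affine chart as rational functions. -/
def chartMap : A →+* Z.functionField :=
  (chartEquiv j).symm.toRingHom.comp (algebraMap A (Spec A).functionField)

theorem pullbackFun_chartMap [IsDominant j] (a : A) :
    pullbackFun j (chartMap j a) = algebraMap A (Spec A).functionField a :=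
  (chartEquiv j).apply_symm_apply _

theorem chartMap_injective : Function.Injective (chartMap j) :=
  (chartEquiv j).symm.injective.comp (IsFractionRing.injective A _)

theorem exists_chartMap_div (z : Z.functionField) :
    ∃ a b : A, b ≠ 0 ∧ z = chartMap j a / chartMap j b := by
  obtain ⟨a, b, hb, h⟩ := IsFractionRing.div_surjective (A := A) (chartEquiv j z)
  refine ⟨a, b, nonZeroDivisors.ne_zero hb, ?_⟩
  apply (chartEquiv j).injective
  rw [← h, map_div₀]
  simp [chartMap]

theorem pullbackFun_chartMap_of_comm {W : Scheme.{u}} [IsIntegral W] {B : CommRingCat.{u}}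
    [IsDomain B] (i : Spec B ⟶ W) [IsOpenImmersion i] (f : W ⟶ Z) [IsDominant f] (ψ : A ⟶ B)
    (h : Spec.map ψ ≫ j = i ≫ f) (a : A) :
    pullbackFun f (chartMap j a) = chartMap i (ψ a) := by
  have := isDominant_of_isOpenImmersion j
  have := isDominant_of_isOpenImmersion i
  have : IsDominant (Spec.map ψ ≫ j) := h ▸ inferInstance
  have : IsDominant (Spec.map ψ) := IsDominant.of_comp_of_isOpenImmersion (Spec.map ψ) j
  apply (pullbackFun_bijective i).1
  rw [pullbackFun_chartMap, ← pullbackFun_comp, ← pullbackFun_congr h, pullbackFun_comp,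
    pullbackFun_chartMap, pullbackFun_SpecMap]

end Chart

/-! ### Affine charts of curves -/

namespace Curve

variable {k : Type u} [Field k] (X : Curve k)

theorem chartMap_constant {A : CommRingCat.{u}} [IsDomain A] (j : Spec A ⟶ X.scheme)
    [IsOpenImmersion j] (φ : .of k ⟶ A) (h : Spec.map φ = j ≫ X.toSpec) (c : k) :
    chartMap j (φ c) = algebraMap k X.functionField c := by
  have := isDominant_of_isOpenImmersion j
  apply (pullbackFun_bijective j).1
  rw [pullbackFun_chartMap, algebraMap_functionField_Spec]
  refine Eq.trans ?_ (pullbackFun_germ j _).symm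
  congr 1
  have h1 : φ ≫ (Scheme.ΓSpecIso A).inv =
      (Scheme.ΓSpecIso (.of k)).inv ≫ X.toSpec.appTop ≫ j.appTop := by
    rw [Scheme.ΓSpecIso_inv_naturality, h, Scheme.Hom.comp_appTop]
  exact congr($(h1).hom c)

theorem exists_chart (x : X.scheme) : ∃ (A : CommRingCat.{u}) (_ : IsDomain A)
    (j : Spec A ⟶ X.scheme) (_ : IsOpenImmersion j) (φ : .of k ⟶ A),
    Spec.map φ = j ≫ X.toSpec ∧ x ∈ Set.range j ∧ φ.hom.IsStandardSmoothOfRelativeDimension 1 := by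
  obtain ⟨U, hU, V, hV, hx, e, hf⟩ :=
    X.smooth.exists_isStandardSmoothOfRelativeDimension x
  have : Subsingleton (Spec (.of k)) := inferInstanceAs (Subsingleton (PrimeSpectrum k))
  -- The spectrum of a field is a single point, so the affine open of the base is everything.
  have hUtop : U = ⊤ := by
    rw [eq_top_iff]
    intro y _
    rw [Subsingleton.elim y (X.toSpec x)]
    exact e hx
  subst hUtop
  have : Nonempty V := ⟨⟨x, hx⟩⟩
  refine ⟨Γ(X.scheme, V), inferInstance, hV.fromSpec, inferInstance,
    (Scheme.ΓSpecIso (.of k)).inv ≫ X.toSpec.appLE ⊤ V e, ?_, ?_, ?_⟩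
  · rw [Spec.map_comp, ← IsAffineOpen.SpecMap_appLE_fromSpec X.toSpec hU hV e,
      IsAffineOpen.fromSpec_top, Scheme.isoSpec_Spec_inv]
  · rw [hV.range_fromSpec]; exact hx
  · exact RingHom.isStandardSmoothOfRelativeDimension_respectsIso.2 _
      (Scheme.ΓSpecIso (.of k)).symm.commRingCatIsoToRingEquiv hf

end Curve

/-- Localization is formally étale, so the differentials of `L` are those of `A` tensored with `L`,
and these have rank one. -/
theorem isFunctionField_of_isStandardSmooth (k A L : Type u) [Field k] [CommRing A] [IsDomain A]
    [Field L] [Algebra k A] [Algebra A L] [Algebra k L] [IsScalarTower k A L] [IsFractionRing A L]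
    [Algebra.IsStandardSmoothOfRelativeDimension 1 k A] : IsFunctionField k L := by
  have : Algebra.IsStandardSmooth k A :=
    Algebra.IsStandardSmoothOfRelativeDimension.isStandardSmooth 1
  refine ⟨?_, ?_⟩
  · have : Algebra.EssFiniteType A L := Algebra.EssFiniteType.of_isLocalization L (nonZeroDivisors A)
    exact Algebra.EssFiniteType.comp k A L
  · have : Algebra.FormallyEtale A L := Algebra.FormallyEtale.of_isLocalization (nonZeroDivisors A)
    rw [← (KaehlerDifferential.tensorKaehlerEquivOfFormallyEtale k A L).finrank_eq,
      Module.finrank_baseChange]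
    exact Module.finrank_eq_of_rank_eq
      (Algebra.IsStandardSmoothOfRelativeDimension.rank_kaehlerDifferential 1)

namespace Curve

variable {k : Type u} [Field k] (X : Curve k)

theorem isFunctionField : IsFunctionField k X.functionField := by
  obtain ⟨x⟩ : Nonempty X.scheme := inferInstance
  obtain ⟨A, _, j, _, φ, hφ, -, hs⟩ := X.exists_chart x
  let _ : Algebra k A := φ.hom.toAlgebra
  let _ : Algebra A X.functionField := (chartMap j).toAlgebra
  have : IsScalarTower k A X.functionField :=
    IsScalarTower.of_algebraMap_eq fun c => (X.chartMap_constant j φ hφ c).symm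
  have : FaithfulSMul A X.functionField :=
    (faithfulSMul_iff_algebraMap_injective _ _).2 (chartMap_injective j)
  have : IsFractionRing A X.functionField := IsFractionRing.of_field _ _ fun z => by
    obtain ⟨a, b, -, h⟩ := exists_chartMap_div j z
    exact ⟨a, b, h⟩
  have : Algebra.IsStandardSmoothOfRelativeDimension 1 k A := hs
  exact isFunctionField_of_isStandardSmooth k A X.functionField

end Curve

/-! ### The function field of a base change -/

/-- A common denominator in `A` for the left-hand factors of a tensor. -/
theorem exists_smul_eq_map {C A K L : Type u} [Field C] [CommRing A] [Field K] [Field L]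
    [Algebra C A] [Algebra C K] [Algebra C L] [Algebra A L] [IsScalarTower C A L]
    (hA : ∀ z : L, ∃ a b : A, algebraMap A L b ≠ 0 ∧ z = algebraMap A L a / algebraMap A L b)
    (z : L ⊗[C] K) : ∃ (b : A) (y : A ⊗[C] K), algebraMap A L b ≠ 0 ∧
      (algebraMap A L b ⊗ₜ[C] (1 : K)) * z =
        Algebra.TensorProduct.map (IsScalarTower.toAlgHom C A L) (AlgHom.id C K) y := by
  induction z with
  | zero => exact ⟨1, 0, by simp, by simp⟩
  | tmul l k =>
    obtain ⟨a, b, hb, rfl⟩ := hA l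
    refine ⟨b, a ⊗ₜ k, hb, ?_⟩
    simp [mul_div_cancel₀ _ hb]
  | add p q hp hq =>
    obtain ⟨b, y, hb, hy⟩ := hp
    obtain ⟨b', y', hb', hy'⟩ := hq
    refine ⟨b * b', (b' ⊗ₜ 1) * y + (b ⊗ₜ 1) * y', ?_, ?_⟩
    · rw [map_mul]; exact mul_ne_zero hb hb'
    · have h1 : (algebraMap A L (b * b') ⊗ₜ[C] (1 : K)) =
          (algebraMap A L b ⊗ₜ[C] (1 : K)) * (algebraMap A L b' ⊗ₜ[C] (1 : K)) := by simp
      have h2 : ∀ c : A, Algebra.TensorProduct.map (IsScalarTower.toAlgHom C A L) (AlgHom.id C K)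
          (c ⊗ₜ 1) = algebraMap A L c ⊗ₜ[C] (1 : K) := fun c => by simp
      rw [h1, map_add (Algebra.TensorProduct.map _ _), map_mul (Algebra.TensorProduct.map _ _),
        map_mul (Algebra.TensorProduct.map _ _), ← hy, ← hy', h2, h2]
      ring

/-- After clearing denominators both conditions concern `A ⊗ K`, where the product map is the given
injection `f`. -/
theorem isFracTensor_of_chart {C A K L M : Type u} [Field C] [CommRing A] [Field K] [Field L]
    [Field M] [Algebra C A] [Algebra C K] [Algebra C L] [Algebra A L] [IsScalarTower C A L]
    [Algebra C M] [Algebra K M] [Algebra L M] [IsScalarTower C K M] [IsScalarTower C L M]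
    (hA : ∀ z : L, ∃ a b : A, algebraMap A L b ≠ 0 ∧ z = algebraMap A L a / algebraMap A L b)
    (f : A ⊗[C] K →+* M) (hf : Function.Injective f)
    (hM : ∀ z, ∃ a b, f b ≠ 0 ∧ z = f a / f b)
    (hfl : ∀ a, f (a ⊗ₜ 1) = algebraMap L M (algebraMap A L a))
    (hfr : ∀ c, f (1 ⊗ₜ c) = algebraMap K M c) : IsFracTensor C K L M := by
  set μ := Algebra.TensorProduct.productMap
    (IsScalarTower.toAlgHom C L M) (IsScalarTower.toAlgHom C K M) with hμ
  set ι := Algebra.TensorProduct.map (IsScalarTower.toAlgHom C A L) (AlgHom.id C K)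
  have hμι : ∀ y, μ (ι y) = f y := by
    intro y
    induction y with
    | zero => simp
    | tmul a c =>
      have : (a ⊗ₜ[C] c : A ⊗[C] K) = (a ⊗ₜ 1) * (1 ⊗ₜ c) := by simp
      rw [this, map_mul f, hfl, hfr]
      simp [μ, ι]
    | add p q hp hq => rw [map_add, map_add, map_add, hp, hq]
  refine ⟨?_, fun x => ?_⟩
  · rw [← hμ, injective_iff_map_eq_zero]
    intro z hz
    obtain ⟨b, y, hb, hy⟩ := exists_smul_eq_map hA z
    have h1 := congrArg μ hy
    rw [map_mul, hz, mul_zero] at h1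
    have hy0 : y = 0 := hf (by rw [map_zero, ← hμι]; exact h1.symm)
    rw [hy0, map_zero] at hy
    have h2 : ((algebraMap A L b)⁻¹ ⊗ₜ[C] (1 : K)) * ((algebraMap A L b ⊗ₜ[C] (1 : K)) * z) = z := by
      rw [← mul_assoc, Algebra.TensorProduct.tmul_mul_tmul, inv_mul_cancel₀ hb, one_mul,
        ← Algebra.TensorProduct.one_def, one_mul]
    rw [← h2, hy, mul_zero]
  · obtain ⟨a, b, hb, rfl⟩ := hM x
    refine ⟨ι a, ι b, ?_, ?_⟩
    · intro h
      exact hb (by rw [← hμι, h, map_zero])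
    · rw [← hμ, hμι, hμι, div_mul_cancel₀ _ hb]

namespace Curve

variable {C : Type u} [Field C] [IsAlgClosed C] (K : Type u) [Field K] [Algebra C K]

/-- `K(X_K)` as a `C(X)`-algebra. -/
abbrev algebraBaseChange (X : Curve C) : Algebra X.functionField (X.baseChange K).functionField :=
  (X.baseChangeFun K).toAlgebra

/-- `K(X_K)` as a `C`-algebra. -/
abbrev algebraConstants (X : Curve C) : Algebra C (X.baseChange K).functionField :=
  ((algebraMap K (X.baseChange K).functionField).comp (algebraMap C K)).toAlgebra

/-- If `Spec A` is a chart of `X`, then `Spec (A ⊗ K)` is a chart of `X_K`, and `K(X_K)` is the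
fraction field of its ring. -/
theorem isFracTensor (X : Curve C) :
    letI := X.algebraBaseChange K
    letI := X.algebraConstants K
    haveI : IsScalarTower C K (X.baseChange K).functionField :=
      IsScalarTower.of_algebraMap_eq fun _ => rfl
    haveI : IsScalarTower C X.functionField (X.baseChange K).functionField :=
      IsScalarTower.of_algebraMap_eq fun c => (X.baseChangeFun_algebraMap K c).symm
    IsFracTensor C K X.functionField (X.baseChange K).functionField := by
  let _ := X.algebraBaseChange K
  let _ := X.algebraConstants K
  have : IsScalarTower C K (X.baseChange K).functionField :=
    IsScalarTower.of_algebraMap_eq fun _ => rfl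
  have : IsScalarTower C X.functionField (X.baseChange K).functionField :=
    IsScalarTower.of_algebraMap_eq fun c => (X.baseChangeFun_algebraMap K c).symm
  obtain ⟨x⟩ : Nonempty X.scheme := inferInstance
  obtain ⟨A, _, j, _, φ, hφ, -, hs⟩ := X.exists_chart x
  let _ : Algebra C A := φ.hom.toAlgebra
  let _ : Algebra A X.functionField := (chartMap j).toAlgebra
  have : IsScalarTower C A X.functionField :=
    IsScalarTower.of_algebraMap_eq fun c => (X.chartMap_constant j φ hφ c).symm
  have : Algebra.IsStandardSmoothOfRelativeDimension 1 C A := hs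
  have : Algebra.IsStandardSmooth C A :=
    Algebra.IsStandardSmoothOfRelativeDimension.isStandardSmooth 1
  have : IsDomain (A ⊗[C] K) := isDomain_tensor C A K
  let g := Spec.map (CommRingCat.ofHom (algebraMap C K))
  let i₀ : pullback (Spec.map (CommRingCat.ofHom (algebraMap C A))) g ⟶ pullback X.toSpec g :=
    pullback.map _ _ _ _ j (𝟙 _) (𝟙 _) (by rw [Category.comp_id]; exact hφ) (by simp)
  have hi₀ : IsOpenImmersion i₀ := by
    infer_instance
  let i : Spec (.of (A ⊗[C] K)) ⟶ (X.baseChange K).scheme := (pullbackSpecIso C A K).inv ≫ i₀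
  have : IsOpenImmersion i :=
    IsOpenImmersion.comp (pullbackSpecIso C A K).inv i₀
  have hfst : i ≫ X.proj K =
      Spec.map (CommRingCat.ofHom Algebra.TensorProduct.includeLeftRingHom) ≫ j := by
    change ((pullbackSpecIso C A K).inv ≫ i₀) ≫ pullback.fst _ _ = _
    rw [Category.assoc, pullback.lift_fst, ← Category.assoc]
    congr 1
    exact pullbackSpecIso_inv_fst C A K
  have hsnd : i ≫ (X.baseChange K).toSpec =
      Spec.map (CommRingCat.ofHom (Algebra.TensorProduct.includeRight (R := C) (A := A)).toRingHom) := by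
    change ((pullbackSpecIso C A K).inv ≫ i₀) ≫ pullback.snd _ _ = _
    rw [Category.assoc, pullback.lift_snd, ← Category.assoc, Category.comp_id]
    exact pullbackSpecIso_inv_snd C A K
  refine isFracTensor_of_chart (A := A) (fun z => ?_) (chartMap i) (chartMap_injective i)
    (fun z => ?_) (fun a => ?_) (fun c => ?_)
  · obtain ⟨a, b, hb, h⟩ := exists_chartMap_div j z
    exact ⟨a, b, fun h0 => hb (chartMap_injective j (h0.trans (map_zero _).symm)), h⟩
  · obtain ⟨a, b, hb, h⟩ := exists_chartMap_div i z
    exact ⟨a, b, fun h0 => hb (chartMap_injective i (h0.trans (map_zero _).symm)), h⟩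
  · exact (pullbackFun_chartMap_of_comm j i (X.proj K) _ hfst.symm a).symm
  · exact (X.baseChange K).chartMap_constant i _ hsnd.symm c

end Curve

/-! ### Smoothness of Dedekind domains -/

theorem isStandardSmoothOfRelativeDimension_polynomial (k : Type u) [Field k] :
    Algebra.IsStandardSmoothOfRelativeDimension 1 k (Polynomial k) := by
  let b : Module.Basis Unit (Polynomial k) Ω[Polynomial k⁄k] :=
    (Module.Basis.singleton Unit (Polynomial k)).map (KaehlerDifferential.polynomialEquiv k).symm
  have hb : Set.range b ⊆ Set.range (KaehlerDifferential.D k (Polynomial k)) := by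
    rintro _ ⟨i, rfl⟩
    refine ⟨Polynomial.X, ?_⟩
    apply (KaehlerDifferential.polynomialEquiv k).injective
    simp [b]
  have : Algebra.FinitePresentation k (Polynomial k) := Algebra.FinitePresentation.polynomial k k
  have : Algebra.IsStandardSmooth k (Polynomial k) :=
    Algebra.IsStandardSmooth.of_basis_kaehlerDifferential b hb
  rw [Algebra.IsStandardSmoothOfRelativeDimension.iff_of_isStandardSmooth, rank_eq_card_basis b]
  simp

/-- Near a maximal ideal, a Dedekind domain of finite type over a field of characteristic zero is
étale over the affine line via a uniformizer. -/
theorem exists_etale_polynomial {k A : Type u} [Field k] [CharZero k] [CommRing A]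
    [IsDedekindDomain A] [Algebra k A] [Algebra.FiniteType k A] (hA : ¬ IsField A)
    (q : Ideal A) [hq : q.IsMaximal] : ∃ (t : A), ∃ f ∉ q,
      letI := (Polynomial.aeval (R := k) t).toRingHom.toAlgebra
      Algebra.Etale (Polynomial k) (Localization.Away f) := by
  have hq0 : q ≠ ⊥ := fun h => hA (Ring.isField_iff_maximal_bot.2 (h ▸ hq))
  -- A uniformizer at `q`.
  obtain ⟨t, htq, htq2⟩ : ∃ t ∈ q, t ∉ q ^ 2 :=
    SetLike.exists_of_lt (Ideal.pow_right_strictAnti q hq0 hq.ne_top (by norm_num : 1 < 2) |>.trans_eq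
      (pow_one q))
  refine ⟨t, ?_⟩
  have ht0 : t ≠ 0 := fun h => htq2 (h ▸ zero_mem _)
  -- A non-zero algebraic element of a domain over a field is a unit, whereas `t` lies in `q`.
  have htr : Transcendental k t := by
    intro ht
    have := (ht.isIntegral).isUnit ht0
    exact hq.ne_top (Ideal.eq_top_of_isUnit_mem _ htq this)
  let _ : Algebra (Polynomial k) A := (Polynomial.aeval (R := k) t).toRingHom.toAlgebra
  have hmap : ∀ p, algebraMap (Polynomial k) A p = Polynomial.aeval t p := fun _ => rfl
  have : IsScalarTower k (Polynomial k) A := IsScalarTower.of_algebraMap_eq fun c => by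
    rw [hmap, ← Polynomial.C_eq_algebraMap, Polynomial.aeval_C]
  have : Algebra.FiniteType (Polynomial k) A := Algebra.FiniteType.of_restrictScalars_finiteType k _ _
  have : Algebra.FinitePresentation (Polynomial k) A :=
    Algebra.FinitePresentation.of_finiteType.1 inferInstance
  have hinj : Function.Injective (algebraMap (Polynomial k) A) :=
    transcendental_iff_injective.1 htr
  have : FaithfulSMul (Polynomial k) A := (faithfulSMul_iff_algebraMap_injective _ _).2 hinj
  have : Module.IsTorsionFree (Polynomial k) A := inferInstance
  have : Module.Flat (Polynomial k) A := inferInstance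
  let p : Ideal (Polynomial k) := q.under _
  have hX : (Polynomial.X : Polynomial k) ∈ p := by
    rw [Ideal.mem_comap, hmap, Polynomial.aeval_X]; exact htq
  -- Two conditions: the residue extension is separable, being algebraic in characteristic zero, and
  -- the contracted prime generates the maximal ideal of the local ring at `q`. The second holds
  -- already for the image `t` of `X`.
  have : Algebra.IsUnramifiedAt (Polynomial k) q := by
    let _ := Localization.AtPrime.algebraOfLiesOver p q
    refine (Algebra.isUnramifiedAt_iff_map_eq (Polynomial k) p q).2 ⟨?_, ?_⟩
    · have h1 : CharZero p.ResidueField :=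
        charZero_of_injective_algebraMap (algebraMap k p.ResidueField).injective
      let _ : Field (A ⧸ q) := Ideal.Quotient.field q
      have : Module.Finite k (A ⧸ q) := finite_of_finite_type_of_isJacobsonRing k (A ⧸ q)
      have h2 : IsScalarTower k p.ResidueField q.ResidueField :=
        IsScalarTower.of_algebraMap_eq fun c => by
          rw [IsScalarTower.algebraMap_apply k (Polynomial k) p.ResidueField,
            ← IsScalarTower.algebraMap_apply (Polynomial k) p.ResidueField q.ResidueField,
            IsScalarTower.algebraMap_apply (Polynomial k) A q.ResidueField,
            ← IsScalarTower.algebraMap_apply k (Polynomial k) A,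
            ← IsScalarTower.algebraMap_apply k A q.ResidueField]
      have h3 : Algebra.IsAlgebraic k q.ResidueField := by
        have h4 := (Ideal.bijective_algebraMap_quotient_residueField q).2
        let e : (A ⧸ q) →ₐ[k] q.ResidueField := IsScalarTower.toAlgHom k (A ⧸ q) q.ResidueField
        have : Algebra.IsAlgebraic k (A ⧸ q) := inferInstance
        exact ⟨fun x => by
          obtain ⟨y, rfl⟩ := h4 x
          exact (Algebra.IsAlgebraic.isAlgebraic y).algHom e⟩
      have : Algebra.IsAlgebraic p.ResidueField q.ResidueField :=
        Algebra.IsAlgebraic.tower_top (K := k) p.ResidueField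
      infer_instance
    · apply le_antisymm
      · rw [← Localization.AtPrime.map_eq_maximalIdeal, IsScalarTower.algebraMap_eq (Polynomial k) A,
          ← Ideal.map_map]
        exact Ideal.map_mono Ideal.map_comap_le
      · rw [← Localization.AtPrime.map_eq_maximalIdeal, Ideal.map_le_iff_le_comap]
        intro x hx
        -- Write `(t) = q J`. As `t` is not in `q ^ 2`, some `s` in `J` lies outside `q`; it becomes
        -- a unit in the local ring and multiplies `q` into `(t)`.
        obtain ⟨J, hJ⟩ := Ideal.dvd_iff_le.2 ((Ideal.span_singleton_le_iff_mem q).2 htq)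
        have hJq : ¬ J ≤ q := fun h => htq2 (by
          rw [pow_two, ← Ideal.span_singleton_le_iff_mem, hJ]
          exact Ideal.mul_mono_right h)
        obtain ⟨s, hs, hsq⟩ := SetLike.not_le_iff_exists.1 hJq
        have h1 : x * s ∈ Ideal.span {t} := hJ ▸ Ideal.mul_mem_mul hx hs
        obtain ⟨a, ha⟩ := Ideal.mem_span_singleton'.1 h1
        have hu : IsUnit (algebraMap A (Localization.AtPrime q) s) :=
          IsLocalization.map_units _ (⟨s, hsq⟩ : q.primeCompl)
        rw [Ideal.mem_comap, ← Ideal.mul_unit_mem_iff_mem _ hu, ← map_mul, ← ha, map_mul]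
        refine Ideal.mul_mem_left _ _ ?_
        have h2 := Ideal.mem_map_of_mem (algebraMap (Polynomial k) (Localization.AtPrime q)) hX
        rwa [IsScalarTower.algebraMap_apply (Polynomial k) A, hmap, Polynomial.aeval_X] at h2
  have : Algebra.IsEtaleAt (Polynomial k) q := Algebra.IsEtaleAt.of_isUnramifiedAt_of_flat q
  exact Algebra.exists_etale_of_isEtaleAt q

/-- Near each maximal ideal the ring is étale over the affine line, and the line is smooth of
relative dimension one. The elements `f` with good localization lie in no common maximal ideal, so
they generate the unit ideal. -/
theorem locally_isStandardSmooth {k A : Type u} [Field k] [CharZero k] [CommRing A]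
    [IsDedekindDomain A] [Algebra k A] [Algebra.FiniteType k A] (hA : ¬ IsField A) :
    RingHom.Locally (RingHom.IsStandardSmoothOfRelativeDimension 1) (algebraMap k A) := by
  rw [RingHom.locally_iff_span_eq_top]
  by_contra h
  obtain ⟨q, hq, hle⟩ := Ideal.exists_le_maximal _ h
  obtain ⟨t, f, hf, he⟩ := exists_etale_polynomial (k := k) hA q
  refine hf (hle (Ideal.subset_span ?_))
  let _ : Algebra (Polynomial k) A := (Polynomial.aeval (R := k) t).toRingHom.toAlgebra
  have h1 : (algebraMap (Polynomial k) (Localization.Away f)).IsStandardSmoothOfRelativeDimension 0 := by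
    rw [RingHom.isStandardSmoothOfRelativeDimension_algebraMap]
    exact Algebra.Etale.iff_isStandardSmoothOfRelativeDimension_zero.1 he
  have h2 : (algebraMap k (Polynomial k)).IsStandardSmoothOfRelativeDimension 1 := by
    rw [RingHom.isStandardSmoothOfRelativeDimension_algebraMap]
    exact isStandardSmoothOfRelativeDimension_polynomial k
  have h3 := h1.comp h2
  have h4 : (algebraMap (Polynomial k) (Localization.Away f)).comp (algebraMap k (Polynomial k)) =
      (algebraMap A (Localization.Away f)).comp (algebraMap k A) := by
    ext c
    rw [RingHom.comp_apply, RingHom.comp_apply, IsScalarTower.algebraMap_apply (Polynomial k) A]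
    congr 1
    exact Polynomial.aeval_C t c
  rw [h4] at h3
  exact h3

/-! ### Integral closures in a function field -/

section NormalRing

theorem isLocalization_away_of_injective {S T : Type u} [CommRing S] [CommRing T] [Algebra S T]
    (v : S) (hinj : Function.Injective (algebraMap S T)) (hv : IsUnit (algebraMap S T v))
    (h : ∀ z : T, ∃ (n : ℕ) (y : S), algebraMap S T v ^ n * z = algebraMap S T y) :
    IsLocalization.Away v T where
  map_units := by
    rintro ⟨_, n, rfl⟩
    simpa using hv.pow n
  surj z := by
    obtain ⟨n, y, hy⟩ := h z
    exact ⟨(y, ⟨v ^ n, n, rfl⟩), by rw [← hy, mul_comm]; simp⟩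
  exists_of_eq {x y} hxy := ⟨1, by rw [hinj hxy]⟩

theorem isOpenImmersion_of_injective {S T : Type u} [CommRing S] [CommRing T] (φ : S →+* T)
    (v : S) (hinj : Function.Injective φ) (hv : IsUnit (φ v))
    (h : ∀ z : T, ∃ (n : ℕ) (y : S), φ v ^ n * z = φ y) :
    IsOpenImmersion (Spec.map (CommRingCat.ofHom φ)) := by
  let _ := φ.toAlgebra
  have := isLocalization_away_of_injective (T := T) v hinj hv h
  exact IsOpenImmersion.of_isLocalization v

theorem exists_comp_eq_of_injective {S T F : Type u} [CommRing S] [CommRing T] [Field F]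
    (φ : S →+* T) (v : S) (hinj : Function.Injective φ) (hv : IsUnit (φ v))
    (h : ∀ z : T, ∃ (n : ℕ) (y : S), φ v ^ n * z = φ y) (α : S →+* F) (hα : α v ≠ 0) :
    ∃ γ : T →+* F, γ.comp φ = α := by
  let _ := φ.toAlgebra
  have := isLocalization_away_of_injective (T := T) v hinj hv h
  exact ⟨IsLocalization.Away.lift v (isUnit_iff_ne_zero.2 hα), IsLocalization.Away.lift_comp v _⟩

theorem exists_pow_mul_isIntegral {S T E : Type u} [CommRing S] [CommRing T] [Field E]
    [Algebra S E] [Algebra T E] (φ : S →+* T) (hφ : ∀ x, algebraMap T E (φ x) = algebraMap S E x)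
    (v : S) (hinj : Function.Injective φ) (hv : IsUnit (φ v))
    (h : ∀ z : T, ∃ (n : ℕ) (y : S), φ v ^ n * z = φ y) {x : E} (hx : IsIntegral T x) :
    ∃ n : ℕ, IsIntegral S (algebraMap S E v ^ n * x) := by
  let _ := φ.toAlgebra
  have := isLocalization_away_of_injective (T := T) v hinj hv h
  have : IsScalarTower S T E := IsScalarTower.of_algebraMap_eq fun x => (hφ x).symm
  obtain ⟨⟨_, n, rfl⟩, h⟩ := IsIntegral.exists_multiple_integral_of_isLocalization
    (Submonoid.powers v) (Rₘ := T) x hx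
  refine ⟨n, ?_⟩
  rw [← map_pow, ← Algebra.smul_def]
  exact h

variable (k : Type u) {E : Type u} [Field k] [Field E] [Algebra k E]

/-- The integral closure in `E` of the `k`-algebra generated by `s`. -/
@[irreducible] def normalRing (s : Set E) : Subalgebra k E :=
  (integralClosure (Algebra.adjoin k s) E).restrictScalars k

theorem mem_normalRing {s : Set E} {x : E} :
    x ∈ normalRing k s ↔ IsIntegral (Algebra.adjoin k s) x := by
  rw [normalRing]; rfl

theorem mem_normalRing_of_mem_adjoin {s : Set E} {x : E} (h : x ∈ Algebra.adjoin k s) :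
    x ∈ normalRing k s :=
  (mem_normalRing k).2 <| isIntegral_algebraMap (R := Algebra.adjoin k s) (A := E) (x := ⟨x, h⟩)

theorem mem_normalRing_of_mem {s : Set E} {x : E} (h : x ∈ s) : x ∈ normalRing k s :=
  mem_normalRing_of_mem_adjoin k (Algebra.subset_adjoin h)

theorem normalRing_mono {s t : Set E} (h : s ⊆ t) : normalRing k s ≤ normalRing k t := by
  intro x hx
  rw [mem_normalRing] at hx ⊢
  exact IsIntegral.map_of_comp_eq (Subalgebra.inclusion (Algebra.adjoin_mono h)).toRingHom
    (RingHom.id E) rfl hx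

/-- The inclusion of integral closures. -/
def normalRingMap {s t : Set E} (h : s ⊆ t) : normalRing k s →+* normalRing k t :=
  (Subalgebra.inclusion (normalRing_mono k h)).toRingHom

/-- An element of the generating set. -/
def normalGen {s : Set E} (x : E) (h : x ∈ s) : normalRing k s := ⟨x, mem_normalRing_of_mem k h⟩

@[simp]
theorem coe_normalRingMap {s t : Set E} (h : s ⊆ t) (x : normalRing k s) :
    (normalRingMap k h x : E) = x := by
  rw [normalRingMap, AlgHom.toRingHom_eq_coe, RingHom.coe_coe, Subalgebra.coe_inclusion]

@[simp]
theorem coe_normalGen {s : Set E} (x : E) (h : x ∈ s) : (normalGen k x h : E) = x := rfl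

variable {k}

theorem exists_pow_mul_mem_adjoin {v x : E} (hv : v ≠ 0)
    (hx : x ∈ Algebra.adjoin k {v, v⁻¹}) : ∃ n : ℕ, v ^ n * x ∈ Algebra.adjoin k {v} := by
  have hv' : v ∈ Algebra.adjoin k {v} := Algebra.subset_adjoin rfl
  induction hx using Algebra.adjoin_induction with
  | mem x hx =>
    rcases hx with rfl | rfl
    · exact ⟨0, by simp⟩
    · exact ⟨1, by simp [hv]⟩
  | algebraMap r => exact ⟨0, by simp⟩
  | add x y _ _ hx hy =>
    obtain ⟨n, hn⟩ := hx
    obtain ⟨m, hm⟩ := hy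
    refine ⟨n + m, ?_⟩
    have : v ^ (n + m) * (x + y) = v ^ m * (v ^ n * x) + v ^ n * (v ^ m * y) := by ring
    rw [this]
    exact add_mem (mul_mem (pow_mem hv' _) hn) (mul_mem (pow_mem hv' _) hm)
  | mul x y _ _ hx hy =>
    obtain ⟨n, hn⟩ := hx
    obtain ⟨m, hm⟩ := hy
    refine ⟨n + m, ?_⟩
    have : v ^ (n + m) * (x * y) = (v ^ n * x) * (v ^ m * y) := by ring
    rw [this]
    exact mul_mem hn hm

/-- Integral closure commutes with inverting `v`: an equation over `k[v, v⁻¹]` becomes one over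
`k[v]` after scaling by a power of `v`. -/
theorem exists_pow_mul_mem_normalRing {v x : E} (hv : v ≠ 0)
    (hx : x ∈ normalRing k {v, v⁻¹}) : ∃ n : ℕ, v ^ n * x ∈ normalRing k {v} := by
  have h : ({v} : Set E) ⊆ {v, v⁻¹} := by simp
  refine exists_pow_mul_isIntegral (Subalgebra.inclusion (Algebra.adjoin_mono h)).toRingHom
    (fun _ => rfl) (⟨v, Algebra.subset_adjoin rfl⟩ : Algebra.adjoin k {v})
    (Subalgebra.inclusion_injective _) ?_ (fun z => ?_) ((mem_normalRing k).1 hx) |>.imp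
      fun n hn => (mem_normalRing k).2 hn
  · refine IsUnit.of_mul_eq_one (⟨v⁻¹, Algebra.subset_adjoin (by simp)⟩ :
      Algebra.adjoin k {v, v⁻¹}) (Subtype.ext ?_)
    exact mul_inv_cancel₀ hv
  · obtain ⟨n, hn⟩ := exists_pow_mul_mem_adjoin hv z.2
    exact ⟨n, ⟨_, hn⟩, Subtype.ext rfl⟩

theorem normalRingMap_injective {s t : Set E} (h : s ⊆ t) :
    Function.Injective (normalRingMap k h) := fun x y hxy => Subtype.ext <| by
  rw [← coe_normalRingMap k h x, hxy, coe_normalRingMap]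

/-- The set `t` is only propositionally equal to `{v, v⁻¹}`, so that the same overlap ring serves
for `v` and for `v⁻¹`. -/
theorem isUnit_normalRingMap {v : E} (hv : v ≠ 0) {t : Set E} (ht : t = {v, v⁻¹})
    (h : {v} ⊆ t) : IsUnit (normalRingMap k h (normalGen k v (Set.mem_singleton v))) := by
  subst ht
  refine IsUnit.of_mul_eq_one (normalGen k v⁻¹ (by simp)) (Subtype.ext ?_)
  rw [Subalgebra.coe_mul, coe_normalRingMap, coe_normalGen, coe_normalGen, mul_inv_cancel₀ hv,
    Subalgebra.coe_one]

theorem exists_normalRingMap_pow_mul_eq {v : E} (hv : v ≠ 0) {t : Set E} (ht : t = {v, v⁻¹})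
    (h : {v} ⊆ t) (z : normalRing k t) : ∃ (n : ℕ) (y : normalRing k {v}),
      normalRingMap k h (normalGen k v (Set.mem_singleton v)) ^ n * z = normalRingMap k h y := by
  obtain ⟨z, hz⟩ := z
  have hz' : z ∈ normalRing k {v, v⁻¹} := ht ▸ hz
  obtain ⟨n, hn⟩ := exists_pow_mul_mem_normalRing hv hz'
  refine ⟨n, ⟨_, hn⟩, Subtype.ext ?_⟩
  rw [Subalgebra.coe_mul, Subalgebra.coe_pow, coe_normalRingMap, coe_normalRingMap, coe_normalGen]

theorem isOpenImmersion_normalRingMap {v : E} (hv : v ≠ 0) {t : Set E} (ht : t = {v, v⁻¹})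
    (h : {v} ⊆ t) : IsOpenImmersion (Spec.map (CommRingCat.ofHom (normalRingMap k h))) :=
  isOpenImmersion_of_injective (normalRingMap k h) _ (normalRingMap_injective h)
    (isUnit_normalRingMap hv ht h) (exists_normalRingMap_pow_mul_eq hv ht h)

/-- A homomorphism from an integral closure to the fraction field of a valuation ring takes values
in the valuation ring as soon as it does so on generators. -/
theorem mem_range_of_normalRing {R F : Type u} [CommRing R] [IsDomain R] [ValuationRing R] [Field F]
    [Algebra R F] [IsFractionRing R F] {s : Set E} (γ : normalRing k s →+* F)
    (hc : ∀ c : k, γ (algebraMap k _ c) ∈ Set.range (algebraMap R F))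
    (hs : ∀ x (hx : x ∈ s), γ (normalGen k x hx) ∈ Set.range (algebraMap R F))
    (a : normalRing k s) : γ a ∈ Set.range (algebraMap R F) := by
  let j : Algebra.adjoin k s →+* normalRing k s := (Subalgebra.inclusion
    (fun x hx => mem_normalRing_of_mem_adjoin k hx :
      Algebra.adjoin k s ≤ normalRing k s)).toRingHom
  have h1 : ∀ x (hx : x ∈ Algebra.adjoin k s),
      γ ⟨x, mem_normalRing_of_mem_adjoin k hx⟩ ∈ (algebraMap R F).range := by
    intro x hx
    induction hx using Algebra.adjoin_induction with
    | mem x hx => exact hs x hx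
    | algebraMap r => exact hc r
    | add x y hx hy h h' =>
      have := add_mem h h'
      rwa [← map_add] at this
    | mul x y hx hy h h' =>
      have := mul_mem h h'
      rwa [← map_mul] at this
  have hinj := IsFractionRing.injective R F
  let e : R ≃+* (algebraMap R F).range := RingEquiv.ofBijective (algebraMap R F).rangeRestrict
    ⟨fun x y hxy => hinj (congrArg Subtype.val hxy), (algebraMap R F).rangeRestrict_surjective⟩
  -- On the generated subalgebra `γ` takes values in `R`. The integral equation of `a` maps to one
  -- for `γ a` over `R`, and valuation rings are integrally closed.
  let δ : Algebra.adjoin k s →+* R := e.symm.toRingHom.comp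
    ((γ.comp j).codRestrict _ fun x => h1 x x.2)
  have hδ : ∀ x, algebraMap R F (δ x) = γ (j x) := fun x =>
    congrArg Subtype.val (e.apply_symm_apply _)
  obtain ⟨p, hp, hpa⟩ := (mem_normalRing k).1 a.2
  have h2 : p.eval₂ j a = 0 := by
    apply Subtype.val_injective
    have := Polynomial.hom_eval₂ p j (normalRing k s).val.toRingHom a
    exact this.trans hpa
  have h3 : (p.map δ).eval₂ (algebraMap R F) (γ a) = 0 := by
    rw [Polynomial.eval₂_map, show (algebraMap R F).comp δ = γ.comp j from RingHom.ext hδ,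
      ← Polynomial.hom_eval₂, h2, map_zero]
  exact IsIntegrallyClosed.isIntegral_iff.1 ⟨p.map δ, hp.map δ, h3⟩

theorem isDedekindDomain_of_isIntegralClosure (k R F E A : Type u) [Field k] [CharZero k]
    [CommRing R] [IsDomain R] [IsPrincipalIdealRing R] [Field F] [Field E] [CommRing A] [IsDomain A]
    [Algebra k R] [Algebra.FiniteType k R] [Algebra R F] [IsFractionRing R F] [Algebra R E]
    [Algebra F E] [IsScalarTower R F E] [FiniteDimensional F E] [Algebra R A] [Algebra A E]
    [IsScalarTower R A E] [IsIntegralClosure A R E] [Algebra k A] [IsScalarTower k R A]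
    [CharZero F] :
    Algebra.FiniteType k A ∧ IsDedekindDomain A ∧ IsFractionRing A E ∧
      (¬ IsField R → ¬ IsField A) := by
  have h1 : Module.Finite R A := IsIntegralClosure.finite R F E A
  have h2 : IsFractionRing A E := IsIntegralClosure.isFractionRing_of_finite_extension R F E A
  refine ⟨Algebra.FiniteType.trans ‹_› inferInstance, IsIntegralClosure.isDedekindDomain R F E A,
    h2, fun h h' => h ?_⟩
  have h3 : Function.Injective (algebraMap R A) := by
    have h4 : Function.Injective (algebraMap R E) := by
      rw [IsScalarTower.algebraMap_eq R F E]
      exact (algebraMap F E).injective.comp (IsFractionRing.injective R F)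
    rw [IsScalarTower.algebraMap_eq R A E] at h4
    exact Function.Injective.of_comp h4
  exact isField_of_isIntegral_of_isField h3 h'

theorem isPrincipalIdealRing_adjoin (v : E) : IsPrincipalIdealRing (Algebra.adjoin k {v}) := by
  have h : Function.Surjective (Polynomial.aeval (R := k)
      (⟨v, Algebra.subset_adjoin rfl⟩ : Algebra.adjoin k {v})) := by
    rintro ⟨x, hx⟩
    rw [Algebra.adjoin_singleton_eq_range_aeval] at hx
    obtain ⟨p, rfl⟩ := hx
    refine ⟨p, Subtype.ext ?_⟩
    exact (Polynomial.aeval_algHom_apply (Algebra.adjoin k {v}).val _ p).symm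
  exact IsPrincipalIdealRing.of_surjective _ h

theorem not_isField_adjoin {v : E} (hv : Transcendental k v) : ¬ IsField (Algebra.adjoin k {v}) := by
  intro h1
  have hv0 : (⟨v, Algebra.subset_adjoin rfl⟩ : Algebra.adjoin k {v}) ≠ 0 := fun h =>
    hv (by rw [show v = 0 from congrArg Subtype.val h]; exact isAlgebraic_zero)
  obtain ⟨⟨w, hw⟩, hvw⟩ := h1.mul_inv_cancel hv0
  rw [Algebra.adjoin_singleton_eq_range_aeval] at hw
  obtain ⟨p, rfl⟩ := hw
  have h2 : v * Polynomial.aeval v p = 1 := congrArg Subtype.val hvw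
  have h3 : Polynomial.aeval v (Polynomial.X * p - 1) = 0 := by simp [h2]
  have h4 := (transcendental_iff.1 hv) _ h3
  -- An inverse `p(v)` of `v` would force `X p = 1` as polynomials, which fails at 0.
  have h5 := congrArg (Polynomial.eval 0) h4
  simp at h5

open scoped IntermediateField.algebraAdjoinAdjoin in
theorem normalRing_isDedekindDomain [CharZero k] {v : E} (hv : Transcendental k v)
    [FiniteDimensional (IntermediateField.adjoin k {v}) E] :
    Algebra.FiniteType k (normalRing k {v}) ∧ IsDedekindDomain (normalRing k {v}) ∧
      IsFractionRing (normalRing k {v}) E ∧ ¬ IsField (normalRing k {v}) := by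
  let R := Algebra.adjoin k {v}
  let F := IntermediateField.adjoin k {v}
  have h1 : IsPrincipalIdealRing R := isPrincipalIdealRing_adjoin (k := k) v
  have h2 : Algebra.FiniteType k R :=
    (Subalgebra.fg_iff_finiteType _).1 ⟨{v}, by simp [R]⟩
  have h3 : CharZero F := charZero_of_injective_algebraMap (algebraMap k F).injective
  let _ : Algebra R (normalRing k {v}) := (Subalgebra.inclusion
    (fun x hx => mem_normalRing_of_mem_adjoin k hx : R ≤ normalRing k {v})).toRingHom.toAlgebra
  have h4 : IsScalarTower R (normalRing k {v}) E := IsScalarTower.of_algebraMap_eq fun _ => rfl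
  have h5 : IsScalarTower k R (normalRing k {v}) := IsScalarTower.of_algebraMap_eq fun _ => rfl
  have h6 : IsIntegralClosure (normalRing k {v}) R E :=
    ⟨Subtype.val_injective, fun {x} => ⟨fun h => ⟨⟨x, (mem_normalRing k).2 h⟩, rfl⟩, by
      rintro ⟨y, rfl⟩; exact (mem_normalRing k).1 y.2⟩⟩
  have h7 : IsScalarTower R F E := IsScalarTower.of_algebraMap_eq fun _ => rfl
  obtain ⟨h8, h9, h10, h11⟩ := isDedekindDomain_of_isIntegralClosure k R F E (normalRing k {v})
  exact ⟨h8, h9, h10, h11 (not_isField_adjoin hv)⟩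

end NormalRing

/-! ### Gluing two schemes along an open subscheme -/

section Glue

variable {U V W : Scheme.{u}} (f : W ⟶ U) (g : W ⟶ V) [IsOpenImmersion f] [IsOpenImmersion g]

theorem isOpenImmersion_span_map {i j : WalkingSpan} (h : i ⟶ j) :
    IsOpenImmersion ((span f g).map h) := by
  rcases h with _ | (_ | _)
  · exact inferInstanceAs (IsOpenImmersion ((span f g).map (𝟙 _)))
  · exact inferInstanceAs (IsOpenImmersion f)
  · exact inferInstanceAs (IsOpenImmersion g)

/-- The scheme is the pushout of the two open immersions, seen as a locally directed colimit; this
also describes its points and the intersection of the two charts. -/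
theorem exists_glue : ∃ (Y : Scheme.{u}) (i : U ⟶ Y) (j : V ⟶ Y), IsOpenImmersion i ∧
    IsOpenImmersion j ∧ f ≫ i = g ≫ j ∧ (∀ y, y ∈ Set.range i ∨ y ∈ Set.range j) ∧
    (∀ x y, i x = j y → ∃ w, f w = x ∧ g w = y) ∧
    ∀ (T : Scheme.{u}) (a : U ⟶ T) (b : V ⟶ T), f ≫ a = g ≫ b →
      ∃ c : Y ⟶ T, i ≫ c = a ∧ j ≫ c = b := by
  have h1 : ∀ {i j : WalkingSpan} (h : i ⟶ j), IsOpenImmersion ((span f g).map h) :=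
    fun h => isOpenImmersion_span_map f g h
  have h2 : (span f g ⋙ Scheme.forget).IsLocallyDirected :=
    inferInstanceAs (((span f g : WidePushoutShape WalkingPair ⥤ Scheme.{u}) ⋙
      Scheme.forget).IsLocallyDirected)
  have : Quiver.IsThin WalkingSpan := inferInstance
  have : HasColimit (span f g) := inferInstance
  refine ⟨colimit (span f g), colimit.ι (span f g) WalkingSpan.left,
    colimit.ι (span f g) WalkingSpan.right,
    (Scheme.IsLocallyDirected.openCover (span f g)).map_prop _,
    (Scheme.IsLocallyDirected.openCover (span f g)).map_prop _, ?_, ?_, ?_, ?_⟩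
  · exact (colimit.w (span f g) WalkingSpan.Hom.fst).trans
      (colimit.w (span f g) WalkingSpan.Hom.snd).symm
  · intro y
    obtain ⟨k, z, hz⟩ := Scheme.IsLocallyDirected.ι_jointly_surjective (span f g) y
    rcases k with _ | (_ | _)
    · left
      refine ⟨f z, ?_⟩
      rw [← hz, ← colimit.w (span f g) WalkingSpan.Hom.fst]
      rfl
    · exact Or.inl ⟨z, hz⟩
    · exact Or.inr ⟨z, hz⟩
  · intro x y h
    obtain ⟨k, fi, fj, z, hx, hy⟩ := (Scheme.IsLocallyDirected.ι_eq_ι_iff (span f g)).1 h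
    rcases k with _ | (_ | _)
    · obtain rfl : fi = WalkingSpan.Hom.fst := Subsingleton.elim _ _
      obtain rfl : fj = WalkingSpan.Hom.snd := Subsingleton.elim _ _
      exact ⟨z, hx, hy⟩
    · cases (show WidePushoutShape.Hom (some WalkingPair.left) (some WalkingPair.right) from fj)
    · cases (show WidePushoutShape.Hom (some WalkingPair.right) (some WalkingPair.left) from fi)
  · intro T a b hab
    exact ⟨pushout.desc a b hab, pushout.inl_desc _ _ _, pushout.inr_desc _ _ _⟩

end Glue

/-! ### Properness of glued schemes -/

section Proper

theorem exists_comp_eq_of_mem_range {A R F : CommRingCat.{u}} (ι : R ⟶ F)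
    (hι : Function.Injective ι) (α : A ⟶ F) (h : ∀ a, α a ∈ Set.range ι) :
    ∃ β : A ⟶ R, β ≫ ι = α := by
  let e : R ≃+* ι.hom.range := RingEquiv.ofBijective ι.hom.rangeRestrict
    ⟨fun x y hxy => hι (congrArg Subtype.val hxy), ι.hom.rangeRestrict_surjective⟩
  let α' : A →+* ι.hom.range := α.hom.codRestrict _ fun a => h a
  refine ⟨CommRingCat.ofHom (e.symm.toRingHom.comp α'), ?_⟩
  ext a
  exact congrArg Subtype.val (e.apply_symm_apply (α' a))

/-- The valuative condition on one of two affine charts glued along an open subscheme: a point of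
the chart `Spec A` with values in the fraction field of a valuation ring extends to the valuation
ring in one of the two charts. -/
def ChartValuative {k A A' B : CommRingCat.{u}} (σ : k ⟶ A) (φ : A ⟶ B) (φ' : A' ⟶ B) : Prop :=
  ∀ (R F : Type u) [CommRing R] [IsDomain R] [ValuationRing R] [Field F] [Algebra R F]
    [IsFractionRing R F] (α : A ⟶ .of F), (∀ c, α (σ c) ∈ Set.range (algebraMap R F)) →
    (∀ a, α a ∈ Set.range (algebraMap R F)) ∨
      ∃ γ : B ⟶ .of F, φ ≫ γ = α ∧ ∀ a, γ (φ' a) ∈ Set.range (algebraMap R F)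

variable {k A₀ A₁ B : CommRingCat.{u}} {φ₀ : A₀ ⟶ B} {φ₁ : A₁ ⟶ B} {σ₀ : k ⟶ A₀} {σ₁ : k ⟶ A₁}
  {Y : Scheme.{u}} (i₀ : Spec A₀ ⟶ Y) (i₁ : Spec A₁ ⟶ Y) [IsOpenImmersion i₀]
  (s : Y ⟶ Spec k)

/-- Existence half of the valuative criterion for a generic point in the first chart. It is a map
`α` to the fraction field, and the hypothesis factors it through the valuation ring either there or,
across the overlap, in the second chart. -/
theorem exists_lift_of_chartValuative (hcomm : Spec.map φ₀ ≫ i₀ = Spec.map φ₁ ≫ i₁)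
    (h₀ : i₀ ≫ s = Spec.map σ₀) (h₁ : i₁ ≫ s = Spec.map σ₁) (hσ : σ₀ ≫ φ₀ = σ₁ ≫ φ₁)
    (hv : ChartValuative σ₀ φ₀ φ₁) (S : ValuativeCommSq s)
    (hS : Set.range S.i₁ ⊆ Set.range i₀) : S.commSq.HasLift := by
  have hinj : Function.Injective (CommRingCat.ofHom (algebraMap S.R S.K)) :=
    IsFractionRing.injective S.R S.K
  obtain ⟨α, hα⟩ := Spec.map_surjective (IsOpenImmersion.lift i₀ S.i₁ hS)
  obtain ⟨κ, hκ⟩ := Spec.map_surjective S.i₂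
  have hα' : Spec.map α ≫ i₀ = S.i₁ := by rw [hα, IsOpenImmersion.lift_fac]
  have hw : σ₀ ≫ α = κ ≫ CommRingCat.ofHom (algebraMap S.R S.K) := by
    apply Spec.map_injective
    rw [Spec.map_comp, Spec.map_comp, hκ, ← h₀, ← Category.assoc, hα']
    exact S.commSq.w
  rcases hv S.R S.K α (fun c => ⟨κ c, (congr($(hw).hom c)).symm⟩) with h | ⟨γ, hγ, h⟩
  · obtain ⟨β, hβ⟩ := exists_comp_eq_of_mem_range (CommRingCat.ofHom (algebraMap S.R S.K)) hinj α h
    refine ⟨⟨⟨Spec.map β ≫ i₀, ?_, ?_⟩⟩⟩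
    · rw [← Category.assoc, ← Spec.map_comp, hβ, hα']
    · rw [Category.assoc, h₀, ← Spec.map_comp, ← hκ]
      congr 1
      rw [← hβ] at hw
      ext c
      exact hinj congr($(hw).hom c)
  · obtain ⟨β, hβ⟩ := exists_comp_eq_of_mem_range (CommRingCat.ofHom (algebraMap S.R S.K)) hinj
      (φ₁ ≫ γ) h
    refine ⟨⟨⟨Spec.map β ≫ i₁, ?_, ?_⟩⟩⟩
    · rw [← Category.assoc, ← Spec.map_comp, hβ, Spec.map_comp, Category.assoc, ← hcomm,
        ← Category.assoc, ← Spec.map_comp, hγ, hα']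
    · rw [Category.assoc, h₁, ← Spec.map_comp, ← hκ]
      congr 1
      have h2 : σ₁ ≫ β ≫ CommRingCat.ofHom (algebraMap S.R S.K) =
          κ ≫ CommRingCat.ofHom (algebraMap S.R S.K) := by
        rw [hβ, ← hw, ← hγ, reassoc_of% hσ]
      ext c
      exact hinj congr($(h2).hom c)

variable [IsOpenImmersion i₁]

/-- An open subset of the spectrum of a local ring containing the closed point is everything. -/
theorem range_subset_of_closedPoint_mem {R : CommRingCat.{u}} [IsLocalRing R] {U : Scheme.{u}}
    (i : U ⟶ Y) [IsOpenImmersion i] (l : Spec R ⟶ Y)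
    (h : l (IsLocalRing.closedPoint R) ∈ Set.range i) : Set.range l ⊆ Set.range i := by
  have : l ⁻¹ᵁ i.opensRange = ⊤ := (IsLocalRing.closedPoint_mem_iff (l ⁻¹ᵁ i.opensRange)).1 h
  rintro _ ⟨x, rfl⟩
  have hx : x ∈ l ⁻¹ᵁ i.opensRange := this ▸ TopologicalSpace.Opens.mem_top x
  exact hx

theorem eq_of_range_subset {A R F : CommRingCat.{u}} (ι : R ⟶ F) (hι : Function.Injective ι)
    (i : Spec A ⟶ Y) [IsOpenImmersion i] (l l' : Spec R ⟶ Y) (h : Set.range l ⊆ Set.range i)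
    (h' : Set.range l' ⊆ Set.range i) (hl : Spec.map ι ≫ l = Spec.map ι ≫ l') : l = l' := by
  obtain ⟨β, hβ⟩ := Spec.map_surjective (IsOpenImmersion.lift i l h)
  obtain ⟨β', hβ'⟩ := Spec.map_surjective (IsOpenImmersion.lift i l' h')
  rw [← IsOpenImmersion.lift_fac i l h, ← IsOpenImmersion.lift_fac i l' h', ← hβ, ← hβ'] at hl ⊢
  have h1 : Spec.map ι ≫ Spec.map β = Spec.map ι ≫ Spec.map β' := by
    rw [← cancel_mono i, Category.assoc, Category.assoc, hl]
  rw [← Spec.map_comp, ← Spec.map_comp] at h1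
  have h2 := Spec.map_injective h1
  congr 2
  ext a
  exact hι congr($(h2).hom a)

/-- Uniqueness half of the criterion for lifts in different charts. They agree on `Spec F`, which
therefore lands in the overlap; `hB` makes the resulting map on `B` take values in `R`, so both
lifts factor through the overlap and coincide. -/
theorem eq_of_range_subset_of_range_subset {R F : CommRingCat.{u}} (ι : R ⟶ F)
    (hι : Function.Injective ι)  [Subsingleton (Spec F)] [Nonempty (Spec F)]
    (hcomm : Spec.map φ₀ ≫ i₀ = Spec.map φ₁ ≫ i₁)
    [IsOpenImmersion (Spec.map φ₀)]
    (hinter : ∀ x y, i₀ x = i₁ y → ∃ w, Spec.map φ₀ w = x ∧ Spec.map φ₁ w = y)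
    (hB : ∀ γ : B ⟶ F, (∀ a, γ (φ₀ a) ∈ Set.range ι) → (∀ a, γ (φ₁ a) ∈ Set.range ι) →
      ∀ b, γ b ∈ Set.range ι)
    (l l' : Spec R ⟶ Y) (h : Set.range l ⊆ Set.range i₀) (h' : Set.range l' ⊆ Set.range i₁)
    (hl : Spec.map ι ≫ l = Spec.map ι ≫ l') : l = l' := by
  obtain ⟨β, hβ⟩ := Spec.map_surjective (IsOpenImmersion.lift i₀ l h)
  obtain ⟨β', hβ'⟩ := Spec.map_surjective (IsOpenImmersion.lift i₁ l' h')
  rw [← IsOpenImmersion.lift_fac i₀ l h, ← IsOpenImmersion.lift_fac i₁ l' h', ← hβ, ← hβ'] at hl ⊢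
  have hr : Set.range (Spec.map (β ≫ ι)) ⊆ Set.range (Spec.map φ₀) := by
    obtain ⟨x⟩ : Nonempty (Spec F) := inferInstance
    have hx : i₀ (Spec.map (β ≫ ι) x) = i₁ (Spec.map (β' ≫ ι) x) := by
      have := congr($hl x)
      simpa only [Spec.map_comp, Scheme.Hom.comp_apply] using this
    obtain ⟨w, hw, -⟩ := hinter _ _ hx
    rintro _ ⟨y, rfl⟩
    rw [Subsingleton.elim y x]
    exact ⟨w, hw⟩
  obtain ⟨γ, hγ⟩ := Spec.map_surjective (IsOpenImmersion.lift (Spec.map φ₀) _ hr)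
  have hγ₀ : φ₀ ≫ γ = β ≫ ι := by
    apply Spec.map_injective
    rw [Spec.map_comp, hγ, IsOpenImmersion.lift_fac]
  have hγ₁ : φ₁ ≫ γ = β' ≫ ι := by
    apply Spec.map_injective
    rw [← cancel_mono i₁, Spec.map_comp, Category.assoc, ← hcomm, ← Category.assoc, ← Spec.map_comp,
      hγ₀, Spec.map_comp, Category.assoc, hl, Spec.map_comp, Category.assoc]
  obtain ⟨δ, hδ⟩ := exists_comp_eq_of_mem_range ι hι γ
    (hB γ (fun a => ⟨β a, congr($(hγ₀).hom a).symm⟩) (fun a => ⟨β' a, congr($(hγ₁).hom a).symm⟩))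
  have e₀ : β = φ₀ ≫ δ := by
    ext a
    apply hι
    have := hγ₀
    rw [← hδ] at this
    exact congr($(this).hom a).symm
  have e₁ : β' = φ₁ ≫ δ := by
    ext a
    apply hι
    have := hγ₁
    rw [← hδ] at this
    exact congr($(this).hom a).symm
  rw [e₀, e₁, Spec.map_comp, Spec.map_comp, Category.assoc, Category.assoc, hcomm]

theorem isProper_of_charts [LocallyOfFiniteType s] [QuasiCompact s] [QuasiSeparated s]
    [IsOpenImmersion (Spec.map φ₀)]
    (hcomm : Spec.map φ₀ ≫ i₀ = Spec.map φ₁ ≫ i₁)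
    (hcover : ∀ y, y ∈ Set.range i₀ ∨ y ∈ Set.range i₁)
    (hinter : ∀ x y, i₀ x = i₁ y → ∃ w, Spec.map φ₀ w = x ∧ Spec.map φ₁ w = y)
    (h₀ : i₀ ≫ s = Spec.map σ₀) (h₁ : i₁ ≫ s = Spec.map σ₁) (hσ : σ₀ ≫ φ₀ = σ₁ ≫ φ₁)
    (hv₀ : ChartValuative σ₀ φ₀ φ₁) (hv₁ : ChartValuative σ₁ φ₁ φ₀)
    (hB : ∀ (R F : Type u) [CommRing R] [IsDomain R] [ValuationRing R] [Field F] [Algebra R F]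
      [IsFractionRing R F] (γ : B ⟶ .of F), (∀ a, γ (φ₀ a) ∈ Set.range (algebraMap R F)) →
      (∀ a, γ (φ₁ a) ∈ Set.range (algebraMap R F)) → ∀ b, γ b ∈ Set.range (algebraMap R F)) :
    IsProper s := by
  apply IsProper.of_valuativeCriterion
  rw [ValuativeCriterion.iff]
  refine ⟨fun S => ?_, fun S => ⟨fun l l' => ?_⟩⟩
  · have hsub : Subsingleton (Spec (.of S.K)) := inferInstanceAs (Subsingleton (PrimeSpectrum S.K))
    obtain ⟨x⟩ : Nonempty (Spec (.of S.K)) := inferInstance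
    have hx : ∀ U : Set Y, S.i₁ x ∈ U → Set.range S.i₁ ⊆ U := by
      rintro U hU _ ⟨y, rfl⟩
      rwa [Subsingleton.elim y x]
    rcases hcover (S.i₁ x) with h | h
    · exact exists_lift_of_chartValuative i₀ i₁ s hcomm h₀ h₁ hσ hv₀ S (hx _ h)
    · exact exists_lift_of_chartValuative i₁ i₀ s hcomm.symm h₁ h₀ hσ.symm hv₁ S (hx _ h)
  · have hsub : Subsingleton (Spec (.of S.K)) := inferInstanceAs (Subsingleton (PrimeSpectrum S.K))
    have hne : Nonempty (Spec (.of S.K)) := inferInstance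
    have hloc : IsLocalRing (CommRingCat.of S.R) := inferInstanceAs (IsLocalRing S.R)
    have hinj : Function.Injective (CommRingCat.ofHom (algebraMap S.R S.K)) :=
      IsFractionRing.injective S.R S.K
    ext1
    have hl : Spec.map (CommRingCat.ofHom (algebraMap S.R S.K)) ≫ l.l =
        Spec.map (CommRingCat.ofHom (algebraMap S.R S.K)) ≫ l'.l := l.fac_left.trans l'.fac_left.symm
    rcases hcover (l.l (IsLocalRing.closedPoint S.R)) with h | h <;>
    rcases hcover (l'.l (IsLocalRing.closedPoint S.R)) with h' | h'
    · exact eq_of_range_subset _ hinj i₀ _ _ (range_subset_of_closedPoint_mem _ _ h)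
        (range_subset_of_closedPoint_mem _ _ h') hl
    · exact eq_of_range_subset_of_range_subset i₀ i₁ _ hinj hcomm hinter (hB S.R S.K) _ _
        (range_subset_of_closedPoint_mem _ _ h) (range_subset_of_closedPoint_mem _ _ h') hl
    · exact (eq_of_range_subset_of_range_subset i₀ i₁ _ hinj hcomm hinter (hB S.R S.K) _ _
        (range_subset_of_closedPoint_mem _ _ h') (range_subset_of_closedPoint_mem _ _ h)
        hl.symm).symm
    · exact eq_of_range_subset _ hinj i₁ _ _ (range_subset_of_closedPoint_mem _ _ h)
        (range_subset_of_closedPoint_mem _ _ h') hl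

end Proper

/-! ### The complete nonsingular curve attached to a function field -/

section TwoCharts

variable {U V Y : Scheme.{u}} (i : U ⟶ Y) (j : V ⟶ Y)

theorem compactSpace_of_twoCharts [CompactSpace U] [CompactSpace V]
    (h : ∀ y, y ∈ Set.range i ∨ y ∈ Set.range j) : CompactSpace Y := by
  refine ⟨?_⟩
  have : (Set.univ : Set Y) = Set.range i ∪ Set.range j := by
    ext y; simpa using h y
  rw [this]
  exact (isCompact_range i.continuous).union (isCompact_range j.continuous)

variable [IsOpenImmersion i] [IsOpenImmersion j]

/-- The open cover of a scheme by two charts. -/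
def twoCover (h : ∀ y, y ∈ Set.range i ∨ y ∈ Set.range j) : Y.OpenCover :=
  Scheme.Cover.mkOfCovers Bool (fun b => bif b then U else V)
    (fun b => match b with
      | true => i
      | false => j)
    (fun y => by
      rcases h y with ⟨x, hx⟩ | ⟨x, hx⟩
      · exact ⟨true, x, hx⟩
      · exact ⟨false, x, hx⟩)
    (fun b => by
      cases b
      · exact inferInstanceAs (IsOpenImmersion j)
      · exact inferInstanceAs (IsOpenImmersion i))

theorem of_twoCharts (P : MorphismProperty Scheme.{u}) [IsZariskiLocalAtSource P]
    (h : ∀ y, y ∈ Set.range i ∨ y ∈ Set.range j) {S : Scheme.{u}} (s : Y ⟶ S) (hi : P (i ≫ s))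
    (hj : P (j ≫ s)) : P s := by
  rw [IsZariskiLocalAtSource.iff_of_openCover (P := P) (twoCover i j h)]
  rintro (_ | _)
  · exact hj
  · exact hi

theorem isIntegral_of_twoCharts [IsIntegral U] [IsIntegral V]
    (h : ∀ y, y ∈ Set.range i ∨ y ∈ Set.range j) (x : U) (x' : V) (hx : i x = j x') :
    IsIntegral Y := by
  have hred : IsReduced Y := by
    have : ∀ b, IsReduced ((twoCover i j h).X b) := by
      rintro (_ | _)
      · exact inferInstanceAs (IsReduced V)
      · exact inferInstanceAs (IsReduced U)
    exact IsReduced.of_openCover _ (twoCover i j h)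
  have hi : IsPreirreducible (Set.range i) := by
    rw [← Set.image_univ]
    exact (IrreducibleSpace.isIrreducible_univ _).2.image _ i.continuous.continuousOn
  have hj : IsPreirreducible (Set.range j) := by
    rw [← Set.image_univ]
    exact (IrreducibleSpace.isIrreducible_univ _).2.image _ j.continuous.continuousOn
  have hpre : PreirreducibleSpace Y := by
    refine PreirreducibleSpace.of_isOpenCover
      (U := fun b : Bool => bif b then i.opensRange else j.opensRange) ?_ ?_ ?_
    · have hnd : ¬ Disjoint i.opensRange j.opensRange := fun hd => by
        have : i x ∈ i.opensRange ⊓ j.opensRange := ⟨⟨x, rfl⟩, ⟨x', hx.symm⟩⟩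
        rw [disjoint_iff.1 hd] at this
        exact this
      rintro (_ | _) (_ | _) hne
      · exact absurd rfl hne
      · exact fun hd => hnd hd.symm
      · exact hnd
      · exact absurd rfl hne
    · rw [TopologicalSpace.IsOpenCover, eq_top_iff]
      intro y _
      rcases h y with hy | hy
      · exact TopologicalSpace.Opens.mem_iSup.2 ⟨true, hy⟩
      · exact TopologicalSpace.Opens.mem_iSup.2 ⟨false, hy⟩
    · rintro (_ | _)
      · exact Subtype.preirreducibleSpace hj
      · exact Subtype.preirreducibleSpace hi
  have : IrreducibleSpace Y := { toNonempty := ⟨i x⟩ }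
  exact isIntegral_of_irreducibleSpace_of_isReduced _

end TwoCharts

section NormalCurve

variable {k E : Type u} [Field k] [Field E] [Algebra k E]

theorem normalRingMap_algebraMap {s t : Set E} (h : s ⊆ t) (c : k) :
    normalRingMap k h (algebraMap k _ c) = algebraMap k _ c := Subtype.ext <| by
  rw [coe_normalRingMap, Subalgebra.coe_algebraMap, Subalgebra.coe_algebraMap]

/-- In a valuation ring either `v` or `v⁻¹` is integral. If `α v` lies in `R`, so does the image of
the whole integral closure. If not, `α v` is non-zero, `α` extends to the overlap, and the inverse
of `α v` lies in `R`. -/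
theorem chartValuative_normalRing {v w : E} (hv : v ≠ 0) (hw : w = v⁻¹) {t : Set E}
    (ht : t = {v, v⁻¹}) (h : {v} ⊆ t) (h' : {w} ⊆ t) :
    ChartValuative (CommRingCat.ofHom (algebraMap k (normalRing k {v})))
      (CommRingCat.ofHom (normalRingMap k h)) (CommRingCat.ofHom (normalRingMap k h')) := by
  intro R F _ _ _ _ _ _ α hα
  by_cases hvR : α (normalGen k v (Set.mem_singleton v)) ∈ Set.range (algebraMap R F)
  · left
    exact mem_range_of_normalRing α.hom hα fun x hx => by
      obtain rfl : x = v := hx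
      exact hvR
  · right
    have hα0 : α (normalGen k v (Set.mem_singleton v)) ≠ 0 := fun h0 =>
      hvR ⟨0, by rw [map_zero, h0]⟩
    obtain ⟨γ, hγ⟩ := exists_comp_eq_of_injective (normalRingMap k h) _ (normalRingMap_injective h)
      (isUnit_normalRingMap hv ht h) (exists_normalRingMap_pow_mul_eq hv ht h) α.hom hα0
    refine ⟨CommRingCat.ofHom γ, CommRingCat.hom_ext hγ, ?_⟩
    refine mem_range_of_normalRing (γ.comp (normalRingMap k h')) (fun c => ?_) fun x hx => ?_
    · have h1 : γ (normalRingMap k h (algebraMap k _ c)) = α.hom (algebraMap k _ c) :=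
        RingHom.congr_fun hγ _
      rw [RingHom.comp_apply, normalRingMap_algebraMap, ← normalRingMap_algebraMap h, h1]
      exact hα c
    · have hxw : x = w := hx
      have h1 : normalRingMap k h (normalGen k v (Set.mem_singleton v)) *
          normalRingMap k h' (normalGen k x hx) = 1 := Subtype.ext <| by
        rw [Subalgebra.coe_mul, coe_normalRingMap, coe_normalRingMap, coe_normalGen, coe_normalGen,
          hxw, hw, mul_inv_cancel₀ hv, Subalgebra.coe_one]
      have h2 : γ (normalRingMap k h (normalGen k v (Set.mem_singleton v))) =
          α.hom (normalGen k v (Set.mem_singleton v)) := RingHom.congr_fun hγ _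
      have h3 := congrArg γ h1
      rw [map_mul γ, h2, map_one] at h3
      rw [RingHom.comp_apply, eq_inv_of_mul_eq_one_right h3]
      rcases ValuationRing.isInteger_or_isInteger R (α (normalGen k v (Set.mem_singleton v)))
        with h3 | h3
      · exact absurd h3 hvR
      · exact h3

theorem smooth_normalRing [CharZero k] {v : E} (hv : Transcendental k v)
    [FiniteDimensional (IntermediateField.adjoin k {v}) E] :
    SmoothOfRelativeDimension 1
      (Spec.map (CommRingCat.ofHom (algebraMap k (normalRing k {v})))) := by
  obtain ⟨h1, h2, -, h3⟩ := normalRing_isDedekindDomain hv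
  rw [HasRingHomProperty.Spec_iff (P := @SmoothOfRelativeDimension 1)]
  exact locally_isStandardSmooth h3

/-- The curve is the normalization of the projective line in `E`: the spectra of the integral
closures of `k[v]` and `k[v⁻¹]`, glued along that of `k[v, v⁻¹]`. -/
theorem exists_curve [CharZero k] {v : E} (hv : Transcendental k v)
    [hfin : FiniteDimensional (IntermediateField.adjoin k {v}) E] :
    ∃ (Y : Curve k), Nonempty (Y.functionField ≃ₐ[k] E) := by
  have hv0 : v ≠ 0 := fun h => hv (h ▸ isAlgebraic_zero)
  have hw : Transcendental k v⁻¹ := fun h => hv (by simpa using h.inv)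
  have hadj : IntermediateField.adjoin k {v⁻¹} = IntermediateField.adjoin k {v} := by
    apply le_antisymm
    · rw [IntermediateField.adjoin_simple_le_iff]
      exact inv_mem (IntermediateField.mem_adjoin_simple_self k v)
    · rw [IntermediateField.adjoin_simple_le_iff]
      simpa using inv_mem (IntermediateField.mem_adjoin_simple_self k v⁻¹)
  have hfin' : FiniteDimensional (IntermediateField.adjoin k {v⁻¹}) E := hadj ▸ hfin
  obtain ⟨hft, hded, hfrac, -⟩ := normalRing_isDedekindDomain hv
  have ht : ({v, v⁻¹} : Set E) = {v, v⁻¹} := rfl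
  have ht' : ({v, v⁻¹} : Set E) = {v⁻¹, v⁻¹⁻¹} := by rw [inv_inv, Set.pair_comm]
  have h₀ : ({v} : Set E) ⊆ {v, v⁻¹} := by simp
  have h₁ : ({v⁻¹} : Set E) ⊆ {v, v⁻¹} := by simp
  let σ₀ := CommRingCat.ofHom (algebraMap k (normalRing k {v}))
  let σ₁ := CommRingCat.ofHom (algebraMap k (normalRing k {v⁻¹}))
  let φ₀ := CommRingCat.ofHom (normalRingMap k h₀)
  let φ₁ := CommRingCat.ofHom (normalRingMap k h₁)
  have hφ₀ : IsOpenImmersion (Spec.map φ₀) := isOpenImmersion_normalRingMap hv0 ht h₀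
  have hφ₁ : IsOpenImmersion (Spec.map φ₁) := isOpenImmersion_normalRingMap (inv_ne_zero hv0) ht' h₁
  have hσ : σ₀ ≫ φ₀ = σ₁ ≫ φ₁ := by
    refine CommRingCat.hom_ext (RingHom.ext fun c => ?_)
    exact (normalRingMap_algebraMap h₀ c).trans (normalRingMap_algebraMap h₁ c).symm
  obtain ⟨Y, i₀, i₁, hi₀, hi₁, hcomm, hcover, hinter, hdesc⟩ :=
    exists_glue (Spec.map φ₀) (Spec.map φ₁)
  obtain ⟨s, hs₀, hs₁⟩ := hdesc _ (Spec.map σ₀) (Spec.map σ₁)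
    (by rw [← Spec.map_comp, ← Spec.map_comp, hσ])
  have hsm : SmoothOfRelativeDimension 1 s := by
    have : IsZariskiLocalAtSource (@SmoothOfRelativeDimension.{u} 1) :=
      HasRingHomProperty.instIsZariskiLocalAtSource
        (Q := RingHom.Locally (RingHom.IsStandardSmoothOfRelativeDimension 1))
    refine of_twoCharts i₀ i₁ (@SmoothOfRelativeDimension 1) hcover s ?_ ?_
    · rw [hs₀]; exact smooth_normalRing hv
    · rw [hs₁]; exact smooth_normalRing hw
  have hsm' : Smooth s := SmoothOfRelativeDimension.smooth 1 s
  have hint : IsIntegral Y := by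
    obtain ⟨b⟩ : Nonempty (Spec (.of (normalRing k ({v, v⁻¹} : Set E)))) := inferInstance
    exact isIntegral_of_twoCharts i₀ i₁ hcover (Spec.map φ₀ b) (Spec.map φ₁ b) congr($hcomm b)
  have hcpt : CompactSpace Y := compactSpace_of_twoCharts i₀ i₁ hcover
  have hnoeth : IsLocallyNoetherian Y := LocallyOfFiniteType.isLocallyNoetherian s
  have hqc : QuasiCompact s := (quasiCompact_iff_compactSpace s).2 hcpt
  have hqs : QuasiSeparated s := inferInstance
  have hprop : IsProper s := by
    refine isProper_of_charts i₀ i₁ s hcomm hcover hinter hs₀ hs₁ hσ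
      (chartValuative_normalRing hv0 rfl ht h₀ h₁)
      (chartValuative_normalRing (inv_ne_zero hv0) (inv_inv v).symm ht' h₁ h₀) ?_
    intro R F _ _ _ _ _ _ γ hγ₀ hγ₁
    refine mem_range_of_normalRing γ.hom (fun c => ?_) fun x hx => ?_
    · rw [← normalRingMap_algebraMap h₀ c]
      exact hγ₀ _
    · rcases hx with rfl | hx
      · have : normalGen k x (Set.mem_insert x _) =
            normalRingMap k h₀ (normalGen k x (Set.mem_singleton x)) := Subtype.ext <| by
          rw [coe_normalRingMap, coe_normalGen, coe_normalGen]
        rw [this]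
        exact hγ₀ _
      · have hx' : x ∈ ({v, v⁻¹} : Set E) := Or.inr hx
        have : normalGen k x hx' = normalRingMap k h₁ (normalGen k x hx) :=
          Subtype.ext <| by rw [coe_normalRingMap, coe_normalGen, coe_normalGen]
        rw [this]
        exact hγ₁ _
  let Z : Curve k := { scheme := Y, toSpec := s }
  refine ⟨Z, ?_⟩
  let j : Spec (.of (normalRing k {v})) ⟶ Z.scheme := i₀
  have hj : IsOpenImmersion j := hi₀
  let f : normalRing k {v} →+* Z.functionField := chartMap (Z := Z.scheme) j
  let _ : Algebra (normalRing k {v}) Z.functionField := f.toAlgebra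
  have hinj : Function.Injective f := chartMap_injective j
  have hZ : IsFractionRing (normalRing k {v}) Z.functionField := by
    have : FaithfulSMul (normalRing k {v}) Z.functionField :=
      (faithfulSMul_iff_algebraMap_injective _ _).2 hinj
    refine IsFractionRing.of_field _ _ fun z => ?_
    obtain ⟨a, b, -, hz⟩ := exists_chartMap_div (Z := Z.scheme) j z
    exact ⟨a, b, hz⟩
  let e := IsLocalization.algEquiv (nonZeroDivisors (normalRing k {v})) Z.functionField E
  refine ⟨AlgEquiv.ofRingEquiv (f := e.toRingEquiv) fun c => ?_⟩
  have h1 : f (algebraMap k _ c) = algebraMap k Z.functionField c :=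
    Curve.chartMap_constant (X := Z) j σ₀ hs₀.symm c
  rw [← h1]
  exact (e.commutes _).trans rfl

end NormalCurve

/-! ### Local rings of curves -/

-- Some `dt` generates the differentials, since otherwise they would all lie in the maximal ideal
-- times a generator. Then `R` is unramified over a localization of `k[t]` at a prime, so its
-- maximal ideal is extended from a principal one; a Noetherian local domain with principal maximal
-- ideal is a valuation ring.
open IsLocalRing in
theorem valuationRing_of_kaehlerDifferential (k R : Type u) [Field k] [CommRing R] [IsDomain R]
    [IsLocalRing R] [IsNoetherianRing R] [Algebra k R] [Algebra.EssFiniteType k R]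
    (e : Ω[R⁄k] ≃ₗ[R] R) : ValuationRing R := by
  obtain ⟨t, ht⟩ : ∃ t : R, IsUnit (e (KaehlerDifferential.D k R t)) := by
    by_contra! h
    have h1 : Submodule.span R (Set.range (KaehlerDifferential.D k R)) ≤
        Submodule.comap e.toLinearMap (maximalIdeal R) := by
      rw [Submodule.span_le]
      rintro _ ⟨t, rfl⟩
      exact h t
    rw [KaehlerDifferential.span_range_derivation] at h1
    have h2 : (1 : R) ∈ maximalIdeal R := by
      simpa using h1 (Submodule.mem_top (x := e.symm 1))
    exact (Ideal.ne_top_iff_one _).1 (maximalIdeal.isMaximal R).ne_top h2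
  let _ : Algebra (Polynomial k) R := (Polynomial.aeval (R := k) t).toRingHom.toAlgebra
  have hX : algebraMap (Polynomial k) R Polynomial.X = t := Polynomial.aeval_X t
  have : IsScalarTower k (Polynomial k) R :=
    IsScalarTower.of_algebraMap_eq fun c => ((Polynomial.aeval t).commutes c).symm
  have hu : Algebra.FormallyUnramified (Polynomial k) R := by
    constructor
    refine subsingleton_of_forall_eq 0 fun z => ?_
    obtain ⟨y, rfl⟩ := KaehlerDifferential.map_surjective k (Polynomial k) R z
    have hy : y = (e y * ht.unit⁻¹) • KaehlerDifferential.D k R t := by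
      apply e.injective
      rw [map_smul, smul_eq_mul, mul_assoc, IsUnit.val_inv_mul, mul_one]
    have h0 : KaehlerDifferential.D (Polynomial k) R t = 0 := by
      rw [← hX, Derivation.map_algebraMap]
    rw [hy, map_smul, KaehlerDifferential.map_D, Algebra.algebraMap_self_apply, h0, smul_zero]
  let p := (maximalIdeal R).comap (algebraMap (Polynomial k) R)
  let S := Localization.AtPrime p
  let _ : Algebra S R := (IsLocalization.lift (M := p.primeCompl) (S := S)
    (g := algebraMap (Polynomial k) R) fun y => by
      simpa [p, Ideal.primeCompl] using y.2).toAlgebra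
  have : IsScalarTower (Polynomial k) S R := IsScalarTower.of_algebraMap_eq fun c =>
    (IsLocalization.lift_eq _ c).symm
  have : IsScalarTower k S R := IsScalarTower.of_algebraMap_eq fun c => by
    rw [IsScalarTower.algebraMap_apply k (Polynomial k) S,
      ← IsScalarTower.algebraMap_apply (Polynomial k) S R,
      ← IsScalarTower.algebraMap_apply k (Polynomial k) R]
  have : Algebra.FormallyUnramified S R := .of_restrictScalars (Polynomial k) _ _
  have : Algebra.EssFiniteType S R := .of_comp k _ _
  have hloc : IsLocalHom (algebraMap S R) := by
    refine ⟨fun z hz => ?_⟩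
    obtain ⟨a, b, rfl⟩ := IsLocalization.exists_mk'_eq p.primeCompl z
    rw [IsLocalization.AtPrime.isUnit_mk'_iff S p]
    have h1 : algebraMap S R (IsLocalization.mk' S a b) * algebraMap (Polynomial k) R b =
        algebraMap (Polynomial k) R a := by
      rw [IsScalarTower.algebraMap_apply (Polynomial k) S R, ← map_mul, IsLocalization.mk'_spec,
        ← IsScalarTower.algebraMap_apply]
    have h2 : IsUnit (algebraMap (Polynomial k) R b) := by
      simpa [p, Ideal.primeCompl] using b.2
    have h3 : IsUnit (algebraMap (Polynomial k) R a) := h1 ▸ hz.mul h2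
    simpa [p, Ideal.primeCompl] using h3
  have hmax := Algebra.FormallyUnramified.map_maximalIdeal (R := S) (S := R)
  have hS : IsPrincipalIdealRing S := inferInstance
  have hpr : (maximalIdeal R).IsPrincipal := by
    obtain ⟨s, hs⟩ := hS.principal (maximalIdeal S)
    rw [← hmax, hs]
    exact ⟨algebraMap S R s, by
      rw [Ideal.submodule_span_eq, Ideal.submodule_span_eq, Ideal.map_span, Set.image_singleton]⟩
  exact ((tfae_of_isNoetherianRing_of_isLocalRing_of_isDomain R).out 1 4).2 hpr

theorem valuationRing_localization (k A : Type u) [Field k] [CommRing A] [IsDomain A] [Algebra k A]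
    [Algebra.IsStandardSmoothOfRelativeDimension 1 k A] (q : Ideal A) [q.IsPrime] :
    ValuationRing (Localization.AtPrime q) := by
  have : Algebra.IsStandardSmooth k A :=
    Algebra.IsStandardSmoothOfRelativeDimension.isStandardSmooth 1
  let R := Localization.AtPrime q
  have : Algebra.EssFiniteType A R := .of_isLocalization R q.primeCompl
  have : Algebra.EssFiniteType k R := .comp k A R
  have : IsNoetherianRing A := Algebra.FiniteType.isNoetherianRing k A
  have : IsNoetherianRing R := IsLocalization.isNoetherianRing q.primeCompl R inferInstance
  have : IsDomain R := IsLocalization.isDomain_localization q.primeCompl_le_nonZeroDivisors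
  have : Algebra.FormallyEtale A R := Algebra.FormallyEtale.of_isLocalization q.primeCompl
  have e := KaehlerDifferential.tensorKaehlerEquivOfFormallyEtale k A R
  have hr : Module.finrank R Ω[R⁄k] = 1 := by
    rw [← e.finrank_eq, Module.finrank_baseChange]
    exact Module.finrank_eq_of_rank_eq
      (Algebra.IsStandardSmoothOfRelativeDimension.rank_kaehlerDifferential 1)
  have : Module.Free R Ω[R⁄k] := .of_equiv e
  have : Module.Finite R Ω[R⁄k] := inferInstance
  exact valuationRing_of_kaehlerDifferential k R
    (LinearEquiv.ofFinrankEq Ω[R⁄k] R (by rw [hr, Module.finrank_self]))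

namespace Curve

variable {k : Type u} [Field k] (X : Curve k)

instance valuationRing_stalk (x : X.scheme) : ValuationRing (X.scheme.presheaf.stalk x) := by
  obtain ⟨A, _, j, _, φ, -, ⟨y, rfl⟩, hs⟩ := X.exists_chart x
  let _ : Algebra k A := φ.hom.toAlgebra
  have : Algebra.IsStandardSmoothOfRelativeDimension 1 k A := hs
  have : y.asIdeal.IsPrime := PrimeSpectrum.isPrime y
  have : ValuationRing (Localization.AtPrime y.asIdeal) := valuationRing_localization k A y.asIdeal
  let _ : Algebra A ((Spec A).presheaf.stalk y) := StructureSheaf.stalkAlgebra A y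
  have : IsLocalization.AtPrime ((Spec A).presheaf.stalk y) y.asIdeal :=
    StructureSheaf.IsLocalization.to_stalk A y
  have e₁ : Localization.AtPrime y.asIdeal ≃+* (Spec A).presheaf.stalk y :=
    (IsLocalization.algEquiv y.asIdeal.primeCompl (Localization.AtPrime y.asIdeal)
      ((Spec A).presheaf.stalk y)).toRingEquiv
  have e₂ : (Spec A).presheaf.stalk y ≃+* X.scheme.presheaf.stalk (j y) :=
    (asIso (j.stalkMap y)).commRingCatIsoToRingEquiv.symm
  exact Function.Surjective.valuationRing (e₁.trans e₂).toRingHom (e₁.trans e₂).surjective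

/-- The inclusion of the generic point, relative to the base. -/
theorem fromSpecStalk_toSpec :
    X.scheme.fromSpecStalk (genericPoint X.scheme) ≫ X.toSpec =
      Spec.map (CommRingCat.ofHom (algebraMap k X.functionField)) := by
  have h : X.scheme.fromSpecStalk (genericPoint X.scheme) ≫ X.toSpec =
      Spec.map ((Scheme.ΓSpecIso (.of k)).inv ≫ X.toSpec.appTop ≫
        X.scheme.presheaf.germ ⊤ (genericPoint X.scheme) (TopologicalSpace.Opens.mem_top _)) := by
    rw [Spec.map_comp, Spec.map_comp, ← Scheme.fromSpecStalk_toSpecΓ,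
      Category.assoc (X.scheme.fromSpecStalk _),
      ← Scheme.toSpecΓ_naturality, Category.assoc, Category.assoc,
      ← SpecMap_ΓSpecIso_hom, ← Spec.map_comp, Iso.inv_hom_id, Spec.map_id, Category.comp_id]
  exact h

end Curve

/-! ### Morphisms of curves and their function fields -/

theorem fromSpecStalk_comp {X Y : Scheme.{u}} [IsIntegral X] [IsIntegral Y] (f : X ⟶ Y)
    [IsDominant f] : X.fromSpecStalk (genericPoint X) ≫ f =
      Spec.map (CommRingCat.ofHom (pullbackFun f)) ≫ Y.fromSpecStalk (genericPoint Y) := by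
  have h : CommRingCat.ofHom (pullbackFun f) =
    Y.presheaf.stalkSpecializes (specializes_of_eq (map_genericPoint f)) ≫
      f.stalkMap (genericPoint X) := rfl
  rw [h, Spec.map_comp, Category.assoc, Scheme.SpecMap_stalkSpecializes_fromSpecStalk,
    Scheme.SpecMap_stalkMap_fromSpecStalk]

/-- Agreement at the generic point spreads to a non-empty open set, which is dense, and
separatedness does the rest. -/
theorem eq_of_fromSpecStalk_eq {X Y S : Scheme.{u}} [IsIntegral X] (s : Y ⟶ S) [IsSeparated s]
    (f g : X ⟶ Y) (hs : f ≫ s = g ≫ s)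
    (h : X.fromSpecStalk (genericPoint X) ≫ f = X.fromSpecStalk (genericPoint X) ≫ g) : f = g := by
  obtain ⟨U, hU, he⟩ := spread_out_unique_of_isGermInjective' f g h
  have hd : Dense (U : Set X) := U.2.dense ⟨_, hU⟩
  have : IsDominant U.ι := ⟨by simpa [DenseRange] using hd⟩
  exact ext_of_isDominant_of_isSeparated s hs U.ι he

theorem exists_hom_of_domain_eq_top {X Y : Scheme.{u}} [IrreducibleSpace X] (p : X.PartialMap Y)
    (hp : p.domain = ⊤) : ∃ m : X ⟶ Y,
      X.fromSpecStalk (genericPoint X) ≫ m = p.fromFunctionField := by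
  obtain ⟨U, hU, f⟩ := p
  obtain rfl : U = ⊤ := hp
  refine ⟨X.topIso.inv ≫ f, ?_⟩
  have h1 : X.fromSpecStalk (genericPoint X) ≫ X.topIso.inv =
      Scheme.Opens.fromSpecStalkOfMem ⊤ (genericPoint X)
        (TopologicalSpace.Opens.mem_top _) := by
    rw [← cancel_mono (Scheme.Opens.ι ⊤), Category.assoc, Scheme.Opens.fromSpecStalkOfMem_ι,
      ← Scheme.topIso_hom, Iso.inv_hom_id, Category.comp_id]
  rw [← Category.assoc, h1]
  rfl

theorem fromSpecStalk_genericPoint {X : Scheme.{u}} [IrreducibleSpace X]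
    (z : Spec (X.presheaf.stalk (genericPoint X))) :
    X.fromSpecStalk (genericPoint X) z = genericPoint X := by
  have h : X.fromSpecStalk (genericPoint X) z ⤳ genericPoint X := by
    have : X.fromSpecStalk (genericPoint X) z ∈ Set.range (X.fromSpecStalk (genericPoint X)) :=
      ⟨z, rfl⟩
    rwa [Scheme.range_fromSpecStalk] at this
  exact (h.antisymm ((genericPoint_spec X).specializes (Set.mem_univ _))).eq

theorem isDominant_of_fromSpecStalk {X Y : Scheme.{u}} [IrreducibleSpace X] [IrreducibleSpace Y]
    (m : X ⟶ Y)
    (g : Spec (X.presheaf.stalk (genericPoint X)) ⟶ Spec (Y.presheaf.stalk (genericPoint Y)))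
    (hm : X.fromSpecStalk (genericPoint X) ≫ m = g ≫ Y.fromSpecStalk (genericPoint Y)) :
    IsDominant m := by
  have h : genericPoint Y ∈ Set.range m := by
    let z : Spec (X.presheaf.stalk (genericPoint X)) :=
      IsLocalRing.closedPoint (X.presheaf.stalk (genericPoint X))
    have h1 : (X.fromSpecStalk (genericPoint X) ≫ m) z = genericPoint Y := by
      rw [hm, Scheme.Hom.comp_apply, fromSpecStalk_genericPoint]
    rw [Scheme.Hom.comp_apply] at h1
    exact ⟨_, h1⟩
  refine ⟨dense_iff_closure_eq.2 (Set.eq_univ_of_univ_subset ?_)⟩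
  rw [← (genericPoint_spec Y).def]
  exact closure_mono (Set.singleton_subset_iff.2 h)

theorem fromFunctionField_eq {X Y : Scheme.{u}} [IrreducibleSpace X] (p : X.PartialMap Y) {x : X}
    (hx : x ∈ p.domain) : p.fromFunctionField =
      Spec.map (X.presheaf.stalkSpecializes ((genericPoint_spec X).specializes (Set.mem_univ x))) ≫
        p.fromSpecStalkOfMem hx := by
  rw [Scheme.PartialMap.fromFunctionField, Scheme.PartialMap.fromSpecStalkOfMem,
    Scheme.PartialMap.fromSpecStalkOfMem, ← Category.assoc]
  congr 1
  rw [← cancel_mono p.domain.ι, Category.assoc, Scheme.Opens.fromSpecStalkOfMem_ι,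
    Scheme.Opens.fromSpecStalkOfMem_ι, Scheme.SpecMap_stalkSpecializes_fromSpecStalk]

theorem exists_lift_of_isProper {Y S : Scheme.{u}} (s : Y ⟶ S) [IsProper s] {R K : CommRingCat.{u}}
    [IsDomain R] [ValuationRing R] (hK : IsField K) (φ : R ⟶ K)
    (hφ : letI := φ.hom.toAlgebra; IsFractionRing R K) (i₁ : Spec K ⟶ Y) (i₂ : Spec R ⟶ S)
    (h : i₁ ≫ s = Spec.map φ ≫ i₂) : ∃ l : Spec R ⟶ Y, Spec.map φ ≫ l = i₁ ∧ l ≫ s = i₂ := by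
  let _ : Field K := hK.toField
  let _ : Algebra R K := φ.hom.toAlgebra
  let S : ValuativeCommSq s :=
    { R := R, K := K, isFractionRing := hφ, i₁ := i₁, i₂ := i₂, commSq := ⟨h⟩ }
  have hS : S.commSq.HasLift := by
    have h1 : IsProper s := inferInstance
    rw [IsProper.eq_valuativeCriterion] at h1
    exact (ValuativeCriterion.iff.1 h1.1.1.1).1 S
  exact ⟨S.commSq.lift, S.commSq.fac_left, S.commSq.fac_right⟩

namespace Curve

variable {k : Type u} [Field k] (X Y : Curve k)

/-- A rational map from a smooth curve to a proper one is defined everywhere: each local ring is a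
valuation ring, so the valuative criterion extends the map over it, and the extension spreads to a
neighbourhood. -/
theorem exists_hom_of_fromFunctionField
    (f : Spec X.scheme.functionField ⟶ Y.scheme)
    (h : f ≫ Y.toSpec = X.scheme.fromSpecStalk _ ≫ X.toSpec) :
    ∃ m : X.scheme ⟶ Y.scheme, X.scheme.fromSpecStalk (genericPoint X.scheme) ≫ m = f := by
  have hsep : Y.scheme.IsSeparated :=
⟨by
    rw [← terminal.comp_from Y.toSpec]
    infer_instance⟩
  let F := Scheme.RationalMap.ofFunctionField X.toSpec Y.toSpec f h
  have hF : F.domain = ⊤ := by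
    rw [eq_top_iff]
    intro x _
    have hs := (genericPoint_spec X.scheme).specializes (Set.mem_univ x)
    obtain ⟨l, hl, h2⟩ := exists_lift_of_isProper Y.toSpec (Field.toIsField X.scheme.functionField)
      (X.scheme.presheaf.stalkSpecializes hs)
      (inferInstanceAs (IsFractionRing (X.scheme.presheaf.stalk x) X.scheme.functionField)) f
      (X.scheme.fromSpecStalk x ≫ X.toSpec) (by
        rw [h, ← Category.assoc, Scheme.SpecMap_stalkSpecializes_fromSpecStalk])
    have hx := Scheme.PartialMap.mem_domain_ofFromSpecStalk X.toSpec Y.toSpec l h2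
    refine Scheme.RationalMap.mem_domain.2
      ⟨.ofFromSpecStalk X.toSpec Y.toSpec l h2, hx, ?_⟩
    apply Scheme.RationalMap.eq_of_fromFunctionField_eq
    rw [Scheme.RationalMap.fromFunctionField_ofFunctionField,
      Scheme.RationalMap.fromFunctionField_toRationalMap, fromFunctionField_eq _ hx,
      Scheme.PartialMap.fromSpecStalkOfMem_ofFromSpecStalk, hl]
  obtain ⟨m, hm⟩ := exists_hom_of_domain_eq_top F.toPartialMap hF
  refine ⟨m, hm.trans ?_⟩
  rw [← Scheme.RationalMap.fromFunctionField_toRationalMap,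
    Scheme.RationalMap.toRationalMap_toPartialMap,
    Scheme.RationalMap.fromFunctionField_ofFunctionField]

variable {X Y}

theorem exists_nonconstHom (ψ : Y.functionField →ₐ[k] X.functionField) :
    ∃ m : NonconstHom X Y, m.onFun = ψ.toRingHom := by
  let Ψ : Y.scheme.functionField ⟶ X.scheme.functionField := CommRingCat.ofHom ψ.toRingHom
  have h1 : CommRingCat.ofHom (algebraMap k Y.functionField) ≫ CommRingCat.ofHom ψ.toRingHom =
      CommRingCat.ofHom (algebraMap k X.functionField) :=
    CommRingCat.hom_ext (RingHom.ext fun c => ψ.commutes c)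
  obtain ⟨m, hm⟩ := exists_hom_of_fromFunctionField X Y
    (Spec.map Ψ ≫ Y.scheme.fromSpecStalk _) (by
      rw [Category.assoc, fromSpecStalk_toSpec, fromSpecStalk_toSpec, ← h1, Spec.map_comp]
      rfl)
  have hw : m ≫ Y.toSpec = X.toSpec := by
    refine eq_of_fromSpecStalk_eq (terminal.from _) _ _ (terminal.hom_ext _ _) ?_
    rw [← Category.assoc, hm, Category.assoc, fromSpecStalk_toSpec, fromSpecStalk_toSpec, ← h1,
      Spec.map_comp]
    rfl
  have hdom : IsDominant m := isDominant_of_fromSpecStalk m (Spec.map Ψ) hm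
  refine ⟨⟨m, hw⟩, ?_⟩
  have h2 := fromSpecStalk_comp m
  rw [hm, cancel_mono] at h2
  exact congr($(Spec.map_injective h2).hom).symm

end Curve

/-! ### Degrees and intermediate fields -/

section Fields

/-- Finiteness is essential, as `Module.finrank` is 0 for infinite extensions. -/
theorem two_le_finrank {F L : Type*} [Field F] [Field L] [Algebra F L] [FiniteDimensional F L]
    (h : ¬ Function.Surjective (algebraMap F L)) : 2 ≤ Module.finrank F L := by
  have h0 : 0 < Module.finrank F L := Module.finrank_pos
  rcases Nat.lt_or_ge (Module.finrank F L) 2 with h2 | h2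
  · have h1 : Module.finrank F L = 1 := by omega
    refine absurd (fun x => ?_) h
    obtain ⟨c, hc⟩ := (finrank_eq_one_iff_of_nonzero' (1 : L) one_ne_zero).1 h1 x
    exact ⟨c, by rw [← hc, Algebra.smul_def, mul_one]⟩
  · exact h2

theorem not_surjective_of_two_le_finrank {F L : Type*} [Field F] [Field L] [Algebra F L]
    (h : 2 ≤ Module.finrank F L) : ¬ Function.Surjective (algebraMap F L) := fun hs => by
  have e : F ≃ₗ[F] L := LinearEquiv.ofBijective (Algebra.linearMap F L)
    ⟨(algebraMap F L).injective, hs⟩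
  rw [← e.finrank_eq, Module.finrank_self] at h
  omega

theorem finite_toAlgebra_of_range_eq {k F L : Type*} [Field k] [Field F] [Field L] [Algebra k L]
    (φ : F →+* L) (E : IntermediateField k L) (h : ∀ x, x ∈ E ↔ x ∈ Set.range φ)
    [FiniteDimensional E L] : letI := φ.toAlgebra; FiniteDimensional F L := by
  let _ := φ.toAlgebra
  let e : F ≃+* E := RingEquiv.ofBijective (φ.codRestrict E.toSubfield fun x => (h _).2 ⟨x, rfl⟩)
    ⟨fun x y hxy => φ.injective congr(($hxy : L)), fun x => by
      obtain ⟨y, hy⟩ := (h _).1 x.2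
      exact ⟨y, Subtype.ext hy⟩⟩
  exact Module.Finite.of_equiv_equiv e.symm (RingEquiv.refl L) (RingHom.ext fun x => by
    exact congrArg Subtype.val (e.apply_symm_apply x))

open IntermediateField in
theorem finiteDimensional_adjoin_intermediateField {k L : Type*} [Field k] [Field L] [Algebra k L]
    (E : IntermediateField k L) (v : E) [FiniteDimensional k⟮(v : L)⟯ L] :
    FiniteDimensional k⟮v⟯ E := by
  have h1 : k⟮v⟯.map E.val = k⟮(v : L)⟯ := by
    rw [adjoin_map, Set.image_singleton]; rfl
  have : FiniteDimensional k⟮v⟯ L := by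
    refine finite_toAlgebra_of_range_eq (algebraMap k⟮v⟯ L) k⟮(v : L)⟯ fun x => ?_
    rw [← h1, mem_map]
    constructor
    · rintro ⟨y, hy, rfl⟩
      exact ⟨⟨y, hy⟩, rfl⟩
    · rintro ⟨y, rfl⟩
      exact ⟨y, y.2, rfl⟩
  exact FiniteDimensional.left k⟮v⟯ E L

end Fields

/-! ### Old forms and intermediate fields -/

namespace Curve

open KaehlerDifferential

variable {k : Type u} [Field k] {X Y : Curve k}

/-- The inclusion of function fields, as a homomorphism of `k`-algebras. -/
def NonconstHom.onFunAlgHom (m : NonconstHom X Y) : Y.functionField →ₐ[k] X.functionField :=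
  { m.onFun with commutes' := m.onFun_algebraMap }

/-- The function `v` makes `k(X)`, and hence `E`, finite over `k(v)`, so `E` is the function field
of a curve. -/
theorem exists_nonconstHom_of_intermediateField [CharZero k] (E : IntermediateField k X.functionField)
    {v : X.functionField} (hvE : v ∈ E) (hv : D k X.functionField v ≠ 0) :
    ∃ (Y : Curve k) (m : NonconstHom X Y), ∀ x, x ∈ E ↔ x ∈ Set.range m.onFun := by
  have h1 := X.isFunctionField.finiteDimensional_adjoin hv
  have h2 : FiniteDimensional (IntermediateField.adjoin k {(⟨v, hvE⟩ : E)}) E :=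
    finiteDimensional_adjoin_intermediateField E ⟨v, hvE⟩
  have h3 : Transcendental k (⟨v, hvE⟩ : E) := fun h =>
    transcendental_of_D_ne_zero hv (h.algHom E.val)
  obtain ⟨Y, ⟨e⟩⟩ := exists_curve h3
  obtain ⟨m, hm⟩ := exists_nonconstHom (X := X) (Y := Y) (E.val.comp e.toAlgHom)
  refine ⟨Y, m, fun x => ?_⟩
  rw [hm]
  constructor
  · intro hx
    exact ⟨e.symm ⟨x, hx⟩, congrArg Subtype.val (e.apply_symm_apply ⟨x, hx⟩)⟩
  · rintro ⟨y, rfl⟩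
    exact (e y).2

theorem isOld_of_intermediateField [CharZero k] (E : IntermediateField k X.functionField)
    [FiniteDimensional E X.functionField] (hE : E ≠ ⊤) {u v : X.functionField} (hu : u ∈ E)
    (hv : v ∈ E) (hω : u • D k X.functionField v ≠ 0) : X.IsOld (u • D k X.functionField v) := by
  have hv0 : D k X.functionField v ≠ 0 := fun h => hω (by rw [h, smul_zero])
  obtain ⟨Y, m, h⟩ := exists_nonconstHom_of_intermediateField E hv hv0
  obtain ⟨u', rfl⟩ := (h _).1 hu
  obtain ⟨v', rfl⟩ := (h _).1 hv
  refine ⟨Y, m, u' • D k Y.functionField v', ?_, formMap_smul_D k k _ _ _ _⟩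
  let _ : Algebra Y.functionField X.functionField := m.onFun.toAlgebra
  have : FiniteDimensional Y.functionField X.functionField := finite_toAlgebra_of_range_eq m.onFun E h
  refine two_le_finrank fun hs => hE ?_
  rw [eq_top_iff]
  intro x _
  exact (h x).2 (hs x)

theorem NonconstHom.onFun_not_surjective (m : NonconstHom X Y) (h : 2 ≤ m.degree) :
    ¬ Function.Surjective m.onFun :=
  letI : Algebra Y.functionField X.functionField := m.onFun.toAlgebra
  not_surjective_of_two_le_finrank (F := Y.functionField) (L := X.functionField) h

theorem exists_form_eq (X : Curve k) (ω : X.Form) :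
    ∃ h t : X.functionField, D k X.functionField t ≠ 0 ∧ ω = h • D k X.functionField t := by
  obtain ⟨t, ht⟩ := X.isFunctionField.exists_D_ne_zero
  obtain ⟨h, hh⟩ := X.isFunctionField.exists_eq_smul ht ω
  exact ⟨h, t, ht, hh⟩

/-! ### Descent from `X_K` to `X` -/

section Descent

variable {C : Type u} [Field C] [IsAlgClosed C] (K : Type u) [Field K] [Algebra C K] (X : Curve C)

theorem nonempty_specialization : letI := X.algebraBaseChange K
    Nonempty (Specialization C K X.functionField (X.baseChange K).functionField) := by
  let _ := X.algebraBaseChange K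
  let _ := X.algebraConstants K
  have : IsScalarTower C K (X.baseChange K).functionField :=
    IsScalarTower.of_algebraMap_eq fun _ => rfl
  have : IsScalarTower C X.functionField (X.baseChange K).functionField :=
    IsScalarTower.of_algebraMap_eq fun c => (X.baseChangeFun_algebraMap K c).symm
  exact (X.isFracTensor K).nonempty_specialization

theorem baseChangeForm_smul_D (h t : X.functionField) :
    X.baseChangeForm K (h • D C X.functionField t) = X.baseChangeFun K h •
      D K (X.baseChange K).functionField (X.baseChangeFun K t) :=
  formMap_smul_D C K _ _ h t

variable {X}

theorem isExact_of_baseChange {ω : X.Form} (h : (X.baseChange K).IsExact (X.baseChangeForm K ω)) :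
    X.IsExact ω := by
  let _ := X.algebraBaseChange K
  obtain ⟨S⟩ := X.nonempty_specialization K
  obtain ⟨h, t, ht, rfl⟩ := X.exists_form_eq ω
  obtain ⟨f, hf⟩ := h
  rw [baseChangeForm_smul_D] at hf
  exact S.exists_exact X.isFunctionField ht hf

theorem isExponential_of_baseChange {ω : X.Form}
    (h : (X.baseChange K).IsExponential (X.baseChangeForm K ω)) : X.IsExponential ω := by
  let _ := X.algebraBaseChange K
  obtain ⟨S⟩ := X.nonempty_specialization K
  obtain ⟨h, t, ht, rfl⟩ := X.exists_form_eq ω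
  obtain ⟨f, c, hf0, hc0, hf⟩ := h
  rw [baseChangeForm_smul_D] at hf
  exact S.exists_exponential X.isFunctionField ht hf0 hc0 hf

theorem isWeierstrass_of_baseChange {ω : X.Form}
    (h : (X.baseChange K).IsWeierstrass (X.baseChangeForm K ω)) : X.IsWeierstrass ω := by
  let _ := X.algebraBaseChange K
  obtain ⟨S⟩ := X.nonempty_specialization K
  obtain ⟨h, t, ht, rfl⟩ := X.exists_form_eq ω
  obtain ⟨f, g, a, b, hg0, hab, hfg, hf⟩ := h
  rw [baseChangeForm_smul_D] at hf
  exact S.exists_weierstrass X.isFunctionField ht hg0 hab hfg hf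

/-- If `ω_K` were `0 d0`, specializing that identity would give `ω = 0`. -/
theorem baseChangeForm_ne_zero {ω : X.Form} (hω : ω ≠ 0) : X.baseChangeForm K ω ≠ 0 := by
  intro h0
  let _ := X.algebraBaseChange K
  obtain ⟨S⟩ := X.nonempty_specialization K
  obtain ⟨h, t, ht, rfl⟩ := X.exists_form_eq ω
  rw [baseChangeForm_smul_D] at h0
  have h1 := S.eventually_form_eq X.isFunctionField ht (x := 0) (y := 0)
    (h0.trans (zero_smul _ _).symm) (x' := fun _ => 0) (y' := fun _ => 0)
    (by rw [map_zero]; rfl) (by rw [map_zero]; rfl)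
  obtain ⟨i, hi⟩ := h1.exists
  exact hω (hi.trans (zero_smul _ _))

theorem isOld_of_baseChange [CharZero C] {ω : X.Form} (hω : ω ≠ 0)
    (h : (X.baseChange K).IsOld (X.baseChangeForm K ω)) : X.IsOld ω := by
  let _ := X.algebraBaseChange K
  let _ := X.algebraConstants K
  have : IsScalarTower C K (X.baseChange K).functionField :=
    IsScalarTower.of_algebraMap_eq fun _ => rfl
  have : IsScalarTower C X.functionField (X.baseChange K).functionField :=
    IsScalarTower.of_algebraMap_eq fun c => (X.baseChangeFun_algebraMap K c).symm
  have : CharZero K := charZero_of_injective_algebraMap (algebraMap C K).injective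
  obtain ⟨S⟩ := X.nonempty_specialization K
  have h0 := baseChangeForm_ne_zero K hω
  obtain ⟨h, t, ht, rfl⟩ := X.exists_form_eq ω
  obtain ⟨Y, m, η, hdeg, hη⟩ := h
  obtain ⟨u, v, -, rfl⟩ := Y.exists_form_eq η
  have h1 : m.pullbackForm (u • D K Y.functionField v) =
    m.onFun u • D K (X.baseChange K).functionField (m.onFun v) := formMap_smul_D K K _ _ u v
  rw [h1] at hη
  have hv : D K (X.baseChange K).functionField (m.onFun v) ≠ 0 := fun hv => h0 (by
    rw [← hη, hv, smul_zero])
  have hfin := (X.baseChange K).isFunctionField.finiteDimensional_adjoin hv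
  rw [baseChangeForm_smul_D] at hη
  -- The image of `K(Y)` contains `v`, so it is an intermediate field over `K(v)`; it is proper
  -- because the degree is at least two.
  let F := m.onFunAlgHom.fieldRange
  have hF : IntermediateField.adjoin K {m.onFun v} ≤ F := by
    rw [IntermediateField.adjoin_simple_le_iff]
    exact ⟨v, rfl⟩
  have hmem : ∀ x, x ∈ IntermediateField.extendScalars hF ↔ x ∈ Set.range m.onFun := fun x => Iff.rfl
  obtain ⟨E, u', v', hE, hu', hv', hEfin, huv⟩ :=
    S.exists_old (X.isFracTensor K) X.isFunctionField hω
      (IntermediateField.extendScalars hF) (fun htop => m.onFun_not_surjective hdeg fun x => by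
        rw [← Set.mem_range, ← hmem, htop]
        trivial) ((hmem _).2 ⟨u, rfl⟩) hη.symm
  rw [huv] at hω ⊢
  exact isOld_of_intermediateField E hE hu' hv' hω

end Descent

end Curve

/-! ### Base change of morphisms of curves -/

/-- If `θ` is not in the image of `F`, an `F`-linear functional `l` on `L` kills 1 but not `θ`. Were
`θ` in the image of `F'`, clearing denominators would give `θ q = p` with `p`, `q` from `F ⊗ K`, and
applying `l ⊗ id` would give `l(θ) q = 0`, hence `q = 0`. -/
theorem IsFracTensor.surjective_of_surjective {C K F L F' M : Type u} [Field C] [Field K] [Field F]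
    [Field L] [Field F'] [Field M] [Algebra C K] [Algebra C F] [Algebra C F'] [Algebra K F']
    [Algebra F F'] [IsScalarTower C K F'] [IsScalarTower C F F'] [Algebra C L] [Algebra C M]
    [Algebra K M] [Algebra L M] [IsScalarTower C K M] [IsScalarTower C L M]
    (HF : IsFracTensor C K F F') (HL : IsFracTensor C K L M) (ψ : F →ₐ[C] L) (φ : F' →+* M)
    (h₁ : ∀ a, φ (algebraMap F F' a) = algebraMap L M (ψ a))
    (h₂ : ∀ c, φ (algebraMap K F' c) = algebraMap K M c) (hφ : Function.Surjective φ) :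
    Function.Surjective ψ := by
  intro θ
  by_contra hθ
  let _ : Algebra F L := ψ.toRingHom.toAlgebra
  have : IsScalarTower C F L := IsScalarTower.of_algebraMap_eq fun c => (ψ.commutes c).symm
  have hθ' : θ ∉ Submodule.span F {(1 : L)} := fun h => by
    obtain ⟨a, rfl⟩ := Submodule.mem_span_singleton.1 h
    exact hθ ⟨a, by rw [Algebra.smul_def, mul_one]; rfl⟩
  obtain ⟨l, hl, hl1⟩ := Submodule.exists_le_ker_of_notMem hθ'
  have hl1 : l 1 = 0 := hl1 (Submodule.mem_span_singleton_self 1)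
  obtain ⟨z, hz⟩ := hφ (algebraMap L M θ)
  obtain ⟨p, q, hq, hpq⟩ := HF.frac z
  let ψ' : F ⊗[C] K →ₐ[C] L ⊗[C] K := Algebra.TensorProduct.map ψ (AlgHom.id C K)
  have hcomm : ∀ y, φ (Algebra.TensorProduct.productMap
      (IsScalarTower.toAlgHom C F F') (IsScalarTower.toAlgHom C K F') y) =
      Algebra.TensorProduct.productMap
      (IsScalarTower.toAlgHom C L M) (IsScalarTower.toAlgHom C K M) (ψ' y) := by
    intro y
    induction y with
    | zero => simp
    | tmul a c => simp [ψ', h₁, h₂]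
    | add x y hx hy => rw [map_add, map_add, hx, hy, map_add, map_add]
  have h3 : (θ ⊗ₜ[C] (1 : K)) * ψ' q = ψ' p := by
    apply HL.inj
    rw [map_mul, ← hcomm, ← hcomm, ← hpq, map_mul, hz]
    simp
  let l' : L ⊗[C] K →ₗ[C] F ⊗[C] K := (l.restrictScalars C).rTensor K
  have h4 : ∀ y, l' (ψ' y) = 0 := by
    intro y
    induction y with
    | zero => simp
    | tmul a c =>
      have : l (ψ a) = 0 := by
        have := l.map_smul a 1
        rw [hl1, smul_zero, Algebra.smul_def, mul_one] at this
        exact this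
      simp [ψ', l', this]
    | add x y hx hy => rw [map_add, map_add, hx, hy, add_zero]
  have h5 : ∀ y, l' ((θ ⊗ₜ[C] (1 : K)) * ψ' y) = (l θ ⊗ₜ[C] (1 : K)) * y := by
    intro y
    induction y with
    | zero => simp
    | tmul a c =>
      have : l (θ * ψ a) = l θ * a := by
        have := l.map_smul a θ
        rw [Algebra.smul_def, smul_eq_mul, mul_comm, mul_comm a] at this
        exact this
      simp [ψ', l', this]
    | add x y hx hy => rw [map_add, mul_add, map_add, hx, hy, mul_add]
  have h6 : (l θ ⊗ₜ[C] (1 : K)) * q = 0 := by rw [← h5, h3, h4]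
  apply hq
  have h7 : ((l θ)⁻¹ ⊗ₜ[C] (1 : K)) * ((l θ ⊗ₜ[C] (1 : K)) * q) = q := by
    rw [← mul_assoc, Algebra.TensorProduct.tmul_mul_tmul, inv_mul_cancel₀ hl, one_mul,
      ← Algebra.TensorProduct.one_def, one_mul]
  rw [← h7, h6, mul_zero]

namespace Curve

open KaehlerDifferential

section

variable {k : Type u} [Field k] {X Y : Curve k}

theorem NonconstHom.two_le_degree [CharZero k] (m : NonconstHom X Y) {v : Y.functionField}
    (hv : D k X.functionField (m.onFun v) ≠ 0) (h : ¬ Function.Surjective m.onFun) :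
    2 ≤ m.degree := by
  let _ : Algebra Y.functionField X.functionField := m.onFun.toAlgebra
  have hfin := X.isFunctionField.finiteDimensional_adjoin hv
  have hF : IntermediateField.adjoin k {m.onFun v} ≤ m.onFunAlgHom.fieldRange := by
    rw [IntermediateField.adjoin_simple_le_iff]
    exact ⟨v, rfl⟩
  have : FiniteDimensional (IntermediateField.extendScalars hF) X.functionField :=
    FiniteDimensional.right (IntermediateField.adjoin k {m.onFun v}) _ _
  have : FiniteDimensional Y.functionField X.functionField :=
    finite_toAlgebra_of_range_eq m.onFun (IntermediateField.extendScalars hF) fun x => Iff.rfl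
  exact two_le_finrank h

instance (m : NonconstHom X Y) : Surjective m.hom := by
  have h1 : IsProper (m.hom ≫ Y.toSpec) := m.w ▸ X.proper
  have h2 : IsProper m.hom := IsProper.of_comp m.hom Y.toSpec
  refine ⟨fun y => ?_⟩
  have h3 : IsClosed (Set.range m.hom) := m.hom.isClosedMap.isClosed_range
  have h4 := m.hom.denseRange.closure_range
  rw [h3.closure_eq] at h4
  exact (Set.ext_iff.1 h4 y).2 (Set.mem_univ y)

end

variable {C : Type u} [Field C] [IsAlgClosed C] (K : Type u) [Field K] [Algebra C K]
  {X Y : Curve C}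

/-- The base change `m_K : X_K → Y_K` of a morphism of curves. -/
def NonconstHom.baseChange (m : NonconstHom X Y) :
    NonconstHom (X.baseChange K) (Y.baseChange K) where
  hom := pullback.map _ _ _ _ m.hom (𝟙 _) (𝟙 _) (by rw [Category.comp_id, m.w]) (by simp)
  w := (pullback.lift_snd _ _ _).trans (Category.comp_id _)
  dominant := by
    have h1 : IsPullback (pullback.fst X.toSpec (Spec.map (CommRingCat.ofHom (algebraMap C K))))
        (pullback.map X.toSpec (Spec.map (CommRingCat.ofHom (algebraMap C K))) Y.toSpec
          (Spec.map (CommRingCat.ofHom (algebraMap C K))) m.hom (𝟙 _) (𝟙 _)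
          (by rw [Category.comp_id, m.w]) (by simp)) m.hom (pullback.fst _ _) := by
      refine IsPullback.of_bot ?_ (pullback.lift_fst _ _ _).symm
        (IsPullback.of_hasPullback Y.toSpec _)
      convert! IsPullback.of_hasPullback X.toSpec _ using 1
      · exact (pullback.lift_snd _ _ _).trans (Category.comp_id _)
      · exact m.w
    -- A dominant morphism of curves is surjective by properness, and surjectivity is stable under
    -- base change.
    have h2 : Surjective (pullback.map X.toSpec (Spec.map (CommRingCat.ofHom (algebraMap C K)))
        Y.toSpec (Spec.map (CommRingCat.ofHom (algebraMap C K))) m.hom (𝟙 _) (𝟙 _)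
        (by rw [Category.comp_id, m.w]) (by simp)) :=
      MorphismProperty.of_isPullback (P := @Surjective) h1 inferInstance
    exact ⟨h2.surj.denseRange⟩

theorem NonconstHom.baseChange_proj (m : NonconstHom X Y) :
    (m.baseChange K).hom ≫ Y.proj K = X.proj K ≫ m.hom := pullback.lift_fst _ _ _

theorem NonconstHom.baseChange_onFun (m : NonconstHom X Y) (f : Y.functionField) :
    (m.baseChange K).onFun (Y.baseChangeFun K f) = X.baseChangeFun K (m.onFun f) := by
  have h1 := pullbackFun_comp (m.baseChange K).hom (Y.proj K) f
  have h2 := pullbackFun_comp (X.proj K) m.hom f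
  rw [pullbackFun_congr (m.baseChange_proj K)] at h1
  exact h1.symm.trans h2

theorem isOld_baseChange [CharZero C] {ω : X.Form} (hω : ω ≠ 0) (h : X.IsOld ω) :
    (X.baseChange K).IsOld (X.baseChangeForm K ω) := by
  obtain ⟨Y, m, η, hdeg, rfl⟩ := h
  obtain ⟨u, v, -, rfl⟩ := Y.exists_form_eq η
  have h1 : m.pullbackForm (u • D C Y.functionField v) =
    m.onFun u • D C X.functionField (m.onFun v) := formMap_smul_D C C _ _ u v
  rw [h1] at hω ⊢
  have h2 := baseChangeForm_ne_zero K hω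
  rw [baseChangeForm_smul_D, ← m.baseChange_onFun K, ← m.baseChange_onFun K] at h2 ⊢
  have : CharZero K := charZero_of_injective_algebraMap (algebraMap C K).injective
  refine ⟨Y.baseChange K, m.baseChange K,
    Y.baseChangeFun K u • D K (Y.baseChange K).functionField (Y.baseChangeFun K v), ?_,
    formMap_smul_D K K _ _ _ _⟩
  refine (m.baseChange K).two_le_degree (fun h => h2 (by rw [h, smul_zero])) fun hs =>
    m.onFun_not_surjective hdeg ?_
  let _ := X.algebraBaseChange K
  let _ := X.algebraConstants K
  have : IsScalarTower C K (X.baseChange K).functionField :=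
    IsScalarTower.of_algebraMap_eq fun _ => rfl
  have : IsScalarTower C X.functionField (X.baseChange K).functionField :=
    IsScalarTower.of_algebraMap_eq fun c => (X.baseChangeFun_algebraMap K c).symm
  let _ := Y.algebraBaseChange K
  let _ := Y.algebraConstants K
  have : IsScalarTower C K (Y.baseChange K).functionField :=
    IsScalarTower.of_algebraMap_eq fun _ => rfl
  have : IsScalarTower C Y.functionField (Y.baseChange K).functionField :=
    IsScalarTower.of_algebraMap_eq fun c => (Y.baseChangeFun_algebraMap K c).symm
  exact (Y.isFracTensor K).surjective_of_surjective (X.isFracTensor K) m.onFunAlgHom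
    (m.baseChange K).onFun (m.baseChange_onFun K) (m.baseChange K).onFun_algebraMap hs

/-! ### Ascent of exact, exponential and Weierstrass forms -/

theorem isExact_baseChange {ω : X.Form} (h : X.IsExact ω) :
    (X.baseChange K).IsExact (X.baseChangeForm K ω) := by
  obtain ⟨f, rfl⟩ := h
  refine ⟨X.baseChangeFun K f, ?_⟩
  rw [← one_smul X.functionField (X.d f), baseChangeForm_smul_D, map_one, one_smul]

theorem isExponential_baseChange {ω : X.Form} (h : X.IsExponential ω) :
    (X.baseChange K).IsExponential (X.baseChangeForm K ω) := by
  obtain ⟨f, c, hf, hc, rfl⟩ := h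
  refine ⟨X.baseChangeFun K f, algebraMap C K c, (map_ne_zero _).2 hf, (map_ne_zero _).2 hc, ?_⟩
  rw [baseChangeForm_smul_D, map_inv₀, map_mul, baseChangeFun_algebraMap]

theorem isWeierstrass_baseChange {ω : X.Form} (h : X.IsWeierstrass ω) :
    (X.baseChange K).IsWeierstrass (X.baseChangeForm K ω) := by
  obtain ⟨f, g, a, b, hg, hab, hfg, rfl⟩ := h
  refine ⟨X.baseChangeFun K f, X.baseChangeFun K g, algebraMap C K a, algebraMap C K b,
    (map_ne_zero _).2 hg, ?_, ?_, ?_⟩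
  · have := (map_ne_zero (algebraMap C K)).2 hab
    rwa [map_add, map_mul, map_mul, map_pow, map_pow, map_ofNat, map_ofNat] at this
  · rw [← map_pow, hfg, map_add, map_add, map_mul, map_pow, baseChangeFun_algebraMap,
      baseChangeFun_algebraMap]
  · rw [baseChangeForm_smul_D, map_inv₀]

end Curve

end OneForms

end

theorem proposition4p2 {C : Type u} [Field C] [IsAlgClosed C] [CharZero C]
    (K : Type u) [Field K] [Algebra C K]
    (X : OneForms.Curve C) (ω : X.Form) (hω : ω ≠ 0) :
    (X.IsExact ω ↔ (X.baseChange K).IsExact (X.baseChangeForm K ω)) ∧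
    (X.IsExponential ω ↔ (X.baseChange K).IsExponential (X.baseChangeForm K ω)) ∧
    (X.IsWeierstrass ω ↔ (X.baseChange K).IsWeierstrass (X.baseChangeForm K ω)) ∧
    (X.IsGeneral ω ↔ (X.baseChange K).IsGeneral (X.baseChangeForm K ω)) ∧
    (X.IsOld ω ↔ (X.baseChange K).IsOld (X.baseChangeForm K ω)) := by
  have h1 : X.IsExact ω ↔ (X.baseChange K).IsExact (X.baseChangeForm K ω) :=
    ⟨OneForms.Curve.isExact_baseChange K, OneForms.Curve.isExact_of_baseChange K⟩
  have h2 : X.IsExponential ω ↔ (X.baseChange K).IsExponential (X.baseChangeForm K ω) :=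
    ⟨OneForms.Curve.isExponential_baseChange K, OneForms.Curve.isExponential_of_baseChange K⟩
  have h3 : X.IsWeierstrass ω ↔ (X.baseChange K).IsWeierstrass (X.baseChangeForm K ω) :=
    ⟨OneForms.Curve.isWeierstrass_baseChange K, OneForms.Curve.isWeierstrass_of_baseChange K⟩
  exact ⟨h1, h2, h3, and_congr (not_congr h1) (and_congr (not_congr h2) (not_congr h3)),
    OneForms.Curve.isOld_baseChange K hω, OneForms.Curve.isOld_of_baseChange K hω⟩
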